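/- Let $w_0,w_1\in\mathbb C$ with $w_0\neq w_1$, put $\Lambda=\tfrac14(w_0-w_1)^2$ and $v=-\Lambda$, and consider the GKZ curve $\Sigma=\{(y-w_0)(y-w_1)-x=0\}$ of equivariant $\mathbb{CP}^1$, parametrized by $x(z)=z^2-\Lambda$, $y(z)=z+\tfrac12(w_0+w_1)$, with covering involution $\sigma(z)=-z$, ramification point $z=0$ (over the turning point $x=v$) and 1-form $\omega=y\,dx/x$. **WKB solution.** Let $Q_0(x)=\frac{4x+(w_0-w_1)^2}{4x^2}$ and $Q_2(x)=-\frac1{4x^2}$. Let $P^{(\pm)}=\sum_{n\ge0}\hbar^{n-1}P^{(\pm)}_n$ be the formal solutions of $\hbar^2(P^2+\frac{dP}{dx})=Q_0+\hbar^2Q_2$ with $P_0^{(\pm)}=\pm\sqrt{Q_0}$, where $\sqrt{Q_0}=z/x(z)$ on $\Sigma$, and let $P_{\rm odd}=\frac12(P^{(+)}-P^{(-)})$. The WKB solutions of $\big[(\hbar x\frac{d}{dx}-w_0)(\hbar x\frac{d}{dx}-w_1)-x\big]\psi=0$ normalized at the turning point are $$\psi_\pm=\frac{\exp\big(\frac{w_0+w_1-\hbar}{2\hbar}\log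 x\big)}{\sqrt{P_{\rm odd}}}\exp\Big(\pm\int_v^xP_{\rm odd}\,dx'\Big)=\exp\Big(\frac1\hbar S_0^{(\pm)}\Big)\sum_{n\ge0}\hbar^{n+\frac12}\psi_n^{(\pm)},\qquad \int_v^xP_{\rm odd}\,dx'=\frac12\int_{\gamma_x}P_{\rm odd}\,dx',$$ where $\gamma_x$ is a path on $\Sigma\setminus\{z=0,\ x=0\}$ from $\sigma(z)$ to $z$. They are considered on a simply connected open set $V$ of the $z$-plane that contains neither $z=0$ nor a point with $x(z)=0$, with continuous branches of $\log x$ and of the square root $\sqrt{z/x(z)}$ (the leading part of $\sqrt{P_{\rm odd}}$), and with paths that form a $C^1$ family in dependence on $z\in V$. **Topological recursion wave function.** Let $B(z_1,z_2)=\frac{dz_1dz_2}{(z_1-z_2)^2}$, $\omega_1^{(0)}=0$, $\omega_2^{(0)}=B$, and for $(g,n+1)\ne(0,1),(0,2)$, with $N=\{1,\dots,n\}$, $$\omega^{(g)}_{n+1}(z,\boldsymbol z_N)=\mathop{\rm Res}_{w=0}\frac{\frac12\int_{-w}^{w}B(\cdot,z)}{\omega(w)-\omega(-w)}\Big(\omega^{(g-1)}_{n+2}(w,-w,\boldsymbol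 z_N)+\sum_{\ell=0}^g\sum_{J\subseteq N}\omega^{(g-\ell)}_{|J|+1}(w,\boldsymbol z_J)\,\omega^{(\ell)}_{n-|J|+1}(-w,\boldsymbol z_{N\setminus J})\Big).$$ The wave function with integration divisor $D=[u]-[\infty]$ is $$\psi_{\rm TR}([u]-[\infty])=\exp\Big(\sum_{m\ge0}\hbar^{m-1}F_m\Big),\qquad F_m=\sum_{\substack{g\ge0,\,n\ge1\\2g-1+n=m}}\frac1{n!}F^{(g)}_n(u,\dots,u),$$ $$F_n^{(g)}(u,\dots,u)=\int_\infty^u\cdots\int_\infty^u\omega_n^{(g)}\quad(2g-2+n>0),$$ where $F_1^{(0)}=\int_\infty^u\omega$ and $F_2^{(0)}(u,u)=\int_\infty^u\int_\infty^u\big(B-\frac{dx_1dx_2}{(x_1-x_2)^2}\big)$ are divergent, are regularized by constants (which may depend on the reference point before it tends to $\infty$, but not on $u$), and are thus determined up to additive constants. **Statement.** For each sign $\pm$, all coefficients $\psi^{(\pm)}_n$, $n\ge0$, tend to $0$ as $x\to\infty$ in $V$, and the WKB solution agrees, as a formal series in $\hbar$, with the wave function with divisor $[\pm z]-[\infty]$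 up to the overall factor $\hbar^{1/2}$: there is a regularization of $F_1^{(0)}$ and $F_2^{(0)}$ such that on $V$ $$\psi_\pm(x(z),\hbar)=\hbar^{1/2}\,\psi_{\rm TR}([\pm z]-[\infty]),$$ and for every regularization there are constants $c_0,c_1\in\mathbb C$, independent of $z$ and $\hbar$, such that on $V$ $$\psi_\pm(x(z),\hbar)=\hbar^{1/2}\,e^{c_0/\hbar+c_1}\,\psi_{\rm TR}([\pm z]-[\infty]).$$ -/

import Mathlib

noncomputable section

namespace EquivariantCP1

/-! ### The spectral curve `(y - w₀)(y - w₁) = x`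

The curve is the Riemann sphere with coordinate `z`; the only finite ramification point of `x` is
`z = 0`, lying over the turning point `v = -(w₀ - w₁)² / 4`, and the covering involution is
`σ(z) = -z`. Functions and differentials on the curve are written in the coordinate `z`. -/

/-- The constant `Λ = (w₀ - w₁)² / 4`. -/
def Lam (w₀ w₁ : ℂ) : ℂ := (w₀ - w₁) ^ 2 / 4

/-- `x(z) = z² - Λ`. -/
def curveX (w₀ w₁ z : ℂ) : ℂ := z ^ 2 - Lam w₀ w₁

/-- `y(z) = z + (w₀ + w₁) / 2`. -/
def curveY (w₀ w₁ z : ℂ) : ℂ := z + (w₀ + w₁) / 2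

theorem curve_equation (w₀ w₁ z : ℂ) :
    (curveY w₀ w₁ z - w₀) * (curveY w₀ w₁ z - w₁) - curveX w₀ w₁ z = 0 := by
  unfold curveY curveX Lam; ring

theorem hasDerivAt_curveX (w₀ w₁ z : ℂ) : HasDerivAt (curveX w₀ w₁) (2 * z) z := by
  have h := (hasDerivAt_pow 2 z).sub_const (Lam w₀ w₁)
  have e : curveX w₀ w₁ = fun x => x ^ 2 - Lam w₀ w₁ := rfl
  rw [e]
  simpa using h

/-- The curve with the ramification point, the two points over `x = 0`, and the point
at infinity removed. -/
def puncturedCurve (w₀ w₁ : ℂ) : Set ℂ := {z | z ≠ 0 ∧ curveX w₀ w₁ z ≠ 0}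

/-! ### Formal WKB series -/

/-- The formal expression `exp (phase(z) / ħ) · ħ ^ order · ∑ₙ ħⁿ ampₙ(z)`, where `ampₙ(z)` is the
`n`-th coefficient of the power series `amp z`. -/
structure FormalWKB where
  phase : ℂ → ℂ
  order : ℚ
  amp : ℂ → PowerSeries ℂ

namespace FormalWKB

/-- Multiplication by the factor `ħ ^ ρ · exp (c₀ / ħ + c₁)`, which does not depend on the point. -/
def scale (ρ : ℚ) (c₀ c₁ : ℂ) (ψ : FormalWKB) : FormalWKB where
  phase z := ψ.phase z + c₀
  order := ψ.order + ρ
  amp z := PowerSeries.C (Complex.exp c₁) * ψ.amp z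

/-- Substitution `z ↦ f z` of the point of the curve. -/
def comp (ψ : FormalWKB) (f : ℂ → ℂ) : FormalWKB where
  phase z := ψ.phase (f z)
  order := ψ.order
  amp z := ψ.amp (f z)

/-- Equality of formal WKB series, coefficient by coefficient, at all points of `V`. -/
def EqOn (ψ φ : FormalWKB) (V : Set ℂ) : Prop :=
  ψ.order = φ.order ∧ ∀ z ∈ V, ψ.phase z = φ.phase z ∧ ψ.amp z = φ.amp z

end FormalWKB

/-- The power series `exp (∑_{m ≥ 1} ħ^m aₘ)`; the value `a 0` is not used. -/
def expSeries (a : ℕ → ℂ) : PowerSeries ℂ :=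
  (PowerSeries.exp ℂ).subst (PowerSeries.mk fun m => if m = 0 then 0 else a m)

/-! ### The WKB solution normalized at the turning point -/

/-- `Q₀(x) = (4x + (w₀ - w₁)²) / (4x²)`. -/
def Q0 (w₀ w₁ x : ℂ) : ℂ := (4 * x + (w₀ - w₁) ^ 2) / (4 * x ^ 2)

/-- `Q₂(x) = -1 / (4x²)`, so that the potential is `Q = Q₀ + ħ² Q₂`. -/
def Q2 (x : ℂ) : ℂ := -1 / (4 * x ^ 2)

/-- The function `√Q₀` on the curve. It takes opposite values at `z` and `σ(z) = -z`, and behaves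
like `(w₀ - w₁) / (2x)` at the point `z = (w₀ - w₁) / 2` over `x = 0`. -/
def sqrtQ0 (w₀ w₁ z : ℂ) : ℂ := z / curveX w₀ w₁ z

theorem sqrtQ0_sq (w₀ w₁ z : ℂ) : sqrtQ0 w₀ w₁ z ^ 2 = Q0 w₀ w₁ (curveX w₀ w₁ z) := by
  unfold sqrtQ0 Q0
  by_cases h : curveX w₀ w₁ z = 0
  · simp [h]
  · field_simp
    unfold curveX Lam
    ring

/-- The derivation `d/dx` on functions on the curve. -/
def ddx (w₀ w₁ : ℂ) (f : ℂ → ℂ) (z : ℂ) : ℂ := deriv f z / deriv (curveX w₀ w₁) z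

/-- The coefficients `Pₙ` (as functions on the curve) of the formal solution
`P = ∑ₙ ħ^(n-1) Pₙ` of the Riccati equation `ħ² (P² + dP/dx) = Q` with leading term
`P₀ = ε √Q₀`, where `ε = 1` for `P⁽⁺⁾` and `ε = -1` for `P⁽⁻⁾`. -/
def riccati (w₀ w₁ ε : ℂ) : ℕ → ℂ → ℂ
  | 0 => fun z => ε * sqrtQ0 w₀ w₁ z
  | n + 1 => fun z =>
      1 / (2 * (ε * sqrtQ0 w₀ w₁ z)) *
        ((if n = 1 then Q2 (curveX w₀ w₁ z) else 0)
          - ∑ i : Fin n, riccati w₀ w₁ ε (i + 1) z * riccati w₀ w₁ ε (n - i) z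
          - ddx w₀ w₁ (riccati w₀ w₁ ε n) z)
  termination_by n => n

/-- The coefficients of `P_odd = (P⁽⁺⁾ - P⁽⁻⁾) / 2 = ∑ₙ ħ^(n-1) P_odd,ₙ`. -/
def Podd (w₀ w₁ : ℂ) (n : ℕ) (z : ℂ) : ℂ :=
  (riccati w₀ w₁ 1 n z - riccati w₀ w₁ (-1) n z) / 2

/-- A `C¹` family of paths on the punctured curve: the path with index `z ∈ V` leads from
`σ(z) = -z` to `z`; it therefore makes a half turn about the ramification point. -/
structure TurningPointPaths (w₀ w₁ : ℂ) (V : Set ℂ) where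
  path : ℂ → ℝ → ℂ
  velocity : ℂ → ℝ → ℂ
  hasDeriv : ∀ z ∈ V, ∀ t ∈ Set.Icc (0 : ℝ) 1,
    HasDerivWithinAt (path z) (velocity z t) (Set.Icc 0 1) t
  continuousOn_path : ContinuousOn (fun p : ℂ × ℝ => path p.1 p.2) (V ×ˢ Set.Icc 0 1)
  continuousOn_velocity : ContinuousOn (fun p : ℂ × ℝ => velocity p.1 p.2) (V ×ˢ Set.Icc 0 1)
  source : ∀ z ∈ V, path z 0 = -z
  target : ∀ z ∈ V, path z 1 = z
  mem_punctured : ∀ z ∈ V, ∀ t ∈ Set.Icc (0 : ℝ) 1, path z t ∈ puncturedCurve w₀ w₁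

/-- `∫_v^x f dx := ½ ∫_{γₓ} f dx`, at the point `z` of the curve over `x`. -/
def turningPointIntegral {w₀ w₁ : ℂ} {V : Set ℂ} (γ : TurningPointPaths w₀ w₁ V)
    (f : ℂ → ℂ) (z : ℂ) : ℂ :=
  1 / 2 * ∫ t in (0 : ℝ)..1,
    f (γ.path z t) * deriv (curveX w₀ w₁) (γ.path z t) * γ.velocity z t

/-- The formal series
`(1/√P_odd) · exp (((w₀ + w₁ - ħ) / (2ħ)) log x) · exp (ε ∫_v^x P_odd dx)`, with `ε = ±1`,
expanded in powers of `ħ`. Here `L` is a branch of `log x`, and `r` a branch of `√P_odd,₀`, so that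
`1/√P_odd = ħ^(1/2) · r⁻¹ · exp (-½ log (∑ₙ ħⁿ P_odd,ₙ / P_odd,₀))`. -/
def wkbSolution (w₀ w₁ : ℂ) {V : Set ℂ} (L r : ℂ → ℂ) (γ : TurningPointPaths w₀ w₁ V) (ε : ℂ) :
    FormalWKB where
  phase z := (w₀ + w₁) / 2 * L z + ε * turningPointIntegral γ (Podd w₀ w₁ 0) z
  order := 1 / 2
  amp z :=
    PowerSeries.C (Complex.exp (-(1 / 2) * L z)) *
      (PowerSeries.C (r z)⁻¹ *
        (PowerSeries.exp ℂ).subst (PowerSeries.C (-(1 / 2 : ℂ)) *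
          PowerSeries.logOf (PowerSeries.mk fun n => Podd w₀ w₁ n z / Podd w₀ w₁ 0 z))) *
      (PowerSeries.C (Complex.exp (ε * turningPointIntegral γ (Podd w₀ w₁ 1) z)) *
        expSeries fun m => ε * turningPointIntegral γ (Podd w₀ w₁ (m + 1)) z)

/-! ### Topological recursion

A (multi)differential is represented by its coefficient with respect to `dz₁ ⋯ dzₙ`. -/

/-- The residue at `0` of the differential `f(w) dw`. -/
def residueZero (f : ℂ → ℂ) : ℂ :=
  Filter.limUnder (nhdsWithin (0 : ℝ) (Set.Ioi 0)) fun R => (2 * Real.pi * Complex.I)⁻¹ * ∮ w in C(0, R), f w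

/-- The Bergman kernel `B = dz₁ dz₂ / (z₁ - z₂)²` of the sphere. -/
def bergman (z₁ z₂ : ℂ) : ℂ := 1 / (z₁ - z₂) ^ 2

/-- The 1-form `ω(x(z)) = y dx / x`. -/
def omegaForm (w₀ w₁ z : ℂ) : ℂ :=
  curveY w₀ w₁ z * deriv (curveX w₀ w₁) z / curveX w₀ w₁ z

/-- The recursion kernel
`½ ∫_{σ(w)}^{w} B(·, z) / (ω(x(w)) - ω(x(σ(w))))`. The inner integral is taken along the segment
from `-w` to `w` (for `|w| < |z|`), and the pullback of `ω` by `σ` has the coefficient `-ω(-w)`. -/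
def recursionKernel (w₀ w₁ w z : ℂ) : ℂ :=
  (1 / 2 * ∫ t in (-1 : ℝ)..1, bergman (t * w) z * w) /
    (omegaForm w₀ w₁ w - -omegaForm w₀ w₁ (-w))

/-- The differentials `ω_n^{(g)}` of the local topological recursion, `trOmega w₀ w₁ g n`.
The second entry `σ(w) = -w` in the recursion carries `d(-w) = -dw`, whence the overall sign.
The terms which contain `ω_1^{(0)} = 0` as a factor are left out of the sum. For `n = 0`, which does
not occur, the value is `0`. -/
def trOmega (w₀ w₁ : ℂ) : (g n : ℕ) → (Fin n → ℂ) → ℂ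
  | _, 0 => fun _ => 0
  | 0, 1 => fun _ => 0
  | 0, 2 => fun z => bergman (z 0) (z 1)
  | g, n + 1 => fun z =>
      residueZero fun w =>
        recursionKernel w₀ w₁ w (z 0) *
          -((if _h : 0 < g then
                trOmega w₀ w₁ (g - 1) (n + 2) (Fin.cons w (Fin.cons (-w) (Fin.tail z)))
              else 0) +
            ∑ l : Fin (g + 1), ∑ J : Finset (Fin n),
              if _h : 0 < (g - l) + J.card ∧ 0 < l + Jᶜ.card then
                trOmega w₀ w₁ (g - l) (J.card + 1)
                    (Fin.cons w fun i => z (J.orderEmbOfFin rfl i).succ) *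
                  trOmega w₀ w₁ l (Jᶜ.card + 1)
                    (Fin.cons (-w) fun i => z (Jᶜ.orderEmbOfFin rfl i).succ)
              else 0)
  termination_by g n => 2 * g + n
  decreasing_by
    all_goals
      first
      | omega
      | (have hJ := Finset.card_add_card_compl J
         simp only [Fintype.card_fin] at hJ
         omega)

/-- `F_n^{(g)}(z₁, …, zₙ) = ∫_∞^{z₁} ⋯ ∫_∞^{zₙ} ω_n^{(g)}` for `2g - 2 + n > 0`, that is, the
`n`-fold integral of `ω_n^{(g)}` over the divisors `[zᵢ] - [∞]`; each integral is taken along the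
straight ray `s ↦ s zᵢ`, `s ∈ (1, ∞)`, run through from `∞` to `zᵢ`. -/
def freeEnergy (w₀ w₁ : ℂ) (g n : ℕ) (z : Fin n → ℂ) : ℂ :=
  ∫ s in Set.pi Set.univ (fun _ : Fin n => Set.Ioi (1 : ℝ)),
    trOmega w₀ w₁ g n (fun i => (s i : ℂ) * z i) * ∏ i, -z i

/-- `F_m(x(z)) = ∑_{g ≥ 0, n ≥ 1, 2g - 1 + n = m} F_n^{(g)}(z, …, z) / n!`, for `m ≥ 2`. -/
def freeEnergySum (w₀ w₁ : ℂ) (m : ℕ) (z : ℂ) : ℂ :=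
  ∑ p ∈ (Finset.range (m + 2) ×ˢ Finset.Icc 1 (m + 1)).filter (fun p => 2 * p.1 + p.2 = m + 1),
    1 / (p.2.factorial : ℂ) * freeEnergy w₀ w₁ p.1 p.2 (fun _ => z)

/-- The differential `B(z₁, z₂) - dx(z₁) dx(z₂) / (x(z₁) - x(z₂))²`, which extends regularly to the
diagonal `z₁ = z₂`. -/
def omegaHat2 (z₁ z₂ : ℂ) : ℂ := 1 / (z₁ + z₂) ^ 2

theorem omegaHat2_eq (w₀ w₁ z₁ z₂ : ℂ) (h₁ : z₁ ≠ z₂) (h₂ : z₁ + z₂ ≠ 0) :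
    omegaHat2 z₁ z₂ = bergman z₁ z₂ -
      deriv (curveX w₀ w₁) z₁ * deriv (curveX w₀ w₁) z₂ /
        (curveX w₀ w₁ z₁ - curveX w₀ w₁ z₂) ^ 2 := by
  rw [(hasDerivAt_curveX w₀ w₁ z₁).deriv, (hasDerivAt_curveX w₀ w₁ z₂).deriv]
  have h₃ : z₁ - z₂ ≠ 0 := sub_ne_zero.mpr h₁
  have h₄ : curveX w₀ w₁ z₁ - curveX w₀ w₁ z₂ = (z₁ - z₂) * (z₁ + z₂) := by
    unfold curveX; ring
  rw [h₄]
  unfold omegaHat2 bergman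
  field_simp
  ring

/-- `F` is on `U` a regularized value of the divergent integral `∫_∞^u ω`: the cut-off integral
`∫_{z_*}^u ω` is corrected by a constant that depends only on `z_*` before `z_* → ∞`, so that `F` is
determined up to an additive constant by `dF = ω`. -/
def IsRegularizedF01 (w₀ w₁ : ℂ) (U : Set ℂ) (F : ℂ → ℂ) : Prop :=
  ∀ u ∈ U, HasDerivAt F (omegaForm w₀ w₁ u) u

/-- `F` is on `U` a regularized value of the divergent integral
`F_2^{(0)}(u, u) = ∫_∞^u ∫_∞^u ω̂₂` of the symmetric differential `ω̂₂`: the cut-off integral from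
`z_*` is corrected by a constant that depends only on `z_*`, before `z_* → ∞`. Its differential
`2 ∫_{z_*}^u ω̂₂(u, ·)` is not affected, and converges; so `F` is determined up to an additive
constant by `dF = 2 ∫_∞^u ω̂₂(u, ·)` (integral along the straight ray). -/
def IsRegularizedF02 (U : Set ℂ) (F : ℂ → ℂ) : Prop :=
  ∀ u ∈ U, HasDerivAt F (2 * ∫ s in Set.Ioi (1 : ℝ), omegaHat2 u (s * u) * -u) u

/-- The wave function `exp (∑_{m ≥ 0} ħ^(m-1) F_m)` with the integration divisor `[u] - [∞]`, where
`F₀ = F_1^{(0)}` and `F₁ = ½ F_2^{(0)}` are regularized by `F01` and `F02`. -/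
def waveFunction (w₀ w₁ : ℂ) (F01 F02 : ℂ → ℂ) : FormalWKB where
  phase := F01
  order := 0
  amp u := PowerSeries.C (Complex.exp (1 / 2 * F02 u)) *
    expSeries fun m => freeEnergySum w₀ w₁ (m + 1) u

end EquivariantCP1

end

open EquivariantCP1

/-! Put c = Λ. The stable differentials are packaged into polynomials F_m = `fockEnergy c m` in
variables t₀, t₁, …: the form ω_n^{(g)}(z₁, …, zₙ) with 2g - 2 + n = m is the mixed derivative of
F_m at the origin in the directions ξ(zᵢ), where ξ(z) has the coordinates z^(-2a-2)
(`isPolarization_fockEnergy`). Computing the residues turns the topological recursion into a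
prescription for all ∂_k F_{m+1}, namely -1/4 times the order-m part of e^{-F}(V_{k+1} - c V_k)e^F
with F = ∑ ħ^m F_m and Virasoro operators V_k. This system is overdetermined, and its solvability
expresses the symmetry of the ω_n^{(g)}. It is solvable because the operators ∂_k + (ħ/4)(V_{k+1} -
c V_k) close under commutators (`FockRelations.constraint_comm`), which makes the prescribed 1-form
closed (`pderiv_recursionRHS_comm`).

Integration over [z] - [∞] is evaluation of F_m at τ(z) = ∫_∞^z ξ, minus the constant term
(`freeEnergySum_eq`). Call the result f_m(z) and its derivative W_m(z). On the diagonal the Virasoro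
recursion collapses to W_{m+1} = -(κ W_m)' - κ ∑ W_i W_j with κ = x/(4z²), for m ≥ 1
(`freeEnergyDeriv_succ`). This is the Riccati recursion in the coordinate z, so that P_{m+1}^{(+)}
dx = W_m dz for m ≥ 1 (`riccati_one_succ`).

The function f_m has parity (-1)^m, and σ exchanges P^{(+)} and P^{(-)}. Hence P_odd keeps the W_m
with m odd, and half the integral from σ(z) to z returns f_m for these m, without a constant. The
f_m with m even come from 1/√P_odd: the series P_odd/P_odd,₀ and exp(-2 ∑_{m even} ħ^m f_m) solve
the same linear differential equation and both tend to 1 at infinity (`poddSeries_eq_expOf`).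

There remain the two unstable orders. The phase has the derivative prescribed by ω, and the
prefactor is a branch of z^(-1/2), whose logarithmic derivative is that of ½F_2^{(0)}. Each is thus
matched up to an additive constant, which is the freedom of the regularization. The decay of
z^(-1/2) makes all amplitudes tend to 0. -/

noncomputable section

/-! ### Virasoro constraints and their polynomial solution F_m -/

namespace EquivariantCP1

/-! ### Commutation relations of the Virasoro operators -/

section Virasoro

open Finset

variable {R : Type*} [Ring R] [Algebra ℂ R]

/-- The coefficient `2 (2a + 1)` of `w ^ (2a) / z ^ (2a + 2)` in `1/(w - z)² + 1/(w + z)²`. -/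
def bergmanCoeff (a : ℕ) : ℂ := 2 * (2 * a + 1)

/-- The relations between the operators `∂_a`, `∑_c β_c t_c ∂_{c+k-1}` and the multiplication
by `t₀` on a Fock space. -/
structure FockRelations (D e : ℕ → R) (T : R) : Prop where
  comm (a b : ℕ) : D a * D b = D b * D a
  D_e_zero : D 0 * e 0 = e 0 * D 0
  D_succ_e_zero (a : ℕ) : D (a + 1) * e 0 = e 0 * D (a + 1) + bergmanCoeff (a + 1) • D a
  D_e_succ (a k : ℕ) : D a * e (k + 1) = e (k + 1) * D a + bergmanCoeff a • D (a + k)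
  D_zero_T : D 0 * T = T * D 0 + 1
  D_succ_T (a : ℕ) : D (a + 1) * T = T * D (a + 1)
  e_one_T : e 1 * T = T * e 1 + (2 : ℂ) • T
  e_T (k : ℕ) : e (k + 2) * T = T * e (k + 2)
  e_succ_e_succ (j k : ℕ) :
    e (j + 1) * e (k + 1) = e (k + 1) * e (j + 1) + (4 * ((j : ℂ) - k)) • e (j + k + 1)
  e_zero_e_one : e 0 * e 1 = e 1 * e 0 - (4 : ℂ) • e 0
  e_zero_e (k : ℕ) : e 0 * e (k + 2) =
    e (k + 2) * e 0 - (4 * ((k : ℂ) + 2)) • e (k + 1) + (4 : ℂ) • (T * D k)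

/-- `∑_{a + b = n} D_a D_b`. -/
def quadSum (D : ℕ → R) (n : ℕ) : R := ∑ p ∈ antidiagonal n, D p.1 * D p.2

/-- The Virasoro operators, with the index shifted by one. -/
def virasoro (D e : ℕ → R) (T : R) : ℕ → R
  | 0 => T * T + e 0
  | 1 => algebraMap ℂ R (1 / 4) + e 1
  | n + 2 => e (n + 2) + quadSum D n

variable {D e : ℕ → R} {T : R}

/-- The products are symmetric under i ↔ N - i, so a weight affine in i may be replaced by its mean
2N + c. -/
theorem two_smul_weighted_sum (h : ∀ a b, D a * D b = D b * D a) (N : ℕ) (c : ℂ) :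
    (2 : ℂ) • ∑ i ∈ range (N + 1), (4 * (i : ℂ) + c) • (D i * D (N - i)) =
      (4 * (N : ℂ) + 2 * c) • quadSum D N := by
  have h1 : ∑ i ∈ range (N + 1), (4 * (i : ℂ) + c) • (D i * D (N - i)) =
      ∑ i ∈ range (N + 1), (4 * ((N : ℂ) - i) + c) • (D i * D (N - i)) := by
    rw [← sum_range_reflect]
    refine sum_congr rfl fun i hi => ?_
    have hi' : i ≤ N := Nat.lt_succ_iff.mp (mem_range.mp hi)
    rw [Nat.add_sub_cancel, Nat.sub_sub_self hi', h, Nat.cast_sub hi']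
  rw [two_smul]
  nth_rewrite 2 [h1]
  rw [← sum_add_distrib, quadSum, Nat.sum_antidiagonal_eq_sum_range_succ_mk, smul_sum]
  refine sum_congr rfl fun i _ => ?_
  rw [← add_smul]
  congr 1
  ring

theorem virasoro_commute {x : R} (hD : ∀ a, Commute x (D a)) (he : ∀ a, Commute x (e a))
    (hT : Commute x T) (k : ℕ) : Commute x (virasoro D e T k) := by
  match k with
  | 0 => exact (hT.mul_right hT).add_right (he 0)
  | 1 => exact (Algebra.commute_algebraMap_right _ _).add_right (he 1)
  | n + 2 => exact (he _).add_right (Commute.sum_right _ _ _ fun p _ => (hD _).mul_right (hD _))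

namespace FockRelations

theorem e_succ_quadSum (H : FockRelations D e T) (j n : ℕ) :
    e (j + 1) * quadSum D n = quadSum D n * e (j + 1) -
      (2 : ℂ) • ∑ p ∈ antidiagonal n, bergmanCoeff p.1 • (D (p.1 + j) * D p.2) := by
  have h1 : ∀ p ∈ antidiagonal n, e (j + 1) * (D p.1 * D p.2) = D p.1 * D p.2 * e (j + 1) -
      bergmanCoeff p.1 • (D (p.1 + j) * D p.2) - bergmanCoeff p.2 • (D (p.2 + j) * D p.1) := by
    intro p _
    have e1 : e (j + 1) * D p.1 = D p.1 * e (j + 1) - bergmanCoeff p.1 • D (p.1 + j) := by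
      rw [H.D_e_succ]; abel
    have e2 : e (j + 1) * D p.2 = D p.2 * e (j + 1) - bergmanCoeff p.2 • D (p.2 + j) := by
      rw [H.D_e_succ]; abel
    rw [← mul_assoc, e1, sub_mul, mul_assoc, e2, mul_sub, smul_mul_assoc, mul_smul_comm,
      H.comm p.1, ← mul_assoc, H.comm (p.2 + j)]
    abel
  rw [quadSum, mul_sum, sum_congr rfl h1, sum_sub_distrib, sum_sub_distrib, ← sum_mul, two_smul]
  nth_rewrite 3 [← Nat.sum_antidiagonal_swap]
  simp only [Prod.fst_swap, Prod.snd_swap]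
  abel

end FockRelations

/-- Index both sums by the position i of one factor. The first runs over i = m+1, …, m+n+1, and the
second, reversed, over i = 0, …, m with the opposite sign. Both carry the weight 4i - 4m - 2, so
together they fill the range of `two_smul_weighted_sum`. -/
theorem sum_shift_sub_sum_shift (h : ∀ a b, D a * D b = D b * D a) (m n : ℕ) :
    (2 : ℂ) • ∑ p ∈ antidiagonal n, bergmanCoeff p.1 • (D (p.1 + (m + 1)) * D p.2) -
      (2 : ℂ) • ∑ p ∈ antidiagonal m, bergmanCoeff p.1 • (D (p.1 + (n + 1)) * D p.2) =
      (4 * ((n : ℂ) - m)) • quadSum D (m + n + 1) := by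
  have h1 : ∑ p ∈ antidiagonal n, bergmanCoeff p.1 • (D (p.1 + (m + 1)) * D p.2) =
      ∑ i ∈ range (n + 1), (4 * ((m + 1 + i : ℕ) : ℂ) + (-4 * m - 2)) •
        (D (m + 1 + i) * D (m + n + 1 - (m + 1 + i))) := by
    rw [Nat.sum_antidiagonal_eq_sum_range_succ_mk]
    refine sum_congr rfl fun i hi => ?_
    rw [show m + n + 1 - (m + 1 + i) = n - i by omega, show i + (m + 1) = m + 1 + i by omega]
    congr 1
    simp only [bergmanCoeff]
    push_cast
    ring
  have h2 : ∑ p ∈ antidiagonal m, bergmanCoeff p.1 • (D (p.1 + (n + 1)) * D p.2) =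
      -∑ i ∈ range (m + 1), (4 * (i : ℂ) + (-4 * m - 2)) • (D i * D (m + n + 1 - i)) := by
    rw [← Nat.sum_antidiagonal_swap, Nat.sum_antidiagonal_eq_sum_range_succ_mk, ← sum_neg_distrib]
    refine sum_congr rfl fun i hi => ?_
    have hi' : i ≤ m := Nat.lt_succ_iff.mp (mem_range.mp hi)
    simp only [Prod.swap]
    rw [show m - i + (n + 1) = m + n + 1 - i by omega, h, ← neg_smul]
    congr 1
    simp only [bergmanCoeff]
    push_cast [hi']
    ring
  have h3 := two_smul_weighted_sum h (m + n + 1) (-4 * m - 2)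
  rw [show m + n + 1 + 1 = (m + 1) + (n + 1) by omega, sum_range_add] at h3
  rw [h1, h2, smul_neg, sub_neg_eq_add, ← smul_add, add_comm, h3]
  congr 1
  push_cast
  ring

namespace FockRelations

theorem e_zero_quadSum (H : FockRelations D e T) (n : ℕ) :
    e 0 * quadSum D (n + 1) = quadSum D (n + 1) * e 0 - (4 * ((n : ℂ) + 3)) • quadSum D n := by
  -- Commuting `e 0` past `D a` lowers the index, and gives nothing at a = 0. Truncated subtraction
  -- alone would produce `D 0` there.
  let D' : ℕ → R := fun a => if a = 0 then 0 else D (a - 1)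
  have hD' : ∀ a, e 0 * D a = D a * e 0 - bergmanCoeff a • D' a := by
    intro a
    cases a with
    | zero => simp [D', H.D_e_zero]
    | succ a => simp [D', H.D_succ_e_zero]
  have hcomm : ∀ a b, D' a * D b = D b * D' a := by
    intro a b
    by_cases h : a = 0 <;> simp [D', h, H.comm]
  have h1 : ∀ p ∈ antidiagonal (n + 1), e 0 * (D p.1 * D p.2) = D p.1 * D p.2 * e 0 -
      bergmanCoeff p.1 • (D' p.1 * D p.2) - bergmanCoeff p.2 • (D' p.2 * D p.1) := by
    intro p _
    rw [← mul_assoc, hD', sub_mul, mul_assoc, hD', mul_sub, smul_mul_assoc, mul_smul_comm,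
      hcomm p.2, ← mul_assoc]
    abel
  have h2 : ∑ p ∈ antidiagonal (n + 1), bergmanCoeff p.1 • (D' p.1 * D p.2) =
      ∑ i ∈ range (n + 1), (4 * (i : ℂ) + 6) • (D i * D (n - i)) := by
    rw [Nat.antidiagonal_succ, sum_cons, sum_map, ← Nat.sum_antidiagonal_eq_sum_range_succ
      (fun i j => (4 * (i : ℂ) + 6) • (D i * D j))]
    simp only [D', Function.Embedding.prodMap, Function.Embedding.coeFn_mk, Prod.map]
    simp only [if_true, zero_mul, smul_zero, zero_add]
    refine sum_congr rfl fun p _ => ?_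
    simp only [Nat.succ_ne_zero, if_false, Nat.succ_eq_add_one, Nat.add_sub_cancel,
      Function.Embedding.refl_apply]
    congr 1
    simp only [bergmanCoeff]
    push_cast
    ring
  have h3 := two_smul_weighted_sum H.comm n 6
  rw [quadSum, mul_sum, sum_congr rfl h1, sum_sub_distrib, sum_sub_distrib, ← sum_mul]
  rw [← Nat.sum_antidiagonal_swap (f := fun p => bergmanCoeff p.2 • (D' p.2 * D p.1))]
  simp only [Prod.snd_swap, Prod.fst_swap]
  rw [h2, sub_sub, ← two_smul ℂ, h3]
  congr 2
  ring

theorem virasoro_zero_one (H : FockRelations D e T) :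
    virasoro D e T 0 * virasoro D e T 1 =
      virasoro D e T 1 * virasoro D e T 0 + (-4 : ℂ) • virasoro D e T 0 := by
  simp only [virasoro]
  have h1 : e 1 * (T * T) = T * T * e 1 + (4 : ℂ) • (T * T) := by
    rw [← mul_assoc, H.e_one_T, add_mul, mul_assoc, H.e_one_T, mul_add, smul_mul_assoc,
      mul_smul_comm, ← mul_assoc, add_assoc, ← add_smul]
    norm_num
  have h2 := Algebra.commutes (R := ℂ) (1 / 4) (T * T + e 0)
  have h3 := H.e_zero_e_one
  simp only [mul_add, add_mul] at h2 ⊢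
  linear_combination (norm := module) h3 - h1 - h2

theorem virasoro_one_add_two (H : FockRelations D e T) (n : ℕ) :
    virasoro D e T 1 * virasoro D e T (n + 2) = virasoro D e T (n + 2) * virasoro D e T 1 +
      (-4 * ((n : ℂ) + 1)) • virasoro D e T (n + 2) := by
  simp only [virasoro]
  have h1 := H.e_succ_quadSum 0 n
  have h2 := two_smul_weighted_sum H.comm n 2
  rw [← Nat.sum_antidiagonal_eq_sum_range_succ
      (fun i j => (4 * (i : ℂ) + 2) • (D i * D j))] at h2
  have h3 : ∑ p ∈ antidiagonal n, bergmanCoeff p.1 • (D (p.1 + 0) * D p.2) =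
      ∑ p ∈ antidiagonal n, (4 * (p.1 : ℂ) + 2) • (D p.1 * D p.2) :=
    sum_congr rfl fun p _ => by
      rw [add_zero, bergmanCoeff]; congr 1; ring
  rw [h3, h2] at h1
  have h4 := H.e_succ_e_succ 0 (n + 1)
  have h5 := Algebra.commutes (R := ℂ) (1 / 4) (e (n + 2) + quadSum D n)
  simp only [zero_add] at h1 h4
  push_cast at h4
  simp only [mul_add, add_mul] at h5 ⊢
  linear_combination (norm := module) h1 + h4 + h5

theorem virasoro_add_two_add_two (H : FockRelations D e T) (m n : ℕ) :
    virasoro D e T (m + 2) * virasoro D e T (n + 2) =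
      virasoro D e T (n + 2) * virasoro D e T (m + 2) +
      (4 * ((m : ℂ) - n)) • virasoro D e T (m + n + 3) := by
  simp only [virasoro]
  have h1 := H.e_succ_quadSum (m + 1) n
  have h2 := H.e_succ_quadSum (n + 1) m
  have h3 := sum_shift_sub_sum_shift H.comm m n
  have h4 := H.e_succ_e_succ (m + 1) (n + 1)
  have h5 : quadSum D m * quadSum D n = quadSum D n * quadSum D m := by
    have hc : ∀ a k, Commute (D a) (quadSum D k) := fun a k =>
      Commute.sum_right _ _ _ fun p _ => Commute.mul_right (H.comm _ _) (H.comm _ _)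
    exact Commute.sum_left _ _ _ fun p _ => Commute.mul_left (hc _ _) (hc _ _)
  rw [show m + 1 + (n + 1) + 1 = m + n + 3 by ring] at h4
  rw [show m + 1 + 1 = m + 2 by ring] at h1 h4
  rw [show n + 1 + 1 = n + 2 by ring] at h2 h4
  push_cast at h4
  simp only [mul_add, add_mul]
  linear_combination (norm := module) h1 - h2 - h3 + h4 + h5

theorem T_mul_T (H : FockRelations D e T) (n : ℕ) :
    D (n + 1) * (T * T) = T * T * D (n + 1) := by
  rw [← mul_assoc, H.D_succ_T, mul_assoc, H.D_succ_T, mul_assoc]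

/-- Only `D 0` fails to commute with `T`. It occurs just in the two end terms of the sum, and each
contributes 2 T D_{n+1}. -/
theorem quadSum_T_mul_T (H : FockRelations D e T) (n : ℕ) :
    quadSum D (n + 1) * (T * T) = T * T * quadSum D (n + 1) + (4 : ℂ) • (T * D (n + 1)) := by
  have h0 : D 0 * (T * T) = T * T * D 0 + (2 : ℂ) • T := by
    rw [← mul_assoc, H.D_zero_T, add_mul, mul_assoc, H.D_zero_T, mul_add, two_smul, one_mul,
      mul_one, mul_assoc]
    abel
  have h2 : (D 0 * D (n + 1)) * (T * T) =
      T * T * (D 0 * D (n + 1)) + (2 : ℂ) • (T * D (n + 1)) := by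
    rw [mul_assoc, H.T_mul_T, ← mul_assoc, h0, add_mul, smul_mul_assoc, mul_assoc]
  have hs : quadSum D (n + 1) = D 0 * D (n + 1) + D (n + 1) * D 0 +
      (quadSum D (n + 1) - D 0 * D (n + 1) - D (n + 1) * D 0) := by abel
  have hc : (quadSum D (n + 1) - D 0 * D (n + 1) - D (n + 1) * D 0) * (T * T) =
      T * T * (quadSum D (n + 1) - D 0 * D (n + 1) - D (n + 1) * D 0) := by
    rw [quadSum, Nat.antidiagonal_succ, sum_cons, sum_map]
    simp only [Function.Embedding.prodMap, Function.Embedding.coeFn_mk, Prod.map,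
      Function.Embedding.refl_apply, Nat.succ_eq_add_one]
    cases n with
    | zero => simp
    | succ n =>
      rw [Nat.antidiagonal_succ', sum_cons, sum_map]
      simp only [Function.Embedding.prodMap, Function.Embedding.coeFn_mk, Prod.map,
        Function.Embedding.refl_apply, Nat.succ_eq_add_one]
      rw [show ∀ a b c : R, a + (b + c) - a - b = c by intros; abel, sum_mul, mul_sum]
      refine sum_congr rfl fun p _ => ?_
      rw [mul_assoc, H.T_mul_T, ← mul_assoc, H.T_mul_T, mul_assoc]
  rw [hs, add_mul, hc, add_mul, H.comm (n + 1) 0, h2, mul_add, mul_add,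
    show (4 : ℂ) = 2 + 2 by norm_num, add_smul]
  abel

/-- Here both factors are `D 0`, and moving them past `T * T` leaves the additional scalar 2. -/
theorem D_zero_sq_T_mul_T (H : FockRelations D e T) :
    quadSum D 0 * (T * T) = T * T * quadSum D 0 + (4 : ℂ) • (T * D 0) + algebraMap ℂ R 2 := by
  have h0 : D 0 * (T * T) = T * T * D 0 + (2 : ℂ) • T := by
    rw [← mul_assoc, H.D_zero_T, add_mul, mul_assoc, H.D_zero_T, mul_add, two_smul, one_mul,
      mul_one, mul_assoc]
    abel
  have hq : quadSum D 0 = D 0 * D 0 := by simp [quadSum]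
  rw [hq, mul_assoc, h0, mul_add, ← mul_assoc, h0, add_mul, mul_smul_comm, H.D_zero_T, smul_add,
    smul_mul_assoc, show (4 : ℂ) = 2 + 2 by norm_num, add_smul, Algebra.algebraMap_eq_smul_one,
    mul_assoc, mul_assoc]
  abel

/-- The terms T D_n from `e_zero_e` and from moving `quadSum D n` past `T * T` cancel. For n = 0 the
scalar 2 survives and equals 8 · (1/4): this dictates the constant 1/4 in the operator of index 1.
-/
theorem virasoro_zero_add_two (H : FockRelations D e T) (n : ℕ) :
    virasoro D e T 0 * virasoro D e T (n + 2) = virasoro D e T (n + 2) * virasoro D e T 0 +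
      (-4 * ((n : ℂ) + 2)) • virasoro D e T (n + 1) := by
  have h1 : e (n + 2) * (T * T) = T * T * e (n + 2) := by
    rw [← mul_assoc, H.e_T, mul_assoc, H.e_T, mul_assoc]
  have h2 := H.e_zero_e n
  cases n with
  | zero =>
    have h3 := H.D_zero_sq_T_mul_T
    have h4 : e 0 * quadSum D 0 = quadSum D 0 * e 0 := by
      simp only [quadSum, Nat.antidiagonal_zero, sum_singleton]
      rw [← mul_assoc, ← H.D_e_zero, mul_assoc, ← H.D_e_zero, mul_assoc]
    simp only [virasoro, zero_add] at *
    have h5 : algebraMap ℂ R 2 = (4 * (((0 : ℕ) : ℂ) + 2)) • algebraMap ℂ R (1 / 4) := by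
      rw [Algebra.smul_def, ← map_mul]; norm_num
    push_cast at h2 h5 ⊢
    simp only [mul_add, add_mul]
    linear_combination (norm := module) h2 - h1 - h3 + h4 - h5
  | succ n =>
    have h3 := H.quadSum_T_mul_T n
    have h4 := H.e_zero_quadSum n
    simp only [virasoro] at *
    push_cast at h2 ⊢
    simp only [mul_add, add_mul]
    linear_combination (norm := module) h2 - h1 - h3 + h4

/-- The commutation relations of the Virasoro algebra. -/
theorem virasoro_comm (H : FockRelations D e T) (j k : ℕ) (h : 1 ≤ j + k) :
    virasoro D e T j * virasoro D e T k = virasoro D e T k * virasoro D e T j +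
      (4 * ((j : ℂ) - k)) • virasoro D e T (j + k - 1) := by
  have key : ∀ j k : ℕ, j < k →
      virasoro D e T j * virasoro D e T k = virasoro D e T k * virasoro D e T j +
      (4 * ((j : ℂ) - k)) • virasoro D e T (j + k - 1) := by
    intro j k hjk
    match j, k, hjk with
    | 0, 1, _ => simpa using H.virasoro_zero_one
    | 0, n + 2, _ =>
      rw [H.virasoro_zero_add_two n, show 0 + (n + 2) - 1 = n + 1 by omega]
      push_cast; congr 2; ring
    | 1, n + 2, _ =>
      rw [H.virasoro_one_add_two n, show 1 + (n + 2) - 1 = n + 2 by omega]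
      push_cast; congr 2; ring
    | m + 2, n + 2, _ =>
      rw [H.virasoro_add_two_add_two m n, show m + 2 + (n + 2) - 1 = m + n + 3 by omega]
      push_cast; congr 2; ring
  rcases lt_trichotomy j k with h1 | h1 | h1
  · exact key j k h1
  · subst h1; simp
  · rw [key k j h1, add_assoc, add_comm k j, ← add_smul]
    rw [show 4 * ((k : ℂ) - j) + 4 * ((j : ℂ) - k) = 0 by ring, zero_smul, add_zero]

theorem D_virasoro_succ (H : FockRelations D e T) (j k : ℕ) :
    D j * virasoro D e T (k + 1) = virasoro D e T (k + 1) * D j + bergmanCoeff j • D (j + k) := by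
  have hc : ∀ n, D j * quadSum D n = quadSum D n * D j := fun n =>
    Commute.sum_right _ _ _ fun p _ => Commute.mul_right (H.comm _ _) (H.comm _ _)
  cases k with
  | zero =>
    simp only [virasoro]
    rw [mul_add, H.D_e_succ, add_mul, Algebra.commutes]
    abel
  | succ k =>
    simp only [virasoro]
    rw [mul_add, H.D_e_succ j (k + 1), add_mul, hc]
    abel

theorem D_succ_virasoro_zero (H : FockRelations D e T) (j : ℕ) :
    D (j + 1) * virasoro D e T 0 =
      virasoro D e T 0 * D (j + 1) + bergmanCoeff (j + 1) • D j := by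
  simp only [virasoro]
  rw [mul_add, H.T_mul_T, H.D_succ_e_zero, add_mul]
  abel

/-- The commutator of `D 0` with the operator of index 0 is 2T, which is not of the form of the
other cases; j ≠ k keeps it out. -/
theorem D_virasoro_sub (H : FockRelations D e T) (j k : ℕ) (h : j ≠ k) :
    D j * virasoro D e T k - virasoro D e T k * D j -
      (D k * virasoro D e T j - virasoro D e T j * D k) =
      (4 * ((j : ℂ) - k)) • D (j + k - 1) := by
  match j, k, h with
  | 0, 0, h => exact absurd rfl h
  | 0, k + 1, _ =>
    rw [H.D_virasoro_succ, H.D_succ_virasoro_zero, zero_add, zero_add, Nat.add_sub_cancel,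
      add_sub_cancel_left, add_sub_cancel_left, ← sub_smul]
    congr 1; simp only [bergmanCoeff]; push_cast; ring
  | j + 1, 0, _ =>
    rw [H.D_virasoro_succ, H.D_succ_virasoro_zero, add_zero, zero_add, Nat.add_sub_cancel,
      add_sub_cancel_left, add_sub_cancel_left, ← sub_smul]
    congr 1; simp only [bergmanCoeff]; push_cast; ring
  | j + 1, k + 1, _ =>
    rw [H.D_virasoro_succ, H.D_virasoro_succ, show j + 1 + (k + 1) - 1 = j + 1 + k by omega,
      show k + 1 + j = j + 1 + k by omega, add_sub_cancel_left, add_sub_cancel_left, ← sub_smul]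
    congr 1; simp only [bergmanCoeff]; push_cast; ring

/-- The operators which annihilate the partition function form a Lie algebra. -/
theorem constraint_comm (H : FockRelations D e T) {x : R} (hxD : ∀ a, Commute x (D a))
    (hxe : ∀ a, Commute x (e a)) (hxT : Commute x T) (c : ℂ) (j k : ℕ) (hjk : 1 ≤ j + k) :
    let Hop : ℕ → R := fun i =>
      D i + (1 / 4 : ℂ) • (x * (virasoro D e T (i + 1) - c • virasoro D e T i))
    Hop j * Hop k - Hop k * Hop j =
      ((j : ℂ) - k) • (x * (Hop (j + k) - c • Hop (j + k - 1))) := by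
  intro Hop
  rcases eq_or_ne j k with rfl | hne
  · simp
  have hxV := virasoro_commute hxD hxe hxT
  have hxM : ∀ i, x * (virasoro D e T (i + 1) - c • virasoro D e T i) =
      (virasoro D e T (i + 1) - c • virasoro D e T i) * x := fun i =>
    (hxV _).sub_right ((hxV _).smul_right c)
  -- Products of two constraint operators are expanded in powers of `x`. The first-order part of the
  -- commutator is `s1`, the second-order part `s2`.
  have e1 : ∀ P Q M N : R, x * P = P * x → x * M = M * x → (P + (1 / 4 : ℂ) • (x * M)) * (Q + (1 / 4 : ℂ) • (x * N)) =
      P * Q + (1 / 4 : ℂ) • (x * (P * N + M * Q)) + (1 / 16 : ℂ) • (x * (x * (M * N))) := by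
    intro P Q M N hP hM
    have h1 : P * (x * N) = x * (P * N) := by rw [← mul_assoc, ← hP, mul_assoc]
    have h2 : x * M * (x * N) = x * (x * (M * N)) := by
      rw [mul_assoc, ← mul_assoc M, ← hM, mul_assoc]
    simp only [mul_add, add_mul, smul_mul_assoc, mul_smul_comm, h1, h2, mul_assoc]
    module
  obtain ⟨s, hs⟩ : ∃ s, j + k = s + 1 := ⟨j + k - 1, by omega⟩
  have a1 := H.D_virasoro_succ j k
  have a2 := H.D_virasoro_succ k j
  have a3 := H.D_virasoro_sub j k hne
  have b1 := H.virasoro_comm (j + 1) (k + 1) (by omega)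
  have b2 := H.virasoro_comm (j + 1) k (by omega)
  have b3 := H.virasoro_comm j (k + 1) (by omega)
  have b4 := H.virasoro_comm j k hjk
  rw [hs] at a1 a3 b4
  rw [add_comm k j, hs] at a2
  rw [show j + 1 + (k + 1) - 1 = s + 1 + 1 by omega] at b1
  rw [show j + 1 + k - 1 = s + 1 by omega] at b2
  rw [show j + (k + 1) - 1 = s + 1 by omega] at b3
  simp only [Nat.add_sub_cancel, bergmanCoeff] at a1 a2 a3 b4
  push_cast at b1 b2 b3
  have s1 : D j * (virasoro D e T (k + 1) - c • virasoro D e T k) +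
      (virasoro D e T (j + 1) - c • virasoro D e T j) * D k -
      (D k * (virasoro D e T (j + 1) - c • virasoro D e T j) +
      (virasoro D e T (k + 1) - c • virasoro D e T k) * D j) =
      (4 * ((j : ℂ) - k)) • (D (s + 1) - c • D s) := by
    simp only [mul_sub, sub_mul, mul_smul_comm, smul_mul_assoc]
    linear_combination (norm := module) a1 - a2 - c • a3
  have s2 : (virasoro D e T (j + 1) - c • virasoro D e T j) *
      (virasoro D e T (k + 1) - c • virasoro D e T k) -
      (virasoro D e T (k + 1) - c • virasoro D e T k) *
      (virasoro D e T (j + 1) - c • virasoro D e T j) =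
      (4 * ((j : ℂ) - k)) • (virasoro D e T (s + 1 + 1) - (2 * c) • virasoro D e T (s + 1) +
        (c ^ 2) • virasoro D e T s) := by
    simp only [mul_sub, sub_mul, mul_smul_comm, smul_mul_assoc]
    linear_combination (norm := module) b1 - c • b2 - c • b3 + c ^ 2 • b4
  rw [hs, Nat.add_sub_cancel]
  simp only [Hop]
  rw [e1 _ _ _ _ (hxD j) (hxM j), e1 _ _ _ _ (hxD k) (hxM k), H.comm k j]
  rw [show ∀ a b c' d e' : R, a + b + c' - (a + d + e') = (b - d) + (c' - e') by intros; abel,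
    ← smul_sub, ← smul_sub, ← mul_sub, ← mul_sub, ← mul_sub, s1, s2]
  simp only [mul_sub, mul_add, mul_smul_comm, smul_sub, smul_add, smul_smul]
  module

end FockRelations

end Virasoro
end EquivariantCP1

end

noncomputable section

namespace EquivariantCP1

/-! ### Derivations of the Fock space of polynomials in `t₀, t₁, …` -/

section FockSpace

open Finset MvPolynomial

/-- Polynomials in the variables `t₀, t₁, …`. -/
abbrev Fock : Type := MvPolynomial ℕ ℂ

/-- The derivation `∑_c β_c t_c ∂_{c+k-1}`. -/
def shiftDer (k : ℕ) : Derivation ℂ Fock Fock :=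
  mkDerivation ℂ fun j => if k ≤ j + 1 then bergmanCoeff (j + 1 - k) • X (j + 1 - k) else 0

theorem shiftDer_X (k j : ℕ) : shiftDer k (X j) =
    if k ≤ j + 1 then bergmanCoeff (j + 1 - k) • X (j + 1 - k) else 0 := by
  simp [shiftDer]

theorem pderiv_lie_pderiv (a b : ℕ) :
    ⁅(pderiv a : Derivation ℂ Fock Fock), (pderiv b : Derivation ℂ Fock Fock)⁆ = 0 := by
  refine derivation_ext fun i => ?_
  rw [Derivation.commutator_apply, pderiv_X, pderiv_X]
  simp only [Pi.single_apply]
  split_ifs <;> simp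

theorem pderiv_pderiv_comm (a b : ℕ) (p : Fock) :
    pderiv a (pderiv b p) = pderiv b (pderiv a p) := by
  have := congrArg (fun d : Derivation ℂ Fock Fock => d p) (pderiv_lie_pderiv a b)
  simpa [Derivation.commutator_apply, sub_eq_zero] using this

theorem pderiv_lie_shiftDer_succ (a k : ℕ) :
    ⁅(pderiv a : Derivation ℂ Fock Fock), shiftDer (k + 1)⁆ = bergmanCoeff a • pderiv (a + k) := by
  refine derivation_ext fun i => ?_
  rw [Derivation.commutator_apply, shiftDer_X, pderiv_X, Derivation.smul_apply, pderiv_X]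
  simp only [Pi.single_apply]
  by_cases h : a = i + 1 - (k + 1) ∧ k + 1 ≤ i + 1
  · obtain ⟨rfl, h⟩ := h
    rw [if_pos h, show i + 1 - (k + 1) + k = i by omega, Derivation.map_smul, pderiv_X_self,
      if_pos rfl]
    split_ifs <;> simp
  · have h1 : a + k ≠ i := by omega
    by_cases h2 : k + 1 ≤ i + 1
    · have h3 : i + 1 - (k + 1) ≠ a := by omega
      rw [if_pos h2, Derivation.map_smul, pderiv_X_of_ne h3, if_neg (Ne.symm h1)]
      split_ifs <;> simp
    · rw [if_neg h2, if_neg (Ne.symm h1)]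
      split_ifs <;> simp

theorem pderiv_zero_lie_shiftDer_zero :
    ⁅(pderiv 0 : Derivation ℂ Fock Fock), shiftDer 0⁆ = 0 := by
  refine derivation_ext fun i => ?_
  rw [Derivation.commutator_apply, shiftDer_X, pderiv_X, if_pos (Nat.zero_le _), Derivation.map_smul,
    pderiv_X_of_ne (by omega)]
  simp only [Pi.single_apply]
  split_ifs <;> simp

theorem pderiv_succ_lie_shiftDer_zero (a : ℕ) :
    ⁅(pderiv (a + 1) : Derivation ℂ Fock Fock), shiftDer 0⁆ =
      bergmanCoeff (a + 1) • pderiv a := by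
  refine derivation_ext fun i => ?_
  rw [Derivation.commutator_apply, shiftDer_X, pderiv_X, if_pos (Nat.zero_le _), Derivation.map_smul,
    pderiv_X, Derivation.smul_apply, pderiv_X]
  simp only [Pi.single_apply]
  by_cases h : i = a
  · subst h
    simp
  · rw [if_neg (by omega), if_neg h]
    split_ifs <;> simp

theorem shiftDer_lie_succ (j k : ℕ) :
    ⁅shiftDer (j + 1), shiftDer (k + 1)⁆ = (4 * ((j : ℂ) - k)) • shiftDer (j + k + 1) := by
  refine derivation_ext fun i => ?_
  rw [Derivation.commutator_apply, Derivation.smul_apply]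
  simp only [shiftDer_X]
  by_cases h : j + k ≤ i
  · rw [if_pos (by omega), if_pos (by omega), if_pos (by omega), Derivation.map_smul, Derivation.map_smul, shiftDer_X,
      shiftDer_X, if_pos (by omega), if_pos (by omega), smul_smul, smul_smul, smul_smul,
      show i + 1 - (k + 1) + 1 - (j + 1) = i - (j + k) by omega,
      show i + 1 - (j + 1) + 1 - (k + 1) = i - (j + k) by omega,
      show i + 1 - (j + k + 1) = i - (j + k) by omega, ← sub_smul]
    congr 1
    rw [← sub_mul]
    congr 1
    simp only [bergmanCoeff]
    rw [show i + 1 - (k + 1) = i - k by omega, show i + 1 - (j + 1) = i - j by omega,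
      Nat.cast_sub (by omega), Nat.cast_sub (by omega)]
    ring
  · rw [if_neg (by omega : ¬ j + k + 1 ≤ i + 1), smul_zero]
    by_cases h1 : k + 1 ≤ i + 1 <;> by_cases h2 : j + 1 ≤ i + 1 <;>
      simp only [h1, h2, if_true, if_false, map_zero, sub_zero, zero_sub]
    · rw [Derivation.map_smul, Derivation.map_smul, shiftDer_X, shiftDer_X, if_neg (by omega),
        if_neg (by omega)]; simp
    · rw [Derivation.map_smul, shiftDer_X, if_neg (by omega)]; simp
    · rw [Derivation.map_smul, shiftDer_X, if_neg (by omega)]; simp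

theorem shiftDer_lie_zero_one : ⁅shiftDer 0, shiftDer 1⁆ = (-4 : ℂ) • shiftDer 0 := by
  refine derivation_ext fun i => ?_
  rw [Derivation.commutator_apply, Derivation.smul_apply]
  simp only [shiftDer_X]
  simp only [if_true, Nat.le_add_left, Derivation.map_smul, shiftDer_X, smul_smul,
    Nat.add_sub_cancel, Nat.sub_zero]
  rw [← sub_smul]
  congr 1
  simp only [bergmanCoeff]
  push_cast
  ring

/-- Only t_k violates the generic relation: the passage through a variable t_{-1}, with weight
β_{-1} β_0 = -4, is missing there, and the term 4 t₀ ∂_k compensates for it. -/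
theorem shiftDer_lie_zero (k : ℕ) :
    ⁅shiftDer 0, shiftDer (k + 2)⁆ =
      -(4 * ((k : ℂ) + 2)) • shiftDer (k + 1) + (4 : ℂ) • (X 0 : Fock) • pderiv k := by
  refine derivation_ext fun i => ?_
  simp only [Derivation.commutator_apply, Derivation.add_apply, Derivation.smul_apply, shiftDer_X,
    pderiv_X, Pi.single_apply, Nat.zero_le, if_true, Derivation.map_smul, Nat.sub_zero, smul_eq_mul]
  rcases lt_trichotomy i k with h | h | h
  · rw [if_neg (by omega), if_neg (by omega), if_neg (by omega), if_neg (by omega)]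
    simp
  · subst h
    rw [if_neg (by omega), if_pos (by omega), if_pos (by omega), if_pos rfl]
    rw [show i + 1 + 1 - (i + 2) = 0 by omega, show i + 1 - (i + 1) = 0 by omega, map_zero,
      smul_smul, smul_smul, zero_sub, mul_one, ← neg_smul, ← add_smul]
    congr 1
    simp only [bergmanCoeff]
    push_cast
    ring
  · obtain ⟨s, rfl⟩ : ∃ s, i = k + 1 + s := ⟨i - (k + 1), by omega⟩
    rw [if_pos (by omega), if_pos (by omega), if_pos (by omega), if_neg (by omega)]
    rw [Derivation.map_smul, shiftDer_X, if_pos (by omega), smul_smul, smul_smul, smul_smul,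
      show k + 1 + s + 1 + 1 - (k + 2) = s + 1 by omega,
      show k + 1 + s + 1 - (k + 2) + 1 - 0 = s + 1 by omega,
      show k + 1 + s + 1 - (k + 1) = s + 1 by omega,
      show k + 1 + s + 1 - (k + 2) = s by omega, ← sub_smul, mul_zero, smul_zero, add_zero]
    congr 1
    simp only [bergmanCoeff]
    push_cast
    ring

/-- The coefficientwise extension of a derivation to formal power series. -/
def liftDer (d : Derivation ℂ Fock Fock) :
    Derivation ℂ (PowerSeries Fock) (PowerSeries Fock) :=
  Derivation.mk'
    { toFun := fun f => PowerSeries.mk fun n => d (PowerSeries.coeff n f)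
      map_add' := fun f g => by ext n; simp
      map_smul' := fun c f => by ext n; simp }
    (fun f g => by
      refine PowerSeries.ext fun n => ?_
      have h : ∀ p q : PowerSeries Fock, PowerSeries.coeff n (p * q) =
          ∑ ij ∈ antidiagonal n, PowerSeries.coeff ij.1 p * PowerSeries.coeff ij.2 q :=
        fun p q => PowerSeries.coeff_mul n p q
      simp only [LinearMap.coe_mk, AddHom.coe_mk, PowerSeries.coeff_mk, smul_eq_mul, map_add, h]
      rw [map_sum, ← Nat.sum_antidiagonal_swap (n := n)
        (f := fun ij => PowerSeries.coeff ij.1 g * d (PowerSeries.coeff ij.2 f)),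
        ← sum_add_distrib]
      refine sum_congr rfl fun ij _ => ?_
      simp [Derivation.leibniz])

@[simp]
theorem coeff_liftDer (d : Derivation ℂ Fock Fock) (f : PowerSeries Fock) (n : ℕ) :
    PowerSeries.coeff n (liftDer d f) = d (PowerSeries.coeff n f) := by
  simp [liftDer]

/-- Multiplication by a power series, as an operator. -/
def mulOp (a : PowerSeries Fock) : Module.End ℂ (PowerSeries Fock) := LinearMap.mulLeft ℂ a

@[simp]
theorem mulOp_apply (a f : PowerSeries Fock) : mulOp a f = a * f := rfl

/-- The derivation `d` conjugated by the exponential of `F`. -/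
def conjDer (F : PowerSeries Fock) (d : Derivation ℂ Fock Fock) :
    Module.End ℂ (PowerSeries Fock) :=
  (liftDer d : PowerSeries Fock →ₗ[ℂ] PowerSeries Fock) + mulOp (liftDer d F)

theorem conjDer_apply (F : PowerSeries Fock) (d : Derivation ℂ Fock Fock) (f : PowerSeries Fock) :
    conjDer F d f = liftDer d f + liftDer d F * f := rfl

/-- `conjDer F d` is e^{-F} d e^F, and conjugation preserves brackets. -/
theorem conjDer_mul_conjDer (F : PowerSeries Fock) (d₁ d₂ : Derivation ℂ Fock Fock) :
    conjDer F d₁ * conjDer F d₂ = conjDer F d₂ * conjDer F d₁ + conjDer F ⁅d₁, d₂⁆ := by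
  have h : ∀ f, liftDer ⁅d₁, d₂⁆ f = liftDer d₁ (liftDer d₂ f) - liftDer d₂ (liftDer d₁ f) := by
    intro f
    ext1 n
    simp [Derivation.commutator_apply]
  refine LinearMap.ext fun f => ?_
  simp only [Module.End.mul_apply, LinearMap.add_apply, conjDer_apply, map_add, Derivation.leibniz,
    h, smul_eq_mul]
  ring

theorem conjDer_add (F : PowerSeries Fock) (d₁ d₂ : Derivation ℂ Fock Fock) :
    conjDer F (d₁ + d₂) = conjDer F d₁ + conjDer F d₂ := by
  have h : ∀ f, liftDer (d₁ + d₂) f = liftDer d₁ f + liftDer d₂ f := fun f => by ext1 n; simp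
  refine LinearMap.ext fun f => ?_
  simp only [LinearMap.add_apply, conjDer_apply, h]
  ring

theorem conjDer_smul (F : PowerSeries Fock) (c : ℂ) (d : Derivation ℂ Fock Fock) :
    conjDer F (c • d) = c • conjDer F d := by
  have h : ∀ f, liftDer (c • d) f = c • liftDer d f := fun f => by ext1 n; simp
  refine LinearMap.ext fun f => ?_
  simp only [LinearMap.smul_apply, conjDer_apply, h, smul_add, smul_mul_assoc]

theorem conjDer_zero (F : PowerSeries Fock) : conjDer F 0 = 0 := by
  have := conjDer_smul F 0 0
  simpa using this

theorem conjDer_mul_smul (F : PowerSeries Fock) (a : Fock) (d : Derivation ℂ Fock Fock) :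
    conjDer F (a • d) = mulOp (PowerSeries.C a) * conjDer F d := by
  have h : ∀ f, liftDer (a • d) f = PowerSeries.C a * liftDer d f := fun f => by
    ext1 n; simp
  refine LinearMap.ext fun f => ?_
  simp only [Module.End.mul_apply, conjDer_apply, h, mulOp_apply]
  ring

theorem conjDer_mul_mulOp (F : PowerSeries Fock) (a : Fock) (d : Derivation ℂ Fock Fock) :
    conjDer F d * mulOp (PowerSeries.C a) =
      mulOp (PowerSeries.C a) * conjDer F d + mulOp (PowerSeries.C (d a)) := by
  have h : liftDer d (PowerSeries.C a) = PowerSeries.C (d a) := by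
    ext1 n
    rw [coeff_liftDer, PowerSeries.coeff_C, PowerSeries.coeff_C]
    split_ifs <;> simp
  refine LinearMap.ext fun f => ?_
  simp only [Module.End.mul_apply, LinearMap.add_apply, conjDer_apply, mulOp_apply,
    Derivation.leibniz, h, smul_eq_mul]
  ring

/-- Conjugation by e^F does not change the relations of the operators on polynomials. The conjugated
form allows the constraints on the partition function e^F to be written as operators applied to 1.
-/
theorem fockRelations (F : PowerSeries Fock) :
    FockRelations (fun a => conjDer F (pderiv a)) (fun k => conjDer F (shiftDer k))
      (mulOp (PowerSeries.C (X 0))) where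
  comm a b := by rw [conjDer_mul_conjDer, pderiv_lie_pderiv, conjDer_zero, add_zero]
  D_e_zero := by rw [conjDer_mul_conjDer, pderiv_zero_lie_shiftDer_zero, conjDer_zero, add_zero]
  D_succ_e_zero a := by rw [conjDer_mul_conjDer, pderiv_succ_lie_shiftDer_zero, conjDer_smul]
  D_e_succ a k := by rw [conjDer_mul_conjDer, pderiv_lie_shiftDer_succ, conjDer_smul]
  D_zero_T := by
    rw [conjDer_mul_mulOp, pderiv_X_self, map_one]
    congr 1
    exact LinearMap.ext fun f => one_mul f
  D_succ_T a := by
    rw [conjDer_mul_mulOp, pderiv_X_of_ne (by omega), map_zero]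
    simp [mulOp]
  e_one_T := by
    rw [conjDer_mul_mulOp, shiftDer_X, if_pos (by omega)]
    congr 1
    refine LinearMap.ext fun f => ?_
    ext1 n
    simp [bergmanCoeff]
  e_T k := by
    rw [conjDer_mul_mulOp, shiftDer_X, if_neg (by omega), map_zero]
    simp [mulOp]
  e_succ_e_succ j k := by rw [conjDer_mul_conjDer, shiftDer_lie_succ, conjDer_smul]
  e_zero_e_one := by
    rw [conjDer_mul_conjDer, shiftDer_lie_zero_one, conjDer_smul]
    module
  e_zero_e k := by
    rw [conjDer_mul_conjDer, shiftDer_lie_zero, conjDer_add, conjDer_smul, conjDer_smul,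
      conjDer_mul_smul]
    module

end FockSpace
end EquivariantCP1

end

noncomputable section

namespace EquivariantCP1

section FreeEnergy

open Finset MvPolynomial

/-! ### The free energy as a sequence of polynomials -/

theorem coeff_X_mul_pderiv (k : ℕ) (p : Fock) (d : ℕ →₀ ℕ) :
    coeff d (X k * pderiv k p) = d k * coeff d p := by
  induction p using MvPolynomial.induction_on' with
  | monomial m r =>
    rw [X_mul_pderiv_monomial, coeff_smul, coeff_monomial]
    split_ifs with h
    · rw [h]; simp
    · simp
  | add p q hp hq => rw [map_add, mul_add, coeff_add, hp, hq, coeff_add, mul_add]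

/-- Formal Poincaré lemma. -/
theorem exists_primitive (g : ℕ → Fock) (K : ℕ) (hK : ∀ k, K ≤ k → g k = 0)
    (hg : ∀ j k, pderiv j (g k) = pderiv k (g j)) : ∃ F : Fock, ∀ k, pderiv k F = g k := by
  -- By Euler's identity ∑ t_k ∂_k F multiplies each homogeneous part of F by its degree, so the
  -- primitive is G with each coefficient divided by the degree. The bound K makes G a polynomial.
  set G : Fock := ∑ k ∈ range K, X k * g k with hG
  set F : Fock := ∑ d ∈ G.support, monomial d (coeff d G / d.degree) with hF
  have hcF : ∀ d, coeff d F = coeff d G / d.degree := by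
    intro d
    rw [hF, coeff_sum]
    simp only [coeff_monomial]
    rw [Finset.sum_ite_eq']
    split_ifs with h
    · rfl
    · rw [notMem_support_iff.mp h, zero_div]
  have hdG : ∀ j, pderiv j G = g j + ∑ k ∈ range K, X k * pderiv k (g j) := by
    intro j
    rw [hG, map_sum]
    have h1 : ∀ k ∈ range K, pderiv j (X k * g k) =
        (if k = j then g j else 0) + X k * pderiv k (g j) := by
      intro k _
      rw [pderiv_mul, pderiv_X, Pi.single_apply, hg j k]
      split_ifs with h
      · rw [h, one_mul]
      · rw [zero_mul]
    rw [sum_congr rfl h1, sum_add_distrib, Finset.sum_ite_eq']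
    split_ifs with h
    · rfl
    · rw [hK j (by simpa using h)]
  -- Exponents of t_k with k ≥ K do not matter: closedness gives ∂_k g_j = ∂_j g_k = 0, so a
  -- monomial of g_j cannot contain such a variable.
  have hdeg : ∀ j d, ∑ k ∈ range K, (d k : ℂ) * coeff d (g j) = d.degree * coeff d (g j) := by
    intro j d
    rw [← sum_mul]
    by_cases h : coeff d (g j) = 0
    · simp [h]
    · congr 1
      rw [Finsupp.degree_apply, Nat.cast_sum]
      symm
      refine sum_subset (fun k hk => ?_) fun k _ hk => ?_
      · by_contra hkK
        have h2 := coeff_X_mul_pderiv k (g j) d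
        rw [← hg j k, hK k (by simpa using hkK), map_zero, mul_zero, coeff_zero] at h2
        have h3 : (d k : ℂ) ≠ 0 := by exact_mod_cast Finsupp.mem_support_iff.mp hk
        exact (mul_ne_zero h3 h) h2.symm
      · simpa using hk
  refine ⟨F, fun j => ?_⟩
  ext d
  have h1 : coeff d (pderiv j G) = ((d.degree : ℂ) + 1) * coeff d (g j) := by
    rw [hdG, coeff_add, coeff_sum]
    simp only [coeff_X_mul_pderiv]
    rw [hdeg]
    ring
  rw [coeff_pderiv] at h1
  rw [coeff_pderiv, hcF]
  have h2 : (d + Finsupp.single j 1).degree = d.degree + 1 := by simp [map_add]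
  have h3 : ((d.degree : ℂ) + 1) ≠ 0 := by exact_mod_cast Nat.succ_ne_zero d.degree
  rw [h2, div_mul_eq_mul_div, h1]
  push_cast
  rw [mul_div_cancel_left₀ _ h3]

/-- The quadratic part of the Virasoro constraints. -/
def quadTerm (F : ℕ → Fock) (m n : ℕ) : Fock :=
  ∑ p ∈ antidiagonal n, (pderiv p.1 (pderiv p.2 (F m)) +
    ∑ ij ∈ antidiagonal m, pderiv p.1 (F ij.1) * pderiv p.2 (F ij.2))

/-- The coefficient of `w ^ (-2k)` of the right-hand side of the topological recursion. -/
def loopCoeff (F : ℕ → Fock) (m : ℕ) : ℕ → Fock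
  | 0 => (if m = 0 then X 0 * X 0 else 0) + shiftDer 0 (F m)
  | 1 => (if m = 0 then C (1 / 4) else 0) + shiftDer 1 (F m)
  | n + 2 => shiftDer (n + 2) (F m) + quadTerm F m n

theorem loopCoeff_congr {F F' : ℕ → Fock} {m : ℕ} (h : ∀ i ≤ m, F i = F' i) (k : ℕ) :
    loopCoeff F m k = loopCoeff F' m k := by
  have hq : ∀ n, quadTerm F m n = quadTerm F' m n := by
    intro n
    unfold quadTerm
    refine sum_congr rfl fun p _ => ?_
    rw [h m le_rfl]
    congr 1
    refine sum_congr rfl fun ij hij => ?_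
    have := mem_antidiagonal.mp hij
    rw [h ij.1 (by omega), h ij.2 (by omega)]
  match k with
  | 0 => simp only [loopCoeff, h m le_rfl]
  | 1 => simp only [loopCoeff, h m le_rfl]
  | n + 2 => simp only [loopCoeff, h m le_rfl, hq]

/-- The right-hand side of the recursion for `∂_k F_{m+1}`. -/
def recursionRHS (c : ℂ) (F : ℕ → Fock) (m k : ℕ) : Fock :=
  -(1 / 4 : ℂ) • (loopCoeff F m (k + 1) - c • loopCoeff F m k)

open Classical in
/-- A primitive of `g` if there is one. -/
def primitive (g : ℕ → Fock) : Fock :=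
  if h : ∃ F : Fock, ∀ k, pderiv k F = g k then h.choose else 0

theorem pderiv_primitive {g : ℕ → Fock} (h : ∃ F : Fock, ∀ k, pderiv k F = g k) (k : ℕ) :
    pderiv k (primitive g) = g k := by
  rw [primitive, dif_pos h]
  exact h.choose_spec k

/-- The polynomials `F_m`, defined by the recursion. -/
def fockEnergy (c : ℂ) : ℕ → Fock
  | 0 => 0
  | m + 1 => primitive (recursionRHS c (fun i => if _h : i ≤ m then fockEnergy c i else 0) m)

theorem exists_bound_vars (p : Fock) : ∃ M : ℕ, ∀ i ∈ p.vars, i < M :=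
  ⟨p.vars.sup id + 1, fun _ hi => Nat.lt_succ_iff.mpr (Finset.le_sup (f := id) hi)⟩

theorem pderiv_eq_zero_of_bound {p : Fock} {M : ℕ} (h : ∀ i ∈ p.vars, i < M) {k : ℕ} (hk : M ≤ k) :
    pderiv k p = 0 :=
  pderiv_eq_zero_of_notMem_vars fun hmem => absurd (h k hmem) (by omega)

theorem shiftDer_eq_zero_of_bound {p : Fock} {M : ℕ} (h : ∀ i ∈ p.vars, i < M) {k : ℕ}
    (hk : M < k) : shiftDer k p = 0 :=
  derivation_eq_zero_of_forall_mem_vars fun i hi => by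
    have := h i hi
    rw [shiftDer_X, if_neg (by omega)]

theorem exists_common_bound (F : ℕ → Fock) (m : ℕ) :
    ∃ M : ℕ, ∀ i ≤ m, ∀ j ∈ (F i).vars, j < M := by
  choose M hM using fun i => exists_bound_vars (F i)
  refine ⟨(range (m + 1)).sup M, fun i hi j hj => (hM i j hj).trans_le ?_⟩
  exact Finset.le_sup (f := M) (mem_range.mpr (by omega))

theorem loopCoeff_eq_zero {F : ℕ → Fock} {m M : ℕ} (h : ∀ i ≤ m, ∀ j ∈ (F i).vars, j < M) {k : ℕ}
    (hk : 2 * M + 2 ≤ k) : loopCoeff F m k = 0 := by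
  obtain ⟨n, rfl⟩ : ∃ n, k = n + 2 := ⟨k - 2, by omega⟩
  simp only [loopCoeff]
  rw [shiftDer_eq_zero_of_bound (h m le_rfl) (by omega), zero_add, quadTerm]
  refine sum_eq_zero fun p hp => ?_
  have hp' := mem_antidiagonal.mp hp
  -- Here p.1 + p.2 = n ≥ 2M, so at least one index exceeds all variables which occur.
  rcases le_or_gt M p.1 with h1 | h1
  · rw [pderiv_pderiv_comm, pderiv_eq_zero_of_bound (h m le_rfl) h1, map_zero, zero_add]
    refine sum_eq_zero fun ij hij => ?_
    have := mem_antidiagonal.mp hij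
    rw [pderiv_eq_zero_of_bound (h ij.1 (by omega)) h1, zero_mul]
  · have h2 : M ≤ p.2 := by omega
    rw [pderiv_eq_zero_of_bound (h m le_rfl) h2, map_zero, zero_add]
    refine sum_eq_zero fun ij hij => ?_
    have := mem_antidiagonal.mp hij
    rw [pderiv_eq_zero_of_bound (h ij.2 (by omega)) h2, mul_zero]

/-- With the power series variable as ħ, this identifies `loopCoeff F m k` as the order-m part of
e^{-F} V_k e^F. The second-order operators ∂_a ∂_b yield ∂_a ∂_b F + ∂_a F ∂_b F, which is the
origin of `quadTerm`. -/
theorem coeff_virasoro_one (F : ℕ → Fock) (m k : ℕ) :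
    PowerSeries.coeff m (virasoro (fun a => conjDer (PowerSeries.mk F) (pderiv a))
      (fun k => conjDer (PowerSeries.mk F) (shiftDer k)) (mulOp (PowerSeries.C (X 0))) k 1) =
      loopCoeff F m k := by
  have h1 : ∀ d : Derivation ℂ Fock Fock, conjDer (PowerSeries.mk F) d 1 =
      liftDer d (PowerSeries.mk F) := fun d => by
    rw [conjDer_apply, Derivation.map_one_eq_zero, zero_add, mul_one]
  match k with
  | 0 =>
    simp only [virasoro, loopCoeff, LinearMap.add_apply, Module.End.mul_apply, mulOp_apply, h1,
      map_add, coeff_liftDer, PowerSeries.coeff_mk, mul_one, ← map_mul, PowerSeries.coeff_C]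
  | 1 =>
    simp only [virasoro, loopCoeff, LinearMap.add_apply, h1, map_add, coeff_liftDer,
      PowerSeries.coeff_mk, Module.algebraMap_end_apply]
    congr 1
    have h2 : ((1 / 4 : ℂ) • (1 : PowerSeries Fock)) = PowerSeries.C (C (1 / 4)) := by
      ext1 n
      rw [PowerSeries.coeff_smul, PowerSeries.coeff_C, PowerSeries.coeff_one]
      split_ifs
      · rw [smul_eq_C_mul, mul_one]
      · rw [smul_zero]
    rw [h2, PowerSeries.coeff_C]
  | n + 2 =>
    have h2 : quadSum (fun a => conjDer (PowerSeries.mk F) (pderiv a)) n 1 =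
        ∑ p ∈ antidiagonal n, conjDer (PowerSeries.mk F) (pderiv p.1)
          (liftDer (pderiv p.2) (PowerSeries.mk F)) := by
      rw [quadSum, LinearMap.sum_apply]
      exact sum_congr rfl fun p _ => by rw [Module.End.mul_apply, h1]
    have h3 : ∀ p : ℕ × ℕ, PowerSeries.coeff m (conjDer (PowerSeries.mk F) (pderiv p.1)
        (liftDer (pderiv p.2) (PowerSeries.mk F))) = pderiv p.1 (pderiv p.2 (F m)) +
        ∑ ij ∈ antidiagonal m, pderiv p.1 (F ij.1) * pderiv p.2 (F ij.2) := by
      intro p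
      rw [conjDer_apply, map_add, coeff_liftDer, coeff_liftDer, PowerSeries.coeff_mk,
        PowerSeries.coeff_mul]
      simp only [coeff_liftDer, PowerSeries.coeff_mk]
    have h4 : virasoro (fun a => conjDer (PowerSeries.mk F) (pderiv a))
        (fun k => conjDer (PowerSeries.mk F) (shiftDer k)) (mulOp (PowerSeries.C (X 0))) (n + 2) 1 =
        liftDer (shiftDer (n + 2)) (PowerSeries.mk F) +
          ∑ p ∈ antidiagonal n, conjDer (PowerSeries.mk F) (pderiv p.1)
            (liftDer (pderiv p.2) (PowerSeries.mk F)) := by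
      rw [← h1, ← h2]
      rfl
    rw [h4, map_add, coeff_liftDer, PowerSeries.coeff_mk, map_sum, sum_congr rfl fun p _ => h3 p]
    rfl

/-- Since F has no term of order 0, multiplication by dF raises the order in ħ. At the lowest order
where f may be nonzero, only d itself acts. -/
theorem coeff_conjDer_of_vanish {F : ℕ → Fock} (hF : F 0 = 0) (d : Derivation ℂ Fock Fock)
    {f : PowerSeries Fock} {n : ℕ} (hf : ∀ i < n, PowerSeries.coeff i f = 0) :
    ∀ i ≤ n, PowerSeries.coeff i (conjDer (PowerSeries.mk F) d f) =
      d (PowerSeries.coeff i f) := by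
  intro i hi
  rw [conjDer_apply, map_add, coeff_liftDer, PowerSeries.coeff_mul, add_eq_left]
  refine sum_eq_zero fun ij hij => ?_
  have := mem_antidiagonal.mp hij
  rcases Nat.eq_zero_or_pos ij.1 with h | h
  · rw [h, coeff_liftDer, PowerSeries.coeff_mk, hF, map_zero, zero_mul]
  · rw [hf ij.2 (by omega), mul_zero]

theorem coeff_virasoro_of_vanish {F : ℕ → Fock} (hF : F 0 = 0)
    {f : PowerSeries Fock} {n : ℕ} (hf : ∀ i < n, PowerSeries.coeff i f = 0) (k : ℕ) :
    ∀ i < n, PowerSeries.coeff i (virasoro (fun a => conjDer (PowerSeries.mk F) (pderiv a))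
      (fun k => conjDer (PowerSeries.mk F) (shiftDer k)) (mulOp (PowerSeries.C (X 0))) k f) =
      0 := by
  intro i hi
  have hd : ∀ (d : Derivation ℂ Fock Fock) (f : PowerSeries Fock),
      (∀ i < n, PowerSeries.coeff i f = 0) → ∀ i < n,
      PowerSeries.coeff i (conjDer (PowerSeries.mk F) d f) = 0 := fun d f hf i hi => by
    rw [coeff_conjDer_of_vanish hF d hf i hi.le, hf i hi, map_zero]
  match k with
  | 0 =>
    simp only [virasoro, LinearMap.add_apply, Module.End.mul_apply, mulOp_apply, map_add,
      hd _ f hf i hi, PowerSeries.coeff_C_mul, hf i hi, mul_zero, add_zero]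
  | 1 =>
    simp only [virasoro, LinearMap.add_apply, Module.algebraMap_end_apply, map_add,
      hd _ f hf i hi, PowerSeries.coeff_smul, hf i hi, smul_zero, add_zero]
  | k + 2 =>
    simp only [virasoro, quadSum, LinearMap.add_apply, LinearMap.sum_apply, Module.End.mul_apply,
      map_add, map_sum, hd _ f hf i hi, zero_add]
    exact sum_eq_zero fun p _ => hd _ _ (hd _ f hf) i hi

/-- The right-hand side of the recursion is a closed 1-form. -/
theorem pderiv_recursionRHS_comm (c : ℂ) {F : ℕ → Fock} (hF : F 0 = 0) {m : ℕ}
    (hrec : ∀ i < m, ∀ k, pderiv k (F (i + 1)) = recursionRHS c F i k) (j k : ℕ) :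
    pderiv j (recursionRHS c F m k) = pderiv k (recursionRHS c F m j) := by
  rcases eq_or_ne j k with rfl | hne
  · rfl
  set D : ℕ → Module.End ℂ (PowerSeries Fock) := fun a => conjDer (PowerSeries.mk F) (pderiv a)
  set Vir := virasoro D (fun k => conjDer (PowerSeries.mk F) (shiftDer k))
    (mulOp (PowerSeries.C (X 0))) with hVir
  set x : Module.End ℂ (PowerSeries Fock) := mulOp PowerSeries.X
  have hxc : ∀ d, Commute x (conjDer (PowerSeries.mk F) d) := by
    intro d
    have h0 : liftDer d (PowerSeries.X : PowerSeries Fock) = 0 := by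
      ext1 n
      rw [coeff_liftDer, PowerSeries.coeff_X]
      split_ifs <;> simp
    refine LinearMap.ext fun f => ?_
    simp only [x, Module.End.mul_apply, mulOp_apply, conjDer_apply, Derivation.leibniz, h0,
      smul_eq_mul, mul_zero, add_zero]
    ring
  have hxT : Commute x (mulOp (PowerSeries.C (X 0))) :=
    LinearMap.ext fun f => by simp only [x, Module.End.mul_apply, mulOp_apply]; ring
  have hcomm := (fockRelations (PowerSeries.mk F)).constraint_comm (fun a => hxc _)
    (fun a => hxc _) hxT c j k (by omega)
  set Hop : ℕ → Module.End ℂ (PowerSeries Fock) := fun i =>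
    D i + (1 / 4 : ℂ) • (x * (Vir (i + 1) - c • Vir i)) with hHop
  have hHop_apply : ∀ i f, Hop i f = D i f +
      (1 / 4 : ℂ) • (PowerSeries.X * (Vir (i + 1) f - c • Vir i f)) := fun _ _ => rfl
  have hE0 : ∀ i, PowerSeries.coeff 0 (Hop i 1) = 0 := by
    intro i
    rw [hHop_apply, map_add, PowerSeries.coeff_smul, PowerSeries.coeff_zero_X_mul, smul_zero,
      add_zero, conjDer_apply, Derivation.map_one_eq_zero, zero_add, mul_one, coeff_liftDer,
      PowerSeries.coeff_mk, hF, map_zero]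
  -- `Hop i 1` measures the failure of the constraint with index i. By `hrec` it vanishes up to
  -- order m in ħ.
  have hE : ∀ n i, PowerSeries.coeff (n + 1) (Hop i 1) =
      pderiv i (F (n + 1)) - recursionRHS c F n i := by
    intro n i
    rw [hHop_apply, map_add, PowerSeries.coeff_smul, PowerSeries.coeff_succ_X_mul, conjDer_apply,
      Derivation.map_one_eq_zero, zero_add, mul_one, coeff_liftDer, PowerSeries.coeff_mk, map_sub,
      PowerSeries.coeff_smul, coeff_virasoro_one, coeff_virasoro_one, recursionRHS, neg_smul,
      sub_neg_eq_add]
  have hvan : ∀ i, ∀ n < m + 1, PowerSeries.coeff n (Hop i 1) = 0 := by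
    intro i n hn
    cases n with
    | zero => exact hE0 i
    | succ n => rw [hE, hrec n (by omega), sub_self]
  -- At order m + 1, the first one not known to vanish, the part of `Hop i` with a factor ħ
  -- contributes nothing, and neither does multiplication by ∂_i F; only ∂_i remains.
  have hHE : ∀ i i', PowerSeries.coeff (m + 1) (Hop i (Hop i' 1)) =
      pderiv i (PowerSeries.coeff (m + 1) (Hop i' 1)) := by
    intro i i'
    rw [hHop_apply, map_add, PowerSeries.coeff_smul, PowerSeries.coeff_succ_X_mul, map_sub,
      PowerSeries.coeff_smul, coeff_virasoro_of_vanish hF (hvan i') _ m (by omega),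
      coeff_virasoro_of_vanish hF (hvan i') _ m (by omega),
      coeff_conjDer_of_vanish hF _ (hvan i') _ le_rfl, smul_zero, sub_zero, smul_zero, add_zero]
  have h1 := congrArg (fun A : Module.End ℂ (PowerSeries Fock) =>
    PowerSeries.coeff (m + 1) (A 1)) hcomm
  -- The bracket of the constraints is ħ times constraints, so its order m + 1 involves only orders
  -- that vanish. What is left is closedness, because the second derivatives of `F (m + 1)` cancel
  -- whatever this polynomial is.
  have h2 : PowerSeries.coeff (m + 1) (Hop j (Hop k 1)) -
      PowerSeries.coeff (m + 1) (Hop k (Hop j 1)) = 0 := by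
    rw [← map_sub]
    refine h1.trans ?_
    change PowerSeries.coeff (m + 1)
      (((j : ℂ) - k) • (PowerSeries.X * (Hop (j + k) 1 - c • Hop (j + k - 1) 1))) = 0
    rw [PowerSeries.coeff_smul, PowerSeries.coeff_succ_X_mul, map_sub, PowerSeries.coeff_smul,
      hvan _ m (by omega), hvan _ m (by omega), smul_zero, sub_zero, smul_zero]
  rw [hHE, hHE, hE, hE, map_sub, map_sub, pderiv_pderiv_comm j k] at h2
  linear_combination -h2

theorem pderiv_fockEnergy (c : ℂ) (m k : ℕ) :
    pderiv k (fockEnergy c (m + 1)) = recursionRHS c (fockEnergy c) m k := by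
  induction m using Nat.strong_induction_on generalizing k with
  | _ m ih =>
    -- The cutoff i ≤ m in the definition of `fockEnergy` serves only the termination of the
    -- recursion; `recursionRHS` at m does not see beyond it.
    have h1 : recursionRHS c (fun i => if _h : i ≤ m then fockEnergy c i else 0) m =
        recursionRHS c (fockEnergy c) m := by
      funext k
      have h2 : ∀ k, loopCoeff (fun i => if _h : i ≤ m then fockEnergy c i else 0) m k =
          loopCoeff (fockEnergy c) m k :=
        loopCoeff_congr fun i hi => by rw [dif_pos hi]
      simp only [recursionRHS, h2]
    rw [fockEnergy, h1]
    refine pderiv_primitive ?_ k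
    obtain ⟨M, hM⟩ := exists_common_bound (fockEnergy c) m
    refine exists_primitive _ (2 * M + 2) (fun k hk => ?_)
      (pderiv_recursionRHS_comm c (by rw [fockEnergy]) ih)
    rw [recursionRHS, loopCoeff_eq_zero hM hk, loopCoeff_eq_zero hM (by omega), smul_zero, sub_zero,
      smul_zero]

end FreeEnergy
end EquivariantCP1

end

noncomputable section

namespace EquivariantCP1

section Polarization

open Finset MvPolynomial

/-! ### Directional derivatives on the Fock space -/

theorem derivation_sum_apply {α : Type*} (s : Finset α) (f : α → Derivation ℂ Fock Fock) (p : Fock) :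
    (∑ a ∈ s, f a) p = ∑ a ∈ s, f a p := by
  classical
  induction s using Finset.induction_on with
  | empty => simp
  | insert a s ha ih => rw [sum_insert ha, sum_insert ha, Derivation.add_apply, ih]

theorem derivation_eq_sum (d : Derivation ℂ Fock Fock) {p : Fock} {M : ℕ}
    (h : ∀ i ∈ p.vars, i < M) : d p = ∑ n ∈ range M, d (X n) * pderiv n p := by
  have h1 : d p = (∑ n ∈ range M, d (X n) • (pderiv n : Derivation ℂ Fock Fock)) p := by
    refine derivation_eq_of_forall_mem_vars fun i hi => ?_
    rw [derivation_sum_apply, sum_eq_single i]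
    · simp
    · intro b _ hb
      rw [Derivation.smul_apply, pderiv_X_of_ne hb.symm, smul_zero]
    · intro hi'
      exact absurd (mem_range.mpr (h i hi)) hi'
  rw [h1, derivation_sum_apply]
  rfl

/-- The derivation `∑_c v_c ∂_c`. -/
def vecDer (v : ℕ → ℂ) : Derivation ℂ Fock Fock := mkDerivation ℂ fun c => C (v c)

@[simp]
theorem vecDer_X (v : ℕ → ℂ) (c : ℕ) : vecDer v (X c) = C (v c) := by simp [vecDer]

theorem vecDer_eq_sum (v : ℕ → ℂ) {p : Fock} {M : ℕ} (h : ∀ i ∈ p.vars, i < M) :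
    vecDer v p = ∑ n ∈ range M, v n • pderiv n p := by
  rw [derivation_eq_sum _ h]
  simp [smul_eq_C_mul]

theorem vecDer_comm (v u : ℕ → ℂ) (p : Fock) : vecDer v (vecDer u p) = vecDer u (vecDer v p) := by
  have h : ⁅vecDer v, vecDer u⁆ = 0 := derivation_ext fun i => by
    simp [Derivation.commutator_apply]
  have := congrArg (fun d : Derivation ℂ Fock Fock => d p) h
  simpa [Derivation.commutator_apply, sub_eq_zero] using this

theorem vecDer_smul (a : ℂ) (v : ℕ → ℂ) : vecDer (a • v) = a • vecDer v :=
  derivation_ext fun i => by simp [smul_eq_C_mul]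

/-- The direction of the commutator of `∑_c v_c ∂_c` and `shiftDer k`. -/
def shiftVec (k : ℕ) (v : ℕ → ℂ) : ℕ → ℂ := fun n =>
  if k ≤ n + 1 then bergmanCoeff (n + 1 - k) * v (n + 1 - k) else 0

theorem vecDer_shiftDer (k : ℕ) (v : ℕ → ℂ) (p : Fock) :
    vecDer v (shiftDer k p) = shiftDer k (vecDer v p) + vecDer (shiftVec k v) p := by
  have h : ⁅vecDer v, shiftDer k⁆ = vecDer (shiftVec k v) := derivation_ext fun i => by
    rw [Derivation.commutator_apply, shiftDer_X, vecDer_X, vecDer_X, derivation_C, sub_zero,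
      shiftVec]
    split_ifs
    · rw [Derivation.map_smul, vecDer_X, smul_eq_C_mul, C_mul]
    · simp
  have := congrArg (fun d : Derivation ℂ Fock Fock => d p) h
  simp only [Derivation.commutator_apply] at this
  rw [← this]
  ring

theorem constantCoeff_shiftDer (k : ℕ) (p : Fock) : constantCoeff (shiftDer k p) = 0 := by
  obtain ⟨M, hM⟩ := exists_bound_vars p
  rw [derivation_eq_sum _ hM, map_sum]
  refine sum_eq_zero fun n _ => ?_
  rw [map_mul, shiftDer_X]
  split_ifs <;> simp [smul_eq_C_mul]

/-- Constant-coefficient derivations commute, so mixed derivatives may be folded over an unordered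
multiset. The symmetry of polarizations in their arguments is thereby built in. -/
instance : LeftCommutative (fun (v : ℕ → ℂ) (A : Fock →ₗ[ℂ] ℂ) =>
    A ∘ₗ (vecDer v : Fock →ₗ[ℂ] Fock)) where
  left_comm v u A := LinearMap.ext fun p => by
    simp only [LinearMap.comp_apply, Derivation.coeFn_coe, vecDer_comm v u]

/-- The mixed directional derivative at the origin in the directions in `s`. -/
def polar (s : Multiset (ℕ → ℂ)) : Fock →ₗ[ℂ] ℂ :=
  s.foldr (fun v A => A ∘ₗ (vecDer v : Fock →ₗ[ℂ] Fock))
    (aeval (fun _ => (0 : ℂ)) : Fock →ₐ[ℂ] ℂ).toLinearMap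

theorem polar_zero (p : Fock) : polar 0 p = constantCoeff p := by
  simp [polar, constantCoeff_eq]

theorem polar_cons (v : ℕ → ℂ) (s : Multiset (ℕ → ℂ)) (p : Fock) :
    polar (v ::ₘ s) p = polar s (vecDer v p) := by
  simp [polar]

variable {ι : Type*} [DecidableEq ι]

theorem polar_insert (v : ι → ℕ → ℂ) {a : ι} {N : Finset ι} (ha : a ∉ N) (p : Fock) :
    polar ((insert a N).val.map v) p = polar (N.val.map v) (vecDer (v a) p) := by
  rw [insert_val_of_notMem ha, Multiset.map_cons, polar_cons]

/-- Iterated Leibniz rule: every direction falls on one of the two factors. This is the source of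
the sum over subsets J in the topological recursion. -/
theorem polar_mul (v : ι → ℕ → ℂ) (N : Finset ι) (p q : Fock) :
    polar (N.val.map v) (p * q) =
      ∑ J ∈ N.powerset, polar (J.val.map v) p * polar ((N \ J).val.map v) q := by
  induction N using Finset.induction_on generalizing p q with
  | empty => simp [polar_zero]
  | insert a N ha ih =>
    rw [polar_insert v ha, Derivation.leibniz, smul_eq_mul, smul_eq_mul, mul_comm q, map_add, ih,
      ih, sum_powerset_insert ha]
    congr 1
    · refine sum_congr rfl fun J hJ => ?_
      have hJ' := mem_powerset.mp hJ
      rw [insert_sdiff_of_notMem _ (fun h => ha (hJ' h)),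
        polar_insert v (fun h => ha (mem_sdiff.mp h).1)]
    · refine sum_congr rfl fun J hJ => ?_
      have hJ' := mem_powerset.mp hJ
      rw [insert_sdiff_insert, sdiff_insert_of_notMem ha, polar_insert v (fun h => ha (hJ' h))]

/-- The coefficients of `shiftDer k` are linear in t and vanish at the origin. When it is moved
outside all directional derivatives, only its commutators survive, which alter one direction at a
time. -/
theorem polar_shiftDer (v : ι → ℕ → ℂ) (N : Finset ι) (k : ℕ) (p : Fock) :
    polar (N.val.map v) (shiftDer k p) =
      ∑ j ∈ N, polar (shiftVec k (v j) ::ₘ (N.erase j).val.map v) p := by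
  induction N using Finset.induction_on generalizing p with
  | empty => simp [polar_zero, constantCoeff_shiftDer]
  | insert a N ha ih =>
    rw [polar_insert v ha, vecDer_shiftDer, map_add, ih, sum_insert ha, erase_insert ha,
      polar_cons, add_comm]
    congr 1
    refine sum_congr rfl fun j hj => ?_
    have hja : a ≠ j := fun h => ha (h ▸ hj)
    rw [erase_insert_of_ne hja, polar_cons, polar_cons,
      polar_insert v (fun h => ha (mem_of_mem_erase h)), vecDer_comm]

/-! ### The genus grading -/

/-- All monomials of `p` have a degree which is at most `w`, and congruent to `w` modulo `2`. -/
def HasGenusWeight (w : ℕ) (p : Fock) : Prop :=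
  ∀ d, coeff d p ≠ 0 → ∃ g, d.degree + 2 * g = w

namespace HasGenusWeight

theorem zero (w : ℕ) : HasGenusWeight w 0 := fun d h => absurd (coeff_zero d) h

theorem add {w : ℕ} {p q : Fock} (hp : HasGenusWeight w p) (hq : HasGenusWeight w q) :
    HasGenusWeight w (p + q) := fun d h => by
  by_cases h1 : coeff d p = 0
  · refine hq d fun h2 => h ?_
    rw [coeff_add, h1, h2, add_zero]
  · exact hp d h1

theorem smul {w : ℕ} {p : Fock} (hp : HasGenusWeight w p) (c : ℂ) : HasGenusWeight w (c • p) :=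
  fun d h => hp d fun h1 => h (by rw [coeff_smul, h1, smul_zero])

theorem sub {w : ℕ} {p q : Fock} (hp : HasGenusWeight w p) (hq : HasGenusWeight w q) :
    HasGenusWeight w (p - q) := by
  have := hp.add (hq.smul (-1))
  rwa [neg_one_smul, ← sub_eq_add_neg] at this

theorem sum {α : Type*} {w : ℕ} {s : Finset α} {f : α → Fock}
    (h : ∀ a ∈ s, HasGenusWeight w (f a)) : HasGenusWeight w (∑ a ∈ s, f a) :=
  Finset.sum_induction f (HasGenusWeight w) (fun _ _ => add) (zero w) h

theorem mul {w w' : ℕ} {p q : Fock} (hp : HasGenusWeight w p) (hq : HasGenusWeight w' q) :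
    HasGenusWeight (w + w') (p * q) := fun d h => by
  rw [coeff_mul] at h
  obtain ⟨x, hx, hx'⟩ := exists_ne_zero_of_sum_ne_zero h
  obtain ⟨g, hg⟩ := hp _ (left_ne_zero_of_mul hx')
  obtain ⟨g', hg'⟩ := hq _ (right_ne_zero_of_mul hx')
  refine ⟨g + g', ?_⟩
  rw [← mem_antidiagonal.mp hx, map_add]
  omega

theorem X (j : ℕ) : HasGenusWeight 1 (X j) := fun d h => by
  rw [coeff_X] at h
  split_ifs at h with h1
  · exact ⟨0, by simp [← h1]⟩
  · exact absurd rfl h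

theorem C (r : ℂ) (g : ℕ) : HasGenusWeight (2 * g) (C r) := fun d h => by
  rw [coeff_C] at h
  split_ifs at h with h1
  · exact ⟨g, by simp [← h1]⟩
  · exact absurd rfl h

theorem pderiv {w : ℕ} {p : Fock} (hp : HasGenusWeight (w + 1) p) (k : ℕ) :
    HasGenusWeight w (pderiv k p) := fun d h => by
  rw [coeff_pderiv] at h
  obtain ⟨g, hg⟩ := hp _ (left_ne_zero_of_mul h)
  refine ⟨g, ?_⟩
  rw [map_add, Finsupp.degree_single] at hg
  omega

theorem weaken {w : ℕ} {p : Fock} (hp : HasGenusWeight w p) : HasGenusWeight (w + 2) p :=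
  fun d h => by
    obtain ⟨g, hg⟩ := hp d h
    exact ⟨g + 1, by omega⟩

theorem shiftDer {w : ℕ} {p : Fock} (hp : ∀ n, HasGenusWeight w (MvPolynomial.pderiv n p))
    (k : ℕ) : HasGenusWeight (w + 1) (shiftDer k p) := by
  obtain ⟨M, hM⟩ := exists_bound_vars p
  rw [derivation_eq_sum _ hM]
  refine sum fun n _ => ?_
  rw [shiftDer_X, add_comm]
  refine mul ?_ (hp n)
  split_ifs
  · exact (X _).smul _
  · exact zero 1

theorem vecDer {w : ℕ} {p : Fock} (hp : HasGenusWeight (w + 1) p) (v : ℕ → ℂ) :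
    HasGenusWeight w (vecDer v p) := by
  obtain ⟨M, hM⟩ := exists_bound_vars p
  rw [vecDer_eq_sum _ hM]
  exact sum fun n _ => (hp.pderiv n).smul _

theorem vecDer_eq_zero {p : Fock} (hp : HasGenusWeight 0 p) (v : ℕ → ℂ) :
    EquivariantCP1.vecDer v p = 0 := by
  have h : p = MvPolynomial.C (constantCoeff p) := by
    ext d
    rw [coeff_C]
    split_ifs with h
    · rw [← h, constantCoeff_eq]
    · by_contra h1
      obtain ⟨g, hg⟩ := hp d h1
      exact h ((Finsupp.degree_eq_zero_iff d).mp (by omega)).symm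
  rw [h, derivation_C]

theorem polar {w : ℕ} {p : Fock} (hp : HasGenusWeight w p) {s : Multiset (ℕ → ℂ)}
    (h : polar s p ≠ 0) : ∃ g, s.card + 2 * g = w := by
  induction s using Multiset.induction_on generalizing w p with
  | empty =>
    rw [polar_zero, constantCoeff_eq] at h
    obtain ⟨g, hg⟩ := hp 0 h
    exact ⟨g, by simpa using hg⟩
  | cons v s ih =>
    rw [polar_cons] at h
    cases w with
    | zero => exact absurd (by rw [hp.vecDer_eq_zero, map_zero]) h
    | succ w =>
      obtain ⟨g, hg⟩ := ih (hp.vecDer v) h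
      exact ⟨g, by rw [Multiset.card_cons]; omega⟩

end HasGenusWeight

/-- The grading concerns derivatives, because `primitive` leaves the constant term undetermined. In
the recursion a second derivative loses two degrees, which counts as one more unit of genus
(`weaken`). -/
theorem hasGenusWeight_pderiv_fockEnergy (c : ℂ) (m k : ℕ) :
    HasGenusWeight (m + 1) (pderiv k (fockEnergy c m)) := by
  induction m using Nat.strong_induction_on generalizing k with
  | _ m ih =>
    cases m with
    | zero => rw [fockEnergy, map_zero]; exact HasGenusWeight.zero _
    | succ m =>
      have hL : ∀ k, HasGenusWeight (m + 2) (loopCoeff (fockEnergy c) m k) := by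
        have hs := fun k => HasGenusWeight.shiftDer (ih m (by omega)) k
        intro k
        match k with
        | 0 =>
          refine HasGenusWeight.add ?_ (hs 0)
          split_ifs with h
          · subst h; exact (HasGenusWeight.X 0).mul (HasGenusWeight.X 0)
          · exact HasGenusWeight.zero _
        | 1 =>
          refine HasGenusWeight.add ?_ (hs 1)
          split_ifs with h
          · subst h; exact HasGenusWeight.C _ 1
          · exact HasGenusWeight.zero _
        | n + 2 =>
          refine (hs _).add (HasGenusWeight.sum fun p _ => ?_)
          refine HasGenusWeight.add ?_ (HasGenusWeight.sum fun ij hij => ?_)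
          · exact ((ih m (by omega) p.2).pderiv p.1).weaken
          · have h := mem_antidiagonal.mp hij
            have := (ih ij.1 (by omega) p.1).mul (ih ij.2 (by omega) p.2)
            rwa [show ij.1 + 1 + (ij.2 + 1) = m + 2 by omega] at this
      rw [pderiv_fockEnergy]
      exact ((hL _).sub ((hL _).smul c)).smul _

/-- With n = `s.card` + 1 directions the condition reads 2g - 2 + n = m, so a single genus
contributes to each degree. Vanishing of all other polarizations replaces any explicit splitting of
F_m by genus. -/
theorem polar_fockEnergy_ne_zero (c : ℂ) (m : ℕ) {v : ℕ → ℂ} {s : Multiset (ℕ → ℂ)}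
    (h : polar (v ::ₘ s) (fockEnergy c m) ≠ 0) : ∃ g, s.card + 2 * g = m + 1 := by
  rw [polar_cons] at h
  obtain ⟨M, hM⟩ := exists_bound_vars (fockEnergy c m)
  rw [vecDer_eq_sum _ hM] at h
  exact (HasGenusWeight.sum fun n _ =>
    (hasGenusWeight_pderiv_fockEnergy c m n).smul _).polar h

end Polarization
end EquivariantCP1

end

/-! ### Solution of the topological recursion by polarizations -/

noncomputable section

namespace EquivariantCP1

section Residues

open Finset Filter Topology

/-! ### Residues of the recursion kernel -/

/-- `f dw` has the residue `c` at `0`, computed by all sufficiently small circles. -/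
def HasResidue (f : ℂ → ℂ) (c : ℂ) : Prop :=
  ∀ᶠ R in 𝓝[>] (0 : ℝ), CircleIntegrable f 0 R ∧ (∮ w in C(0, R), f w) = 2 * Real.pi * Complex.I * c

theorem HasResidue.residueZero_eq {f : ℂ → ℂ} {c : ℂ} (h : HasResidue f c) : residueZero f = c := by
  refine Tendsto.limUnder_eq ?_
  refine tendsto_const_nhds.congr' ?_
  filter_upwards [h] with R hR
  rw [hR.2, ← mul_assoc, inv_mul_cancel₀ Complex.two_pi_I_ne_zero, one_mul]

theorem HasResidue.add {f g : ℂ → ℂ} {c d : ℂ} (hf : HasResidue f c) (hg : HasResidue g d) :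
    HasResidue (fun w => f w + g w) (c + d) := by
  filter_upwards [hf, hg] with R h1 h2
  refine ⟨h1.1.add h2.1, ?_⟩
  rw [circleIntegral.integral_add h1.1 h2.1, h1.2, h2.2]
  ring

theorem HasResidue.const_mul {f : ℂ → ℂ} {c : ℂ} (hf : HasResidue f c) (a : ℂ) :
    HasResidue (fun w => a * f w) (a * c) := by
  filter_upwards [hf] with R h1
  refine ⟨IntervalIntegrable.const_mul h1.1 a, ?_⟩
  rw [circleIntegral.integral_const_mul, h1.2]
  ring

theorem HasResidue.sum {α : Type*} (s : Finset α) {f : α → ℂ → ℂ} {c : α → ℂ}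
    (h : ∀ a ∈ s, HasResidue (f a) (c a)) :
    HasResidue (fun w => ∑ a ∈ s, f a w) (∑ a ∈ s, c a) := by
  classical
  induction s using Finset.induction_on with
  | empty =>
    refine Eventually.of_forall fun R => ⟨?_, by simp [circleIntegral]⟩
    simp only [sum_empty]
    exact circleIntegrable_const 0 0 R
  | insert a s ha ih =>
    simp only [sum_insert ha]
    exact (h a (mem_insert_self a s)).add (ih fun b hb => h b (mem_insert_of_mem hb))

theorem HasResidue.congr {f g : ℂ → ℂ} {c : ℂ} (hf : HasResidue f c)
    (hfg : ∀ᶠ w in 𝓝[≠] (0 : ℂ), f w = g w) : HasResidue g c := by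
  obtain ⟨ε, hε, h⟩ := Metric.eventually_nhds_iff.mp (eventually_nhdsWithin_iff.mp hfg)
  have hR : ∀ᶠ R in 𝓝[>] (0 : ℝ), R < ε :=
    (eventually_lt_nhds hε).filter_mono nhdsWithin_le_nhds
  filter_upwards [hf, hR, self_mem_nhdsWithin] with R h1 h2 h3
  have h3' : 0 < R := h3
  have heq : Set.EqOn f g (Metric.sphere 0 R) := fun w hw => by
    have hw' : dist w 0 = R := hw
    refine h (by rw [hw']; exact h2) fun h0 => ?_
    rw [h0, dist_self] at hw'
    exact h3'.ne hw'
  refine ⟨(circleIntegrable_congr (by rwa [abs_of_pos h3'])).mp h1.1, ?_⟩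
  · rw [← h1.2]
    exact (circleIntegral.integral_congr h3'.le heq).symm

theorem hasResidue_of_differentiableOn {f : ℂ → ℂ} {r : ℝ} (hr : 0 < r)
    (hf : DifferentiableOn ℂ f (Metric.ball 0 r)) : HasResidue f 0 := by
  have hR : ∀ᶠ R in 𝓝[>] (0 : ℝ), R < r :=
    (eventually_lt_nhds hr).filter_mono nhdsWithin_le_nhds
  filter_upwards [hR, self_mem_nhdsWithin] with R h2 h3
  have h3' : 0 < R := h3
  have hsub : Metric.closedBall (0 : ℂ) R ⊆ Metric.ball 0 r := Metric.closedBall_subset_ball h2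
  refine ⟨ContinuousOn.circleIntegrable h3'.le
    ((hf.continuousOn.mono hsub).mono Metric.sphere_subset_closedBall), ?_⟩
  rw [mul_zero]
  exact Complex.circleIntegral_eq_zero_of_differentiable_on_off_countable h3'.le
    Set.countable_empty (hf.continuousOn.mono hsub) fun w hw =>
      hf.differentiableAt (Metric.isOpen_ball.mem_nhds
        (hsub (Metric.ball_subset_closedBall hw.1)))

theorem hasResidue_zpow (n : ℤ) : HasResidue (fun w => w ^ n) (if n = -1 then 1 else 0) := by
  filter_upwards [self_mem_nhdsWithin] with R hR
  have hR' : 0 < R := hR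
  refine ⟨?_, ?_⟩
  · refine ContinuousOn.circleIntegrable hR'.le fun w hw => ?_
    have hw' : dist w 0 = R := hw
    refine (continuousAt_zpow₀ w n (Or.inl fun h0 => ?_)).continuousWithinAt
    rw [h0, dist_self] at hw'
    exact hR'.ne hw'
  · split_ifs with h
    · subst h
      have := circleIntegral.integral_sub_center_inv (0 : ℂ) hR'.ne'
      simpa [zpow_neg_one] using this
    · have := circleIntegral.integral_sub_zpow_of_ne h (0 : ℂ) 0 R
      simpa using this

/-- The constant (w₀ + w₁)/2 of y drops out of ω - σ*ω, which leaves 4w²/x. The condition on norms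
keeps the segment from -w to w away from the pole z of B. -/
theorem recursionKernel_eq (w₀ w₁ : ℂ) {w z : ℂ} (hw : w ≠ 0) (hwz : ‖w‖ < ‖z‖) :
    recursionKernel w₀ w₁ w z = (w ^ 2 - Lam w₀ w₁) / (4 * w * (z ^ 2 - w ^ 2)) := by
  have hne : ∀ t : ℝ, t ∈ Set.Icc (-1 : ℝ) 1 → (t : ℂ) * w - z ≠ 0 := by
    intro t ht h
    have h1 : ‖(t : ℂ) * w‖ = ‖z‖ := by rw [sub_eq_zero.mp h]
    rw [norm_mul, Complex.norm_real, Real.norm_eq_abs] at h1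
    have h2 : |t| ≤ 1 := abs_le.mpr ht
    nlinarith [norm_nonneg w]
  have hint : ∫ t in (-1 : ℝ)..1, bergman (t * w) z * w = -(w - z)⁻¹ + (-w - z)⁻¹ := by
    have hd : ∀ t ∈ Set.uIcc (-1 : ℝ) 1,
        HasDerivAt (fun t : ℝ => -((t : ℂ) * w - z)⁻¹) (bergman (t * w) z * w) t := by
      intro t ht
      rw [Set.uIcc_of_le (by norm_num)] at ht
      have h1 : HasDerivAt (fun t : ℝ => (t : ℂ) * w - z) (1 * w) t :=
        ((Complex.ofRealCLM.hasDerivAt (x := t)).mul_const w).sub_const z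
      have h2 := (h1.inv (hne t ht)).neg
      refine HasDerivAt.congr_deriv h2 ?_
      rw [bergman]
      ring
    rw [intervalIntegral.integral_eq_sub_of_hasDerivAt hd]
    · push_cast; ring_nf
    · refine ContinuousOn.intervalIntegrable fun t ht => ?_
      rw [Set.uIcc_of_le (by norm_num)] at ht
      refine ContinuousAt.continuousWithinAt ?_
      unfold bergman
      refine ContinuousAt.mul (ContinuousAt.div continuousAt_const ?_ (pow_ne_zero 2 (hne t ht)))
        continuousAt_const
      fun_prop
  have h1 : w - z ≠ 0 := by simpa using hne 1 (by norm_num)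
  have h2 : -w - z ≠ 0 := by simpa using hne (-1) (by norm_num)
  have h3 : z ^ 2 - w ^ 2 ≠ 0 := by
    rw [show z ^ 2 - w ^ 2 = (w - z) * (-w - z) by ring]
    exact mul_ne_zero h1 h2
  have h4 : omegaForm w₀ w₁ w - -omegaForm w₀ w₁ (-w) = 4 * w ^ 2 / (w ^ 2 - Lam w₀ w₁) := by
    unfold omegaForm
    rw [(hasDerivAt_curveX w₀ w₁ w).deriv, (hasDerivAt_curveX w₀ w₁ (-w)).deriv]
    unfold curveX curveY
    rw [neg_sq, sub_neg_eq_add, ← add_div]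
    ring
  have h5 : -(w - z)⁻¹ + (-w - z)⁻¹ = 2 * w / (z ^ 2 - w ^ 2) := by
    rw [show z ^ 2 - w ^ 2 = (w - z) * (-w - z) by ring]
    field_simp
    ring
  rw [recursionKernel, hint, h4, h5, div_div_eq_mul_div]
  field_simp

/-- The residue of the recursion kernel against an even Laurent polynomial. -/
theorem residueZero_recursionKernel (w₀ w₁ : ℂ) {z : ℂ} (hz : z ≠ 0) (B : ℕ) (ρ : ℕ → ℂ)
    {h : ℂ → ℂ} {r : ℝ} (hr : 0 < r) (hh : DifferentiableOn ℂ h (Metric.ball 0 r)) {f : ℂ → ℂ}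
    (hf : ∀ᶠ w in 𝓝[≠] (0 : ℂ), f w = recursionKernel w₀ w₁ w z *
      -(∑ b ∈ range B, (w ^ (2 * b))⁻¹ * ρ b + w * h w)) :
    residueZero f = -(1 / 4) * ∑ b ∈ range B,
      ρ b * ((z ^ 2 - Lam w₀ w₁) * (z ^ (2 * b + 2))⁻¹ - if b = 0 then 1 else 0) := by
  set Λ := Lam w₀ w₁
  set s := min r ‖z‖ with hs
  have hs0 : 0 < s := lt_min hr (norm_pos_iff.mpr hz)
  have hne : ∀ w ∈ Metric.ball (0 : ℂ) s, z ^ 2 - w ^ 2 ≠ 0 := by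
    intro w hw h0
    have h1 : ‖w‖ < ‖z‖ := (mem_ball_zero_iff.mp hw).trans_le (min_le_right _ _)
    have h2 : ‖z‖ ^ 2 = ‖w‖ ^ 2 := by rw [← norm_pow, ← norm_pow, sub_eq_zero.mp h0]
    nlinarith [norm_nonneg w]
  have hrat : ∀ b : ℕ, DifferentiableOn ℂ (fun w => w / (z ^ (2 * b + 2) * (z ^ 2 - w ^ 2)))
      (Metric.ball 0 s) := fun b => by
    refine DifferentiableOn.div (by fun_prop) (by fun_prop) fun w hw => ?_
    exact mul_ne_zero (pow_ne_zero _ hz) (hne w hw)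
  -- The kernel has at most a simple pole at w = 0, so its product with `w * h w` is holomorphic
  -- there and has residue 0.
  have hk : DifferentiableOn ℂ (fun w => (w ^ 2 - Λ) / (4 * (z ^ 2 - w ^ 2)) * h w)
      (Metric.ball 0 s) := by
    refine DifferentiableOn.mul (DifferentiableOn.div (by fun_prop) (by fun_prop) fun w hw => ?_)
      (hh.mono (Metric.ball_subset_ball (min_le_left _ _)))
    exact mul_ne_zero (by norm_num) (hne w hw)
  -- Write (w² - Λ)/(z² - w²) = -1 + (z² - Λ)/(z² - w²) and stop the geometric series after i = b.
  -- After division by w^(2b+1) its remainder is still holomorphic at 0, and of its terms only i = b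
  -- has a residue.
  have hterm : ∀ b : ℕ, HasResidue (fun w => -w ^ (-(2 * b + 1) : ℤ) + (z ^ 2 - Λ) *
      (∑ i ∈ range (b + 1), (z ^ (2 * i + 2))⁻¹ * w ^ (2 * i - (2 * b + 1) : ℤ) +
        w / (z ^ (2 * b + 2) * (z ^ 2 - w ^ 2))))
      ((z ^ 2 - Λ) * (z ^ (2 * b + 2))⁻¹ - if b = 0 then 1 else 0) := by
    intro b
    have h1 := (hasResidue_zpow (-(2 * b + 1))).const_mul (-1)
    have h2 := HasResidue.sum (range (b + 1)) fun i _ =>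
      (hasResidue_zpow (2 * i - (2 * b + 1))).const_mul (z ^ (2 * i + 2))⁻¹
    have h3 := hasResidue_of_differentiableOn hs0 (hrat b)
    have h4 := h1.add ((h2.add h3).const_mul (z ^ 2 - Λ))
    have e1 : ∑ i ∈ range (b + 1), (z ^ (2 * i + 2))⁻¹ *
        (if (2 * i - (2 * b + 1) : ℤ) = -1 then (1 : ℂ) else 0) = (z ^ (2 * b + 2))⁻¹ := by
      rw [sum_eq_single b]
      · rw [if_pos (by ring), mul_one]
      · intro i _ hi
        rw [if_neg (by omega), mul_zero]
      · intro hb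
        exact absurd (self_mem_range_succ b) hb
    have e2 : (-(2 * b + 1) : ℤ) = -1 ↔ b = 0 := by omega
    rw [e1] at h4
    simp only [e2] at h4
    convert h4 using 1
    · funext w; ring
    · ring
  have hsum := (HasResidue.sum (range B) fun b _ => (hterm b).const_mul (ρ b)).const_mul (-(1 / 4))
  have hall := hsum.add ((hasResidue_of_differentiableOn hs0 hk).const_mul (-1))
  rw [mul_zero, add_zero] at hall
  refine (hall.congr ?_).residueZero_eq
  have hball : ∀ᶠ w in 𝓝[≠] (0 : ℂ), w ∈ Metric.ball (0 : ℂ) s :=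
    nhdsWithin_le_nhds (Metric.ball_mem_nhds 0 hs0)
  filter_upwards [hf, hball, self_mem_nhdsWithin] with w h1 h2 h3
  have hw : w ≠ 0 := h3
  have hwz : ‖w‖ < ‖z‖ := (mem_ball_zero_iff.mp h2).trans_le (min_le_right _ _)
  have hzw := hne w h2
  rw [h1, recursionKernel_eq w₀ w₁ hw hwz]
  have hgeom : ∀ b : ℕ, -w ^ (-(2 * b + 1) : ℤ) + (z ^ 2 - Λ) *
      (∑ i ∈ range (b + 1), (z ^ (2 * i + 2))⁻¹ * w ^ (2 * i - (2 * b + 1) : ℤ) +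
        w / (z ^ (2 * b + 2) * (z ^ 2 - w ^ 2))) =
      (w ^ 2 - Λ) / (w * (z ^ 2 - w ^ 2)) * (w ^ (2 * b))⁻¹ := by
    intro b
    have e1 : ∀ i : ℕ, w ^ (2 * i - (2 * b + 1) : ℤ) = w ^ (2 * i) * (w ^ (2 * b + 1))⁻¹ := by
      intro i
      rw [zpow_sub₀ hw, div_eq_mul_inv]
      norm_cast
    have e2 : w ^ (-(2 * b + 1) : ℤ) = (w ^ (2 * b + 1))⁻¹ := by
      rw [zpow_neg]; norm_cast
    have e3 : ∑ i ∈ range (b + 1), (z ^ (2 * i + 2))⁻¹ * w ^ (2 * i) =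
        (1 - w ^ (2 * b + 2) * (z ^ (2 * b + 2))⁻¹) / (z ^ 2 - w ^ 2) := by
      clear e1 e2
      induction b with
      | zero => field_simp; simp; field_simp
      | succ b ih =>
        rw [sum_range_succ, ih]
        field_simp
        ring
    simp only [e1, e2, ← mul_assoc]
    rw [← sum_mul, e3]
    field_simp
    ring
  simp only [hgeom]
  rw [show 4 * w * (z ^ 2 - w ^ 2) = 4 * (w * (z ^ 2 - w ^ 2)) by ring]
  have e4 : ∑ b ∈ range B, ρ b * ((w ^ 2 - Λ) / (w * (z ^ 2 - w ^ 2)) * (w ^ (2 * b))⁻¹) =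
      (w ^ 2 - Λ) / (w * (z ^ 2 - w ^ 2)) * ∑ b ∈ range B, (w ^ (2 * b))⁻¹ * ρ b := by
    rw [mul_sum]
    exact sum_congr rfl fun b _ => by ring
  rw [e4]
  field_simp
  ring

end Residues
end EquivariantCP1

end

noncomputable section

namespace EquivariantCP1

section Bracket

open Finset MvPolynomial

/-! ### Generating functions of the loop coefficients -/

/-- The coefficients `z ^ (-2c-2)`. -/
def xiVec (z : ℂ) : ℕ → ℂ := fun c => (z ^ (2 * c + 2))⁻¹

theorem xiVec_neg (z : ℂ) : xiVec (-z) = xiVec z := by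
  funext c
  rw [xiVec, xiVec, show 2 * c + 2 = 2 * (c + 1) by ring, pow_mul, pow_mul, neg_sq]

/-- The array T is supported on a, b < M, so the antidiagonals below 2M exhaust it. -/
theorem sum_antidiagonal_weighted {E : Type*} [AddCommGroup E] [Module ℂ E] (s : ℂ) (M : ℕ)
    (T : ℕ → ℕ → E) (hT : ∀ a b, M ≤ a ∨ M ≤ b → T a b = 0) :
    ∑ n ∈ range (2 * M), s ^ n • ∑ p ∈ antidiagonal n, T p.1 p.2 =
      ∑ a ∈ range M, ∑ b ∈ range M, (s ^ a * s ^ b) • T a b := by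
  have h1 : ∑ n ∈ range (2 * M), s ^ n • ∑ p ∈ antidiagonal n, T p.1 p.2 =
      ∑ x ∈ (range (2 * M)).sigma fun n => antidiagonal n,
        (s ^ x.2.1 * s ^ x.2.2) • T x.2.1 x.2.2 := by
    rw [sum_sigma]
    refine sum_congr rfl fun n _ => ?_
    rw [smul_sum]
    refine sum_congr rfl fun p hp => ?_
    rw [← mem_antidiagonal.mp hp, pow_add]
  rw [h1, ← sum_product']
  symm
  refine sum_of_injOn (fun x => ⟨x.1 + x.2, x⟩) ?_ ?_ ?_ ?_
  · intro x _ y _ h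
    exact (Sigma.mk.inj_iff.mp h).2.eq
  · intro x hx
    simp only [coe_product, Set.mem_prod, mem_coe, mem_range] at hx
    simp only [coe_sigma, Set.mem_sigma_iff, mem_coe, mem_range,
      HasAntidiagonal.mem_antidiagonal, and_true]
    omega
  · intro x hx hx'
    rw [hT, smul_zero]
    by_contra h
    refine hx' ⟨x.2, ?_, ?_⟩
    · simp only [coe_product, Set.mem_prod, mem_coe, mem_range]
      omega
    · obtain ⟨n, p⟩ := x
      have := mem_antidiagonal.mp (mem_sigma.mp hx).2
      simp only at this
      subst this
      rfl
  · intro x _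
    rfl

/-- Generating function of the quadratic terms. -/
theorem sum_quadTerm {F : ℕ → Fock} {m M : ℕ} (h : ∀ i ≤ m, ∀ j ∈ (F i).vars, j < M) (w : ℂ) :
    ∑ n ∈ range (2 * M), (w ^ (2 * (n + 2)))⁻¹ • quadTerm F m n =
      vecDer (xiVec w) (vecDer (xiVec w) (F m)) +
        ∑ ij ∈ antidiagonal m, vecDer (xiVec w) (F ij.1) * vecDer (xiVec w) (F ij.2) := by
  have hT : ∀ a b, M ≤ a ∨ M ≤ b → (pderiv a (pderiv b (F m)) +
      ∑ ij ∈ antidiagonal m, pderiv a (F ij.1) * pderiv b (F ij.2)) = 0 := by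
    rintro a b (hab | hab)
    · rw [pderiv_pderiv_comm, pderiv_eq_zero_of_bound (h m le_rfl) hab, map_zero, zero_add]
      refine sum_eq_zero fun ij hij => ?_
      have := mem_antidiagonal.mp hij
      rw [pderiv_eq_zero_of_bound (h ij.1 (by omega)) hab, zero_mul]
    · rw [pderiv_eq_zero_of_bound (h m le_rfl) hab, map_zero, zero_add]
      refine sum_eq_zero fun ij hij => ?_
      have := mem_antidiagonal.mp hij
      rw [pderiv_eq_zero_of_bound (h ij.2 (by omega)) hab, mul_zero]
  have h1 := sum_antidiagonal_weighted ((w ^ 2)⁻¹) M _ hT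
  have hx : ∀ n, xiVec w n = (w ^ 2)⁻¹ * (w ^ 2)⁻¹ ^ n := fun n => by
    rw [xiVec, ← pow_succ', inv_pow, ← pow_mul]
    ring_nf
  have h2 : ∑ n ∈ range (2 * M), (w ^ (2 * (n + 2)))⁻¹ • quadTerm F m n =
      ((w ^ 2)⁻¹ * (w ^ 2)⁻¹) • ∑ n ∈ range (2 * M), (w ^ 2)⁻¹ ^ n • quadTerm F m n := by
    rw [smul_sum]
    refine sum_congr rfl fun n _ => ?_
    rw [smul_smul, pow_mul, inv_pow]
    congr 1
    rw [← mul_inv, ← mul_inv]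
    ring_nf
  rw [h2]
  simp only [quadTerm]
  rw [h1]
  have h3 : vecDer (xiVec w) (vecDer (xiVec w) (F m)) =
      ∑ a ∈ range M, ∑ b ∈ range M, (xiVec w a * xiVec w b) • pderiv a (pderiv b (F m)) := by
    rw [vecDer_eq_sum _ (h m le_rfl), map_sum, sum_comm]
    refine sum_congr rfl fun b _ => ?_
    have hb : ∀ M', M ≤ M' → (∀ j ∈ (pderiv b (F m)).vars, j < M') →
        vecDer (xiVec w) (pderiv b (F m)) = ∑ a ∈ range M, xiVec w a • pderiv a (pderiv b (F m)) := by
      intro M' hM' hv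
      rw [vecDer_eq_sum _ hv]
      symm
      refine sum_subset (range_mono hM') fun a _ ha => ?_
      rw [pderiv_pderiv_comm, pderiv_eq_zero_of_bound (h m le_rfl) (by simpa using ha), map_zero,
        smul_zero]
    obtain ⟨M', hM'⟩ := exists_bound_vars (pderiv b (F m))
    rw [Derivation.map_smul, hb (max M M') (le_max_left _ _)
      fun j hj => (hM' j hj).trans_le (le_max_right _ _), smul_sum]
    refine sum_congr rfl fun a _ => ?_
    rw [smul_smul, mul_comm]
  have h4 : ∑ ij ∈ antidiagonal m, vecDer (xiVec w) (F ij.1) * vecDer (xiVec w) (F ij.2) =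
      ∑ a ∈ range M, ∑ b ∈ range M, (xiVec w a * xiVec w b) •
        ∑ ij ∈ antidiagonal m, pderiv a (F ij.1) * pderiv b (F ij.2) := by
    simp only [smul_sum]
    rw [sum_congr rfl fun a _ => sum_comm, sum_comm]
    refine sum_congr rfl fun ij hij => ?_
    have := mem_antidiagonal.mp hij
    rw [vecDer_eq_sum _ (h ij.1 (by omega)), vecDer_eq_sum _ (h ij.2 (by omega)), sum_mul_sum]
    refine sum_congr rfl fun a _ => sum_congr rfl fun b _ => ?_
    rw [smul_mul_smul_comm]
  rw [h3, h4, ← sum_add_distrib, smul_sum]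
  refine sum_congr rfl fun a _ => ?_
  rw [← sum_add_distrib, smul_sum]
  refine sum_congr rfl fun b _ => ?_
  rw [← smul_add, smul_smul, hx, hx]
  congr 1
  ring

/-- The expansion of `1/(w - z)² + 1/(w + z)²` at `w = 0`. -/
theorem bergman_sym_expansion {z w : ℂ} (hz : z ≠ 0) (h : z ^ 2 - w ^ 2 ≠ 0) (n : ℕ) :
    bergman w z + bergman (-w) z = ∑ a ∈ range n, bergmanCoeff a * w ^ (2 * a) * (z ^ (2 * a + 2))⁻¹ +
      w ^ (2 * n) * ((2 * (z ^ 2 + w ^ 2) + 4 * n * (z ^ 2 - w ^ 2)) /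
        (z ^ (2 * n) * (z ^ 2 - w ^ 2) ^ 2)) := by
  induction n with
  | zero =>
    have h1 : w - z ≠ 0 := fun h0 => h (by linear_combination (-(w + z)) * h0)
    have h2 : -w - z ≠ 0 := fun h0 => h (by linear_combination (w - z) * h0)
    have h3 : (z ^ 2 - w ^ 2) ^ 2 = (w - z) ^ 2 * (-w - z) ^ 2 := by ring
    simp only [range_zero, sum_empty, bergman, mul_zero, pow_zero, Nat.cast_zero]
    rw [h3]
    field_simp
    ring
  | succ n ih =>
    rw [ih, sum_range_succ, add_assoc]
    congr 1
    simp only [bergmanCoeff]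
    push_cast
    field_simp
    ring

/-- Generating function of the linear terms. -/
theorem sum_shiftVec {z w : ℂ} (hz : z ≠ 0) (hw : w ≠ 0) (h : z ^ 2 - w ^ 2 ≠ 0) {B n : ℕ}
    (hn : n + 2 ≤ B) :
    ∑ b ∈ range B, (w ^ (2 * b))⁻¹ * shiftVec b (xiVec z) n +
      w * (w * ((2 * (z ^ 2 + w ^ 2) + 4 * (n + 2) * (z ^ 2 - w ^ 2)) /
        (z ^ (2 * (n + 2)) * (z ^ 2 - w ^ 2) ^ 2))) =
      xiVec w n * (bergman w z + bergman (-w) z) := by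
  have h1 : ∑ b ∈ range B, (w ^ (2 * b))⁻¹ * shiftVec b (xiVec z) n =
      ∑ b ∈ range (n + 2), (w ^ (2 * b))⁻¹ * shiftVec b (xiVec z) n := by
    symm
    refine sum_subset (range_mono hn) fun b _ hb => ?_
    have : ¬ b ≤ n + 1 := by simpa [Nat.lt_succ_iff] using hb
    rw [shiftVec, if_neg this, mul_zero]
  -- Multiplied by w^(-2n-2), the term w^(2a) of the expansion becomes w^(-2b) with b = n + 1 - a,
  -- hence the reversal. Expanding to n + 2 terms takes in all b ≥ 0 and leaves a remainder with the
  -- factor w².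
  rw [h1, ← sum_range_reflect, bergman_sym_expansion hz h (n + 2), mul_add (xiVec w n), mul_sum]
  congr 1
  · refine sum_congr rfl fun a ha => ?_
    have ha' : a ≤ n + 1 := Nat.lt_succ_iff.mp (mem_range.mp ha)
    rw [shiftVec, show n + 2 - 1 - a = n + 1 - a by omega, if_pos (by omega),
      show n + 1 - (n + 1 - a) = a by omega, xiVec, xiVec]
    obtain ⟨c, hc⟩ : ∃ c, n + 1 = a + c := ⟨n + 1 - a, by omega⟩
    rw [show 2 * n + 2 = 2 * (n + 1) by ring, hc, Nat.add_sub_cancel_left]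
    field_simp
    ring
  · rw [xiVec]
    push_cast
    field_simp
    ring

/-- The right-hand side of the topological recursion, as a Laurent expansion at `w = 0`. -/
theorem exists_bracket_expansion {n : ℕ} {z : Fin n → ℂ} (hz : ∀ i, z i ≠ 0) {F : ℕ → Fock}
    {m M : ℕ} (hm : m ≠ 0) (h : ∀ i ≤ m, ∀ j ∈ (F i).vars, j < M) :
    ∃ r > 0, ∃ H : ℂ → ℂ, DifferentiableOn ℂ H (Metric.ball 0 r) ∧
      ∀ w ∈ Metric.ball (0 : ℂ) r, w ≠ 0 →
        polar (xiVec w ::ₘ xiVec w ::ₘ univ.val.map fun i => xiVec (z i)) (F m) +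
        ∑ J : Finset (Fin n), ∑ ij ∈ antidiagonal m,
          polar (xiVec w ::ₘ J.val.map fun i => xiVec (z i)) (F ij.1) *
          polar (xiVec w ::ₘ Jᶜ.val.map fun i => xiVec (z i)) (F ij.2) +
        ∑ j, (bergman w (z j) + bergman (-w) (z j)) *
          polar (xiVec w ::ₘ (univ.erase j).val.map fun i => xiVec (z i)) (F m) =
        ∑ b ∈ range (2 * M + 2), (w ^ (2 * b))⁻¹ *
          polar (univ.val.map fun i => xiVec (z i)) (loopCoeff F m b) + w * H w := by
  obtain ⟨r, hr, hrz⟩ : ∃ r > 0, ∀ i, r ≤ ‖z i‖ := by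
    rcases isEmpty_or_nonempty (Fin n) with hn | hn
    · exact ⟨1, one_pos, fun i => (hn.false i).elim⟩
    · obtain ⟨i, hi⟩ := Finite.exists_min fun i => ‖z i‖
      exact ⟨‖z i‖, norm_pos_iff.mpr (hz i), hi⟩
  have hne : ∀ w ∈ Metric.ball (0 : ℂ) r, ∀ i, z i ^ 2 - w ^ 2 ≠ 0 := by
    intro w hw i h0
    have h1 : ‖w‖ < ‖z i‖ := (mem_ball_zero_iff.mp hw).trans_le (hrz i)
    have h2 : ‖z i‖ ^ 2 = ‖w‖ ^ 2 := by rw [← norm_pow, ← norm_pow, sub_eq_zero.mp h0]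
    nlinarith [norm_nonneg w]
  set v : Fin n → ℕ → ℂ := fun i => xiVec (z i) with hv
  set c : Fin n → ℕ → ℂ := fun j k => polar ((univ.erase j).val.map v) (pderiv k (F m)) with hc
  refine ⟨r, hr, fun w => ∑ j, ∑ k ∈ range M, w * ((2 * (z j ^ 2 + w ^ 2) +
    4 * (k + 2) * (z j ^ 2 - w ^ 2)) / (z j ^ (2 * (k + 2)) * (z j ^ 2 - w ^ 2) ^ 2)) * c j k,
    ?_, ?_⟩
  · refine DifferentiableOn.fun_sum fun j _ => DifferentiableOn.fun_sum fun k _ => ?_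
    refine DifferentiableOn.mul_const (DifferentiableOn.mul (by fun_prop)
      (DifferentiableOn.div (by fun_prop) (by fun_prop) fun w hw => ?_)) _
    exact mul_ne_zero (pow_ne_zero _ (hz j)) (pow_ne_zero 2 (hne w hw j))
  · intro w hw hw0
    have hpolar : ∀ (u : ℕ → ℂ) (j : Fin n),
        polar (u ::ₘ (univ.erase j).val.map v) (F m) = ∑ k ∈ range M, u k * c j k := by
      intro u j
      rw [polar_cons, vecDer_eq_sum _ (h m le_rfl), map_sum]
      exact sum_congr rfl fun k _ => by rw [map_smul, smul_eq_mul]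
    -- For m ≠ 0 the inhomogeneous terms t₀² and 1/4 are absent.
    have hloop : ∀ b, loopCoeff F m b = shiftDer b (F m) + (match b with
        | 0 => 0
        | 1 => 0
        | k + 2 => quadTerm F m k) := by
      intro b
      match b with
      | 0 => simp [loopCoeff, hm]
      | 1 => simp [loopCoeff, hm]
      | k + 2 => simp [loopCoeff]
    -- Linear part: the shifts act on one direction ξ(z_j) at a time, and their generating function
    -- is multiplication by B(w, z_j) + B(-w, z_j), up to w times a holomorphic function.
    have hlin : ∑ b ∈ range (2 * M + 2), (w ^ (2 * b))⁻¹ *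
        polar (univ.val.map v) (shiftDer b (F m)) +
        w * ∑ j, ∑ k ∈ range M, w * ((2 * (z j ^ 2 + w ^ 2) +
          4 * (k + 2) * (z j ^ 2 - w ^ 2)) / (z j ^ (2 * (k + 2)) * (z j ^ 2 - w ^ 2) ^ 2)) * c j k =
        ∑ j, (bergman w (z j) + bergman (-w) (z j)) *
          polar (xiVec w ::ₘ (univ.erase j).val.map v) (F m) := by
      simp only [polar_shiftDer, hpolar, mul_sum]
      rw [sum_comm, ← sum_add_distrib]
      refine sum_congr rfl fun j _ => ?_
      rw [sum_comm, ← sum_add_distrib]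
      refine sum_congr rfl fun k hk => ?_
      have hk' := mem_range.mp hk
      have := sum_shiftVec (hz j) hw0 (hne w hw j) (show k + 2 ≤ 2 * M + 2 by omega)
      rw [show (bergman w (z j) + bergman (-w) (z j)) * (xiVec w k * c j k) =
        xiVec w k * (bergman w (z j) + bergman (-w) (z j)) * c j k by ring, ← this, add_mul, sum_mul]
      congr 1
      · exact sum_congr rfl fun b _ => by rw [hv]; ring
      · ring
    have hquad : ∑ b ∈ range (2 * M + 2), (w ^ (2 * b))⁻¹ * polar (univ.val.map v) (match b with
        | 0 => 0
        | 1 => 0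
        | k + 2 => quadTerm F m k) =
        polar (xiVec w ::ₘ xiVec w ::ₘ univ.val.map v) (F m) +
        ∑ J : Finset (Fin n), ∑ ij ∈ antidiagonal m,
          polar (xiVec w ::ₘ J.val.map v) (F ij.1) * polar (xiVec w ::ₘ Jᶜ.val.map v) (F ij.2) := by
      rw [sum_range_succ', sum_range_succ']
      simp only [map_zero, mul_zero, add_zero]
      have h1 := congrArg (polar (univ.val.map v)) (sum_quadTerm h w)
      rw [map_sum, map_add, map_sum] at h1
      simp only [map_smul, smul_eq_mul, polar_mul] at h1
      rw [h1, polar_cons, polar_cons, sum_comm, powerset_univ]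
      simp only [polar_cons, compl_eq_univ_sdiff]
    have hsplit : ∀ b, (w ^ (2 * b))⁻¹ * polar (univ.val.map v) (loopCoeff F m b) =
        (w ^ (2 * b))⁻¹ * polar (univ.val.map v) (shiftDer b (F m)) +
        (w ^ (2 * b))⁻¹ * polar (univ.val.map v) (match b with
        | 0 => 0
        | 1 => 0
        | k + 2 => quadTerm F m k) := fun b => by rw [hloop b, map_add, mul_add]
    rw [sum_congr rfl fun b _ => hsplit b, sum_add_distrib, hquad, ← hlin]
    ring

end Bracket
end EquivariantCP1

end

noncomputable section

namespace EquivariantCP1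

section TopologicalRecursion

open Finset MvPolynomial

/-! ### The differentials of the topological recursion are polarizations of the free energy -/

theorem trOmega_zero_one (w₀ w₁ : ℂ) (z : Fin 1 → ℂ) : trOmega w₀ w₁ 0 1 z = 0 := by
  rw [trOmega]

theorem trOmega_zero_two (w₀ w₁ : ℂ) (z : Fin 2 → ℂ) :
    trOmega w₀ w₁ 0 2 z = bergman (z 0) (z 1) := by
  rw [trOmega]

/-- `ω_{|J|+1}^{(g)}(w, z_J)`. -/
def trOmegaSubset (w₀ w₁ : ℂ) (g : ℕ) {n : ℕ} (z : Fin n → ℂ) (J : Finset (Fin n)) (w : ℂ) : ℂ :=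
  trOmega w₀ w₁ g (J.card + 1) (Fin.cons w fun i => z (J.orderEmbOfFin rfl i))

theorem trOmega_succ (w₀ w₁ : ℂ) {g n : ℕ} (h : 2 ≤ 2 * g + n) (z : Fin (n + 1) → ℂ) :
    trOmega w₀ w₁ g (n + 1) z = residueZero fun w => recursionKernel w₀ w₁ w (z 0) *
      -((if 0 < g then
          trOmega w₀ w₁ (g - 1) (n + 2) (Fin.cons w (Fin.cons (-w) (Fin.tail z))) else 0) +
        ∑ l ∈ range (g + 1), ∑ J : Finset (Fin n),
          if 0 < (g - l) + J.card ∧ 0 < l + Jᶜ.card then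
            trOmegaSubset w₀ w₁ (g - l) (Fin.tail z) J w *
              trOmegaSubset w₀ w₁ l (Fin.tail z) Jᶜ (-w)
          else 0) := by
  rw [trOmega.eq_4 w₀ w₁ g n (by omega) (by omega)]
  refine congrArg residueZero (funext fun w => ?_)
  rw [← Fin.sum_univ_eq_sum_range (fun l => ∑ J : Finset (Fin n),
          if 0 < (g - l) + J.card ∧ 0 < l + Jᶜ.card then
            trOmegaSubset w₀ w₁ (g - l) (Fin.tail z) J w *
              trOmegaSubset w₀ w₁ l (Fin.tail z) Jᶜ (-w)
          else 0)]
  simp only [dite_eq_ite]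
  rfl

theorem univ_map_cons {α : Type*} {n : ℕ} (f : Fin (n + 1) → α) :
    (univ : Finset (Fin (n + 1))).val.map f = f 0 ::ₘ univ.val.map fun i : Fin n => f i.succ := by
  rw [Fin.univ_succ, cons_val, Multiset.map_cons, map_val, Multiset.map_map]
  rfl

theorem map_orderEmbOfFin {α : Type*} {n : ℕ} (J : Finset (Fin n)) (f : Fin n → α) :
    (univ : Finset (Fin J.card)).val.map (fun i => f (J.orderEmbOfFin rfl i)) = J.val.map f := by
  conv_rhs => rw [← map_orderEmbOfFin_univ J rfl, map_val, Multiset.map_map]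
  rfl

theorem trOmega_zero_of_eq_one (w₀ w₁ : ℂ) {k : ℕ} (hk : k = 1) (w : ℂ) (f : Fin k → ℂ) :
    trOmega w₀ w₁ 0 (k + 1) (Fin.cons w f) = bergman w (f ⟨0, by omega⟩) := by
  subst hk
  exact trOmega_zero_two w₀ w₁ _

/-- The contribution of `ω_2^{(0)}` to `trOmegaSubset`. -/
def unstablePart (g : ℕ) {n : ℕ} (z : Fin n → ℂ) (J : Finset (Fin n)) (w : ℂ) : ℂ :=
  if g = 0 ∧ J.card = 1 then ∑ j ∈ J, bergman w (z j) else 0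

/-- The statement that the differentials of Euler characteristic `-m` are the polarizations
of `F_m`. -/
def IsPolarization (w₀ w₁ : ℂ) (F : ℕ → Fock) (m : ℕ) : Prop :=
  ∀ g n : ℕ, 2 * g + n = m + 1 → ∀ z : Fin (n + 1) → ℂ, (∀ i, z i ≠ 0) →
    trOmega w₀ w₁ g (n + 1) z = polar (univ.val.map fun i => xiVec (z i)) (F m)

/-- For g = 0 and at most one element in J the index 2g + |J| - 1 is 0, by truncation if J is empty,
and F 0 = 0. The formula therefore includes the unstable cases, with B as the only correction. -/
theorem trOmegaSubset_eq {w₀ w₁ : ℂ} {F : ℕ → Fock} (hF : F 0 = 0) {m : ℕ}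
    (ih : ∀ i, 1 ≤ i → i ≤ m → IsPolarization w₀ w₁ F i) {g n : ℕ} {z : Fin n → ℂ}
    (hz : ∀ i, z i ≠ 0) {J : Finset (Fin n)} (hJ : 2 * g + J.card ≤ m + 1) {w : ℂ} (hw : w ≠ 0) :
    trOmegaSubset w₀ w₁ g z J w =
      polar (xiVec w ::ₘ J.val.map fun i => xiVec (z i)) (F (2 * g + J.card - 1)) +
        unstablePart g z J w := by
  unfold trOmegaSubset unstablePart
  by_cases h0 : g = 0 ∧ J.card = 0
  · obtain ⟨rfl, hJ0⟩ := h0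
    obtain rfl := card_eq_zero.mp hJ0
    rw [if_neg (by simp)]
    simp only [card_empty, mul_zero, zero_tsub, hF, map_zero, add_zero]
    exact trOmega_zero_one w₀ w₁ _
  by_cases h1 : g = 0 ∧ J.card = 1
  · rw [if_pos h1]
    obtain ⟨rfl, hJ1⟩ := h1
    rw [trOmega_zero_of_eq_one w₀ w₁ hJ1]
    obtain ⟨j, rfl⟩ := card_eq_one.mp hJ1
    simp only [card_singleton, mul_zero, zero_add, Nat.sub_self, hF, map_zero, sum_singleton]
    rw [mem_singleton.mp (orderEmbOfFin_mem _ _ _)]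
  · rw [if_neg h1, add_zero]
    have h2 : 1 ≤ 2 * g + J.card - 1 := by omega
    rw [ih (2 * g + J.card - 1) h2 (by omega) g J.card (by omega)]
    · rw [univ_map_cons]
      simp only [Fin.cons_zero, Fin.cons_succ]
      rw [map_orderEmbOfFin J fun i => xiVec (z i)]
    · intro i
      refine Fin.cases ?_ (fun i => ?_) i
      · rwa [Fin.cons_zero]
      · rw [Fin.cons_succ]; exact hz _

theorem sum_ite_card_eq_one {n : ℕ} (f : Finset (Fin n) → ℂ) :
    ∑ J : Finset (Fin n), (if J.card = 1 then f J else 0) = ∑ j, f {j} := by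
  rw [← sum_filter]
  symm
  refine sum_bij (fun j _ => {j}) (fun j _ => by simp) (fun a _ b _ h => by simpa using h)
    (fun J hJ => ?_) fun j _ => rfl
  obtain ⟨j, rfl⟩ := card_eq_one.mp (mem_filter.mp hJ).2
  exact ⟨j, mem_univ j, rfl⟩

theorem sum_compl {n : ℕ} (f : Finset (Fin n) → ℂ) :
    ∑ J : Finset (Fin n), f Jᶜ = ∑ J : Finset (Fin n), f J :=
  Fintype.sum_equiv (Function.Involutive.toPerm _ compl_involutive) _ _ fun _ => rfl

/-- The terms of the recursion with two stable factors. -/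
theorem sum_genus_polar {c : ℂ} {m g n : ℕ} (h : 2 * g + n = m + 2) (v : Fin n → ℕ → ℂ)
    (u : ℕ → ℂ) (J : Finset (Fin n)) :
    ∑ l ∈ range (g + 1), polar (u ::ₘ J.val.map v) (fockEnergy c (2 * (g - l) + J.card - 1)) *
        polar (u ::ₘ Jᶜ.val.map v) (fockEnergy c (2 * l + Jᶜ.card - 1)) =
      ∑ ij ∈ antidiagonal m, polar (u ::ₘ J.val.map v) (fockEnergy c ij.1) *
        polar (u ::ₘ Jᶜ.val.map v) (fockEnergy c ij.2) := by
  have hcard : J.card + Jᶜ.card = n := by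
    rw [card_add_card_compl, Fintype.card_fin]
  have hzero : ∀ s : Multiset (ℕ → ℂ), polar s (fockEnergy c 0) = 0 := fun s => by
    rw [fockEnergy, map_zero]
  -- Outside `s` an index is truncated to 0 and the summand vanishes. Inside it both subtractions of
  -- 1 are exact, and the two indices add up to m.
  set s := (range (g + 1)).filter fun l => 1 ≤ 2 * (g - l) + J.card ∧ 1 ≤ 2 * l + Jᶜ.card
  have h1 : ∑ l ∈ range (g + 1),
      polar (u ::ₘ J.val.map v) (fockEnergy c (2 * (g - l) + J.card - 1)) *
        polar (u ::ₘ Jᶜ.val.map v) (fockEnergy c (2 * l + Jᶜ.card - 1)) =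
      ∑ l ∈ s, polar (u ::ₘ J.val.map v) (fockEnergy c (2 * (g - l) + J.card - 1)) *
        polar (u ::ₘ Jᶜ.val.map v) (fockEnergy c (2 * l + Jᶜ.card - 1)) := by
    symm
    refine sum_subset (filter_subset _ _) fun l hl hl' => ?_
    have hl'' : ¬ (1 ≤ 2 * (g - l) + J.card ∧ 1 ≤ 2 * l + Jᶜ.card) := fun h2 =>
      hl' (mem_filter.mpr ⟨hl, h2⟩)
    rcases not_and_or.mp hl'' with h2 | h2
    · rw [show 2 * (g - l) + J.card - 1 = 0 by omega, hzero, zero_mul]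
    · rw [show 2 * l + Jᶜ.card - 1 = 0 by omega, hzero, mul_zero]
  rw [h1]
  refine sum_of_injOn (fun l => (2 * (g - l) + J.card - 1, 2 * l + Jᶜ.card - 1)) ?_ ?_ ?_ ?_
  · intro a ha b hb hab
    have ha' := (mem_filter.mp (mem_coe.mp ha)).2
    have hb' := (mem_filter.mp (mem_coe.mp hb)).2
    have := (Prod.mk.inj hab).2
    omega
  · intro l hl
    have hl' := mem_filter.mp (mem_coe.mp hl)
    have hl'' := mem_range.mp hl'.1
    refine mem_coe.mpr (HasAntidiagonal.mem_antidiagonal.mpr ?_)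
    simp only
    omega
  -- A nonzero product forces genera g₁ and g₂ on its factors by the weights, and counting degrees
  -- gives g₁ + g₂ = g. Thus (i, j) comes from the summand l = g₂.
  · rintro ⟨i, j⟩ hij hnot
    have hij' : i + j = m := HasAntidiagonal.mem_antidiagonal.mp hij
    by_contra hne
    obtain ⟨g₁, hg₁⟩ := polar_fockEnergy_ne_zero c i (left_ne_zero_of_mul hne)
    obtain ⟨g₂, hg₂⟩ := polar_fockEnergy_ne_zero c j (right_ne_zero_of_mul hne)
    rw [Multiset.card_map, card_val] at hg₁ hg₂
    refine hnot ⟨g₂, mem_coe.mpr (mem_filter.mpr ⟨mem_range.mpr (by omega), by omega⟩), ?_⟩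
    simp only [Prod.mk.injEq]
    omega
  · intro l _
    rfl

/-- The integrand of the recursion, in the case where all products have a stable factor. -/
theorem bracket_eq {w₀ w₁ c : ℂ} {m : ℕ} (hm : 1 ≤ m)
    (ih : ∀ i, 1 ≤ i → i ≤ m → IsPolarization w₀ w₁ (fockEnergy c) i) {g n : ℕ}
    (hgn : 2 * g + n = m + 2) {z : Fin n → ℂ} (hz : ∀ i, z i ≠ 0) {w : ℂ} (hw : w ≠ 0) :
    (if 0 < g then trOmega w₀ w₁ (g - 1) (n + 2) (Fin.cons w (Fin.cons (-w) z)) else 0) +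
      ∑ l ∈ range (g + 1), ∑ J : Finset (Fin n),
        (if 0 < (g - l) + J.card ∧ 0 < l + Jᶜ.card then
          trOmegaSubset w₀ w₁ (g - l) z J w * trOmegaSubset w₀ w₁ l z Jᶜ (-w) else 0) =
    polar (xiVec w ::ₘ xiVec w ::ₘ univ.val.map fun i => xiVec (z i)) (fockEnergy c m) +
      ∑ J : Finset (Fin n), ∑ ij ∈ antidiagonal m,
        polar (xiVec w ::ₘ J.val.map fun i => xiVec (z i)) (fockEnergy c ij.1) *
        polar (xiVec w ::ₘ Jᶜ.val.map fun i => xiVec (z i)) (fockEnergy c ij.2) +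
      ∑ j, (bergman w (z j) + bergman (-w) (z j)) *
        polar (xiVec w ::ₘ (univ.erase j).val.map fun i => xiVec (z i)) (fockEnergy c m) := by
  have hF : fockEnergy c 0 = 0 := by rw [fockEnergy]
  set v : Fin n → ℕ → ℂ := fun i => xiVec (z i)
  set P : ℕ → Finset (Fin n) → ℂ := fun g J =>
    polar (xiVec w ::ₘ J.val.map v) (fockEnergy c (2 * g + J.card - 1)) with hP
  have hcard : ∀ J : Finset (Fin n), J.card + Jᶜ.card = n := fun J => by
    rw [card_add_card_compl, Fintype.card_fin]
  have h1 : (if 0 < g then trOmega w₀ w₁ (g - 1) (n + 2) (Fin.cons w (Fin.cons (-w) z)) else 0) =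
      polar (xiVec w ::ₘ xiVec w ::ₘ univ.val.map v) (fockEnergy c m) := by
    split_ifs with hg
    · rw [ih m hm le_rfl (g - 1) (n + 1) (by omega)]
      · rw [univ_map_cons, univ_map_cons]
        simp only [Fin.cons_zero, Fin.cons_succ, xiVec_neg]
        rfl
      · intro i
        refine Fin.cases hw (fun i => ?_) i
        rw [Fin.cons_succ]
        exact Fin.cases (neg_ne_zero.mpr hw) (fun i => by rw [Fin.cons_succ]; exact hz i) i
    -- For g = 0 there is no term of lower genus, and the polarization with n + 2 directions
    -- vanishes because its weight would need a negative genus.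
    · by_contra hne
      obtain ⟨g', hg'⟩ := polar_fockEnergy_ne_zero c m (Ne.symm hne)
      simp at hg'
      omega
  have h2 : ∀ l ∈ range (g + 1), ∀ J : Finset (Fin n),
      (if 0 < (g - l) + J.card ∧ 0 < l + Jᶜ.card then
        trOmegaSubset w₀ w₁ (g - l) z J w * trOmegaSubset w₀ w₁ l z Jᶜ (-w) else 0) =
      P (g - l) J * P l Jᶜ + (unstablePart (g - l) z J w * P l Jᶜ +
        P (g - l) J * unstablePart l z Jᶜ (-w)) := by
    intro l hl J
    have hl' := mem_range.mp hl
    have hJ := hcard J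
    -- Two factors B occur only for g = 0 and n = 2, that is m = 0, which `hm` excludes.
    have hUU : unstablePart (g - l) z J w * unstablePart l z Jᶜ (-w) = 0 := by
      unfold unstablePart
      by_cases h3 : g - l = 0 ∧ J.card = 1
      · rw [if_neg (show ¬ (l = 0 ∧ Jᶜ.card = 1) by omega), mul_zero]
      · rw [if_neg h3, zero_mul]
    by_cases hc : 0 < (g - l) + J.card ∧ 0 < l + Jᶜ.card
    · rw [if_pos hc, trOmegaSubset_eq hF ih hz (by omega) hw,
        trOmegaSubset_eq hF ih hz (by omega) (neg_ne_zero.mpr hw), xiVec_neg]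
      linear_combination hUU
    · rw [if_neg hc]
      rcases not_and_or.mp hc with h3 | h3
      · have e1 : P (g - l) J = 0 := by
          simp only [hP]
          rw [show 2 * (g - l) + J.card - 1 = 0 by omega, hF, map_zero]
        have e2 : unstablePart (g - l) z J w = 0 := by
          unfold unstablePart; rw [if_neg (by omega)]
        rw [e1, e2]; ring
      · have e1 : P l Jᶜ = 0 := by
          simp only [hP]
          rw [show 2 * l + Jᶜ.card - 1 = 0 by omega, hF, map_zero]
        have e2 : unstablePart l z Jᶜ (-w) = 0 := by
          unfold unstablePart; rw [if_neg (by omega)]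
        rw [e1, e2]; ring
  have hPj : ∀ j : Fin n, P g ({j}ᶜ) =
      polar (xiVec w ::ₘ (univ.erase j).val.map v) (fockEnergy c m) := by
    intro j
    have hj := hcard {j}
    rw [card_singleton] at hj
    simp only [hP]
    rw [show 2 * g + ({j}ᶜ : Finset (Fin n)).card - 1 = m by omega, compl_singleton]
  have h3 : ∑ l ∈ range (g + 1), ∑ J : Finset (Fin n), unstablePart (g - l) z J w * P l Jᶜ =
      ∑ j, bergman w (z j) *
        polar (xiVec w ::ₘ (univ.erase j).val.map v) (fockEnergy c m) := by
    rw [sum_eq_single_of_mem g (self_mem_range_succ g)]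
    · have h5 : ∀ J : Finset (Fin n), unstablePart (g - g) z J w * P g Jᶜ =
          if J.card = 1 then (∑ j ∈ J, bergman w (z j)) * P g Jᶜ else 0 := fun J => by
        simp only [unstablePart, Nat.sub_self, true_and, ite_mul, zero_mul]
      rw [sum_congr rfl fun J _ => h5 J, sum_ite_card_eq_one]
      exact sum_congr rfl fun j _ => by rw [sum_singleton, hPj]
    · intro l hl hlg
      refine sum_eq_zero fun J _ => ?_
      have hl' := mem_range.mp hl
      unfold unstablePart
      rw [if_neg (by omega), zero_mul]
  have h4 : ∑ l ∈ range (g + 1), ∑ J : Finset (Fin n),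
      P (g - l) J * unstablePart l z Jᶜ (-w) = ∑ j, bergman (-w) (z j) *
        polar (xiVec w ::ₘ (univ.erase j).val.map v) (fockEnergy c m) := by
    rw [sum_eq_single_of_mem 0 (mem_range.mpr (Nat.succ_pos g))]
    · have h5 : ∀ J : Finset (Fin n), P (g - 0) Jᶜ * unstablePart 0 z J (-w) =
          if J.card = 1 then (∑ j ∈ J, bergman (-w) (z j)) * P g Jᶜ else 0 := fun J => by
        simp only [unstablePart, Nat.sub_zero, true_and]
        rw [mul_comm, ite_mul, zero_mul]
      rw [← sum_compl fun J => P (g - 0) J * unstablePart 0 z Jᶜ (-w)]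
      simp only [compl_compl]
      rw [sum_congr rfl fun J _ => h5 J, sum_ite_card_eq_one]
      exact sum_congr rfl fun j _ => by rw [sum_singleton, hPj]
    · intro l hl hlg
      refine sum_eq_zero fun J _ => ?_
      unfold unstablePart
      rw [if_neg (by omega), mul_zero]
  rw [h1, sum_congr rfl fun l hl => sum_congr rfl fun J _ => h2 l hl J]
  simp only [sum_add_distrib]
  rw [h3, h4, sum_comm, sum_congr rfl fun J _ => sum_genus_polar hgn v (xiVec w) J]
  simp only [add_mul, sum_add_distrib]
  ring

/-- Summation by parts: ρ_b enters with z^(-2b) through k = b - 1 and with -c z^(-2b-2) through k =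
b. The first contribution is missing at b = 0, which explains the subtracted 1, and the last term is
the boundary at B. -/
theorem sum_mul_kernel_coeff {z : ℂ} (hz : z ≠ 0) (c : ℂ) (ρ : ℕ → ℂ) (B : ℕ) :
    ∑ k ∈ range B, (z ^ (2 * k + 2))⁻¹ * (-(1 / 4) * (ρ (k + 1) - c * ρ k)) =
      -(1 / 4) * ∑ b ∈ range B, ρ b * ((z ^ 2 - c) * (z ^ (2 * b + 2))⁻¹ - if b = 0 then 1 else 0) -
        1 / 4 * (ρ B * ((z ^ (2 * B))⁻¹ - if B = 0 then 1 else 0)) := by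
  induction B with
  | zero => simp
  | succ B ih =>
    rw [sum_range_succ, sum_range_succ, ih, if_neg (Nat.succ_ne_zero B), mul_add 2 B 1, mul_one]
    have h : z ^ (2 * B + 2) ≠ 0 := pow_ne_zero _ hz
    have h' : z ^ (2 * B) ≠ 0 := pow_ne_zero _ hz
    have h1 : (z ^ 2 - c) * (z ^ (2 * B + 2))⁻¹ = (z ^ (2 * B))⁻¹ - c * (z ^ (2 * B + 2))⁻¹ := by
      rw [pow_add] at *
      field_simp
    rw [h1]
    ring

theorem polar_xiVec_cons (z : ℂ) (s : Multiset (ℕ → ℂ)) {p : Fock} {B : ℕ}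
    (h : ∀ i ∈ p.vars, i < B) :
    polar (xiVec z ::ₘ s) p = ∑ k ∈ range B, (z ^ (2 * k + 2))⁻¹ * polar s (pderiv k p) := by
  rw [polar_cons, vecDer_eq_sum _ h, map_sum]
  refine sum_congr rfl fun k _ => ?_
  rw [map_smul, smul_eq_mul]
  rfl

/-- The residues of the kernel reassemble the Laurent coefficients of the bracket into the
combination of `recursionRHS`, paired with ξ(z₀). The boundary term of the summation by parts
vanishes since the loop coefficient of index 2M + 2 is 0. -/
theorem trOmega_eq_polar_of_bracket {w₀ w₁ : ℂ} {m M : ℕ}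
    (hM : ∀ i ≤ m + 1, ∀ j ∈ (fockEnergy (Lam w₀ w₁) i).vars, j < M)
    {g n : ℕ} (hgn : 2 * g + n = m + 2) {z : Fin (n + 1) → ℂ} (hz : ∀ i, z i ≠ 0)
    {r : ℝ} (hr : 0 < r) {H : ℂ → ℂ} (hH : DifferentiableOn ℂ H (Metric.ball 0 r))
    (hb : ∀ w ∈ Metric.ball (0 : ℂ) r, w ≠ 0 →
      (if 0 < g then
          trOmega w₀ w₁ (g - 1) (n + 2) (Fin.cons w (Fin.cons (-w) (Fin.tail z))) else 0) +
        ∑ l ∈ range (g + 1), ∑ J : Finset (Fin n),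
          (if 0 < (g - l) + J.card ∧ 0 < l + Jᶜ.card then
            trOmegaSubset w₀ w₁ (g - l) (Fin.tail z) J w *
              trOmegaSubset w₀ w₁ l (Fin.tail z) Jᶜ (-w) else 0) =
      ∑ b ∈ range (2 * M + 2), (w ^ (2 * b))⁻¹ *
          polar (univ.val.map fun i => xiVec (Fin.tail z i))
            (loopCoeff (fockEnergy (Lam w₀ w₁)) m b) + w * H w) :
    trOmega w₀ w₁ g (n + 1) z =
      polar (univ.val.map fun i => xiVec (z i)) (fockEnergy (Lam w₀ w₁) (m + 1)) := by
  rw [trOmega_succ w₀ w₁ (by omega), residueZero_recursionKernel w₀ w₁ (hz 0) (2 * M + 2)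
    (fun b => polar (univ.val.map fun i => xiVec (Fin.tail z i))
      (loopCoeff (fockEnergy (Lam w₀ w₁)) m b)) hr hH]
  · rw [univ_map_cons, polar_xiVec_cons (z 0) _ (B := 2 * M + 2)
      fun i hi => (hM (m + 1) le_rfl i hi).trans (by omega)]
    have h0 := loopCoeff_eq_zero (fun i hi => hM i (hi.trans m.le_succ)) (le_refl (2 * M + 2))
    have h1 := sum_mul_kernel_coeff (hz 0) (Lam w₀ w₁)
      (fun b => polar (univ.val.map fun i => xiVec (Fin.tail z i))
        (loopCoeff (fockEnergy (Lam w₀ w₁)) m b)) (2 * M + 2)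
    simp only [h0, map_zero, zero_mul, mul_zero, sub_zero] at h1
    rw [← h1]
    refine sum_congr rfl fun k _ => ?_
    rw [pderiv_fockEnergy, recursionRHS, map_smul, map_sub, map_smul, smul_eq_mul, smul_eq_mul]
    rfl
  · filter_upwards [self_mem_nhdsWithin,
      mem_nhdsWithin_of_mem_nhds (Metric.ball_mem_nhds (0 : ℂ) hr)] with w hw hw'
    rw [hb w hw' hw]

theorem isPolarization_succ {w₀ w₁ : ℂ} {m : ℕ} (hm : 1 ≤ m)
    (ih : ∀ i, 1 ≤ i → i ≤ m → IsPolarization w₀ w₁ (fockEnergy (Lam w₀ w₁)) i) :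
    IsPolarization w₀ w₁ (fockEnergy (Lam w₀ w₁)) (m + 1) := by
  intro g n hgn z hz
  obtain ⟨M, hM⟩ := exists_common_bound (fockEnergy (Lam w₀ w₁)) (m + 1)
  obtain ⟨r, hr, H, hH, h⟩ := exists_bracket_expansion (z := Fin.tail z) (fun i => hz i.succ)
    (Nat.one_le_iff_ne_zero.mp hm) fun i hi => hM i (hi.trans m.le_succ)
  refine trOmega_eq_polar_of_bracket hM hgn hz hr hH fun w hw hw0 => ?_
  rw [bracket_eq hm ih hgn (z := Fin.tail z) (fun i => hz i.succ) hw0]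
  exact h w hw hw0

theorem vecDer_C (v : ℕ → ℂ) (a : ℂ) : vecDer v (C a) = 0 :=
  (vecDer v).map_algebraMap a

theorem trOmegaSubset_zero_mul (w₀ w₁ : ℂ) {z : Fin 2 → ℂ} (hz : ∀ i, z i ≠ 0) {w : ℂ}
    (hw : w ≠ 0) :
    ∑ J : Finset (Fin 2), (if 0 < J.card ∧ 0 < Jᶜ.card then
        trOmegaSubset w₀ w₁ 0 z J w * trOmegaSubset w₀ w₁ 0 z Jᶜ (-w) else 0) =
      bergman w (z 0) * bergman (-w) (z 1) + bergman w (z 1) * bergman (-w) (z 0) := by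
  have h : ∀ J : Finset (Fin 2), (if 0 < J.card ∧ 0 < Jᶜ.card then
        trOmegaSubset w₀ w₁ 0 z J w * trOmegaSubset w₀ w₁ 0 z Jᶜ (-w) else 0) =
      if J.card = 1 then (∑ j ∈ J, bergman w (z j)) * ∑ j ∈ Jᶜ, bergman (-w) (z j) else 0 := by
    intro J
    have hcard : J.card + Jᶜ.card = 2 := by rw [card_add_card_compl, Fintype.card_fin]
    have hF : fockEnergy 0 0 = 0 := by rw [fockEnergy]
    have key : ∀ (K : Finset (Fin 2)) (u : ℂ), u ≠ 0 → K.card = 1 →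
        trOmegaSubset w₀ w₁ 0 z K u = ∑ j ∈ K, bergman u (z j) := by
      intro K u hu hK
      rw [trOmegaSubset_eq hF (m := 0) (fun i h1 h2 => by omega) hz (by omega) hu, unstablePart,
        if_pos ⟨rfl, hK⟩, hK]
      simp only [mul_zero, zero_add, Nat.sub_self, hF, map_zero]
    by_cases hJ : J.card = 1
    · rw [if_pos hJ, if_pos (by omega), key J w hw hJ, key Jᶜ (-w) (neg_ne_zero.mpr hw) (by omega)]
    · rw [if_neg hJ, if_neg (by omega)]
  rw [sum_congr rfl fun J _ => h J, sum_ite_card_eq_one, Fin.sum_univ_two]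
  have e0 : ({0}ᶜ : Finset (Fin 2)) = {1} := by decide
  have e1 : ({1}ᶜ : Finset (Fin 2)) = {0} := by decide
  rw [e0, e1, sum_singleton, sum_singleton, sum_singleton, sum_singleton]

theorem sum_loopCoeff_zero (c : ℂ) (M : ℕ) (s : Multiset (ℕ → ℂ)) (w : ℂ) :
    ∑ b ∈ range (2 * M + 2), (w ^ (2 * b))⁻¹ * polar s (loopCoeff (fockEnergy c) 0 b) =
      polar s (X 0 * X 0) + (w ^ 2)⁻¹ * polar s (C (1 / 4)) := by
  have hF : fockEnergy c 0 = 0 := by rw [fockEnergy]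
  rw [← sum_subset (range_mono (show 2 ≤ 2 * M + 2 by omega)), sum_range_succ, sum_range_one]
  · simp only [loopCoeff, if_true, hF, map_zero, add_zero, mul_zero, pow_zero, inv_one, one_mul,
      mul_one]
  · intro b _ hb
    rw [loopCoeff_eq_zero (M := 0) (fun i hi j hj => ?_) (not_lt.mp (fun h => hb (mem_range.mpr h))), map_zero, mul_zero]
    rw [Nat.le_zero.mp hi, hF] at hj
    simp at hj

/-- The induction starts from the inhomogeneous Virasoro terms. For (g, n) = (0, 3) the bracket at w
= 0 is 2/(a²b²), the polarization of t₀²; for (1, 1) it is B(w, -w) = 1/(4w²), the constant 1/4. -/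
theorem isPolarization_one (w₀ w₁ : ℂ) : IsPolarization w₀ w₁ (fockEnergy (Lam w₀ w₁)) 1 := by
  intro g n hgn z hz
  obtain ⟨M, hM⟩ := exists_common_bound (fockEnergy (Lam w₀ w₁)) 1
  obtain ⟨rfl, rfl⟩ | ⟨rfl, rfl⟩ : (g = 0 ∧ n = 2) ∨ (g = 1 ∧ n = 0) := by omega
  · have hz' : ∀ i, Fin.tail z i ≠ 0 := fun i => hz i.succ
    set a := Fin.tail z 0
    set b := Fin.tail z 1
    set U : ℂ → ℂ := fun w => bergman w a * bergman (-w) b + bergman w b * bergman (-w) a with hU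
    set r := min ‖a‖ ‖b‖ with hr
    have hr0 : 0 < r := lt_min (norm_pos_iff.mpr (hz' 0)) (norm_pos_iff.mpr (hz' 1))
    have hne : ∀ w ∈ Metric.ball (0 : ℂ) r, ∀ u : ℂ, r ≤ ‖u‖ → w - u ≠ 0 ∧ -w - u ≠ 0 := by
      intro w hw u hu
      have h1 := (mem_ball_zero_iff.mp hw).trans_le hu
      constructor <;> intro h0
      · rw [sub_eq_zero.mp h0] at h1; exact h1.false
      · rw [← sub_eq_zero.mp h0, norm_neg] at h1; exact h1.false
    have hdiff : DifferentiableOn ℂ U (Metric.ball 0 r) := by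
      have hB : ∀ u : ℂ, r ≤ ‖u‖ →
          DifferentiableOn ℂ (fun w => bergman w u) (Metric.ball 0 r) ∧
          DifferentiableOn ℂ (fun w => bergman (-w) u) (Metric.ball 0 r) := by
        intro u hu
        unfold bergman
        exact ⟨DifferentiableOn.div (by fun_prop) (by fun_prop)
          fun w hw => pow_ne_zero 2 (hne w hw u hu).1,
          DifferentiableOn.div (by fun_prop) (by fun_prop)
          fun w hw => pow_ne_zero 2 (hne w hw u hu).2⟩
      have ha := hB a (min_le_left _ _)
      have hb := hB b (min_le_right _ _)
      exact (ha.1.mul hb.2).add (hb.1.mul ha.2)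
    -- Here U is holomorphic near 0 and `w * dslope U 0 w` = U(w) - U(0), so only U(0) enters the
    -- residue.
    refine trOmega_eq_polar_of_bracket hM hgn hz hr0 (H := dslope U 0)
      ((Complex.differentiableOn_dslope (Metric.ball_mem_nhds 0 hr0)).mpr hdiff)
      fun w hw hw0 => ?_
    rw [sum_loopCoeff_zero]
    simp only [lt_irrefl, if_false, zero_add, sum_range_one, Nat.sub_self]
    rw [trOmegaSubset_zero_mul w₀ w₁ hz' hw0, univ_map_cons, univ_map_cons]
    have h1 := sub_smul_dslope U 0 w
    rw [sub_zero, smul_eq_mul] at h1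
    rw [h1]
    have e : (univ : Finset (Fin 0)).val = 0 := rfl
    simp only [e, Multiset.map_zero, polar_cons, polar_zero, Derivation.leibniz, vecDer_X,
      smul_eq_mul, map_add, map_mul, MvPolynomial.constantCoeff_X,
      MvPolynomial.constantCoeff_C, hU, bergman, xiVec,
      zero_sub, neg_zero]
    simp only [vecDer_C, map_zero, mul_zero, zero_add, add_zero, neg_sq, one_div]
    change (((w - a) ^ 2)⁻¹ * ((-w - b) ^ 2)⁻¹ + ((w - b) ^ 2)⁻¹ * ((-w - a) ^ 2)⁻¹ : ℂ) =
      (a ^ 2)⁻¹ * (b ^ 2)⁻¹ + (a ^ 2)⁻¹ * (b ^ 2)⁻¹ +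
        (((w - a) ^ 2)⁻¹ * ((-w - b) ^ 2)⁻¹ + ((w - b) ^ 2)⁻¹ * ((-w - a) ^ 2)⁻¹ -
          ((a ^ 2)⁻¹ * (b ^ 2)⁻¹ + (b ^ 2)⁻¹ * (a ^ 2)⁻¹))
    ring
  · refine trOmega_eq_polar_of_bracket hM hgn hz one_pos (H := fun _ => 0)
      (differentiableOn_const 0) fun w hw hw0 => ?_
    rw [sum_loopCoeff_zero]
    have e : (univ : Finset (Fin 0)).val = 0 := rfl
    simp only [zero_lt_one, if_true, e, Multiset.map_zero, polar_zero,
      map_mul, MvPolynomial.constantCoeff_X, MvPolynomial.constantCoeff_C, mul_zero, add_zero,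
      zero_add]
    rw [sum_eq_zero, trOmega_zero_two]
    · simp [bergman]
      rw [← two_mul, mul_pow, mul_inv, mul_comm]
      norm_num
    · intro l hl
      refine sum_eq_zero fun J _ => ?_
      have hJ : J = ∅ := Subsingleton.elim _ _
      have hJ' : J.card = 0 := by rw [hJ, card_empty]
      have hJc : Jᶜ.card = 0 := by rw [Subsingleton.elim Jᶜ ∅, card_empty]
      have := mem_range.mp hl
      rw [if_neg (by omega)]

theorem isPolarization_fockEnergy (w₀ w₁ : ℂ) {m : ℕ} (hm : 1 ≤ m) :
    IsPolarization w₀ w₁ (fockEnergy (Lam w₀ w₁)) m := by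
  induction m using Nat.strong_induction_on with
  | _ m ih =>
    obtain rfl | ⟨k, rfl, hk⟩ : m = 1 ∨ ∃ k, m = k + 1 ∧ 1 ≤ k := by
      rcases m with _ | _ | m
      · omega
      · exact Or.inl rfl
      · exact Or.inr ⟨m + 1, rfl, by omega⟩
    · exact isPolarization_one w₀ w₁
    · exact isPolarization_succ hk fun i h1 h2 => ih i (by omega) h1

end TopologicalRecursion
end EquivariantCP1

end

/-! ### Specialization to the diagonal: the free energies f_m(z) -/

noncomputable section

namespace EquivariantCP1

section FreeEnergy

open Finset MvPolynomial MeasureTheory Filter Topology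

/-! ### The free energies are values of the polynomials `F_m` -/

/-- The integral of `xiVec` from infinity. -/
def tauVec (z : ℂ) : ℕ → ℂ := fun c => -(z ^ (2 * c + 1))⁻¹ / (2 * c + 1)

theorem tauVec_neg (z : ℂ) : tauVec (-z) = -tauVec z := by
  funext c
  simp only [tauVec, Pi.neg_apply]
  rw [Odd.neg_pow ⟨c, rfl⟩, inv_neg]
  ring

theorem hasDerivAt_tauVec {z : ℂ} (hz : z ≠ 0) (c : ℕ) :
    HasDerivAt (fun z => tauVec z c) (xiVec z c) z := by
  have h := (((hasDerivAt_pow (2 * c + 1) z).inv (pow_ne_zero _ hz)).neg.div_const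
    (2 * (c : ℂ) + 1))
  refine h.congr_deriv ?_
  have h1 : (2 * (c : ℂ) + 1) ≠ 0 := by exact_mod_cast Nat.succ_ne_zero (2 * c)
  simp only [xiVec, Nat.add_sub_cancel]
  push_cast
  rw [pow_add z (2 * c) 1, pow_add z (2 * c) 2]
  have := pow_ne_zero (2 * c) hz
  field_simp

theorem tendsto_tauVec (c : ℕ) :
    Tendsto (fun z => tauVec z c) (Bornology.cobounded ℂ) (𝓝 0) := by
  have h : Tendsto (fun z : ℂ => (z ^ (2 * c + 1))⁻¹) (Bornology.cobounded ℂ) (𝓝 0) :=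
    tendsto_inv₀_cobounded.comp (tendsto_pow_cobounded_cobounded (Nat.succ_ne_zero _))
  have h' := h.neg.div_const (2 * (c : ℂ) + 1)
  rw [neg_zero, zero_div] at h'
  exact h'

theorem hasDerivAt_eval_tauVec {z : ℂ} (hz : z ≠ 0) (p : Fock) :
    HasDerivAt (fun z => eval (tauVec z) p) (eval (tauVec z) (vecDer (xiVec z) p)) z := by
  induction p using MvPolynomial.induction_on with
  | C a =>
    simp only [eval_C, vecDer_C, map_zero]
    exact hasDerivAt_const z a
  | add p q hp hq =>
    simp only [map_add]
    exact hp.add hq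
  | mul_X p i hp =>
    simp only [map_mul, eval_X, Derivation.leibniz, vecDer_X, smul_eq_mul, map_add, eval_C]
    refine (hp.mul (hasDerivAt_tauVec hz i)).congr_deriv ?_
    ring

theorem tendsto_eval_tauVec (p : Fock) :
    Tendsto (fun z => eval (tauVec z) p) (Bornology.cobounded ℂ) (𝓝 (constantCoeff p)) := by
  induction p using MvPolynomial.induction_on with
  | C a => simp
  | add p q hp hq => simpa using hp.add hq
  | mul_X p i hp => simpa using hp.mul (tendsto_tauVec i)

/-- A polarization is multilinear and depends on finitely many coordinates. As a finite sum of
products of functions of one variable each, it lets the multiple integral defining `freeEnergy`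
factor. -/
theorem exists_polar_expansion (n : ℕ) (p : Fock) :
    ∃ (s : Finset (Fin n → ℕ)) (A : (Fin n → ℕ) → ℂ), ∀ v : Fin n → ℕ → ℂ,
      polar (univ.val.map v) p = ∑ d ∈ s, A d * ∏ k, v k (d k) := by
  induction n generalizing p with
  | zero =>
    refine ⟨univ, fun _ => constantCoeff p, fun v => ?_⟩
    simp [polar_zero]
  | succ n ih =>
    obtain ⟨M, hM⟩ := exists_bound_vars p
    choose s A h using fun c => ih (pderiv c p)
    refine ⟨((range M).sigma s).image fun x => Fin.cons x.1 x.2,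
      fun d => A (d 0) (Fin.tail d), fun v => ?_⟩
    rw [univ_map_cons, polar_cons, vecDer_eq_sum _ hM, map_sum, sum_image, sum_sigma]
    · refine sum_congr rfl fun c _ => ?_
      rw [map_smul, h, smul_eq_mul, mul_sum]
      refine sum_congr rfl fun d _ => ?_
      rw [Fin.prod_univ_succ]
      simp only [Fin.cons_zero, Fin.cons_succ, Fin.tail_cons]
      ring
    · rintro ⟨a, d⟩ _ ⟨b, e⟩ _ hab
      obtain ⟨h1, h2⟩ := Fin.cons_injective2 hab
      simp only at h1 h2
      subst h1 h2
      rfl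

theorem integral_Ioi_inv_pow (k : ℕ) :
    IntegrableOn (fun s : ℝ => ((s : ℂ) ^ (k + 2))⁻¹) (Set.Ioi 1) ∧
      ∫ s in Set.Ioi (1 : ℝ), ((s : ℂ) ^ (k + 2))⁻¹ = 1 / (k + 1) := by
  have hk : (-((k : ℝ) + 2)) < -1 := by
    have : (0 : ℝ) ≤ k := k.cast_nonneg
    linarith
  have e : Set.EqOn (fun s : ℝ => ((s ^ (-((k : ℝ) + 2)) : ℝ) : ℂ))
      (fun s : ℝ => ((s : ℂ) ^ (k + 2))⁻¹) (Set.Ioi 1) := by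
    intro s hs
    have hs0 : (0 : ℝ) < s := one_pos.trans hs
    simp only
    rw [Real.rpow_neg hs0.le, show (k : ℝ) + 2 = ((k + 2 : ℕ) : ℝ) by push_cast; ring,
      Real.rpow_natCast]
    push_cast
    rfl
  refine ⟨IntegrableOn.congr_fun (integrableOn_Ioi_rpow_of_lt hk one_pos).ofReal e measurableSet_Ioi, ?_⟩
  rw [← setIntegral_congr_fun measurableSet_Ioi e, integral_complex_ofReal,
    integral_Ioi_rpow_of_lt hk one_pos, Real.one_rpow]
  push_cast
  rw [show (-((k : ℂ) + 2) + 1) = -(k + 1) by ring, neg_div_neg_eq]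

theorem integral_xiVec (z : ℂ) (d : ℕ) :
    Integrable (fun s : ℝ => xiVec (s * z) d * -z) (volume.restrict (Set.Ioi 1)) ∧
      ∫ s in Set.Ioi (1 : ℝ), xiVec (s * z) d * -z = tauVec z d := by
  have e : (fun s : ℝ => xiVec (s * z) d * -z) =
      fun s : ℝ => ((s : ℂ) ^ (2 * d + 2))⁻¹ * ((z ^ (2 * d + 2))⁻¹ * -z) := by
    funext s
    rw [xiVec, mul_pow, mul_inv, mul_assoc]
  obtain ⟨h1, h2⟩ := integral_Ioi_inv_pow (2 * d)
  refine ⟨by rw [e]; exact h1.mul_const _, ?_⟩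
  rw [e, integral_mul_const, h2, tauVec]
  push_cast
  rcases eq_or_ne z 0 with rfl | hz
  · simp
  · rw [show 2 * d + 2 = 2 * d + 1 + 1 from rfl, pow_succ z (2 * d + 1)]
    have := pow_ne_zero (2 * d + 1) hz
    field_simp

theorem freeEnergy_eq_polar (w₀ w₁ : ℂ) {g n m : ℕ} (hm : 1 ≤ m) (hgn : 2 * g + n = m + 1) {z : ℂ}
    (hz : z ≠ 0) :
    freeEnergy w₀ w₁ g (n + 1) (fun _ => z) =
      polar (Multiset.replicate (n + 1) (tauVec z)) (fockEnergy (Lam w₀ w₁) m) := by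
  obtain ⟨s, A, hA⟩ := exists_polar_expansion (n + 1) (fockEnergy (Lam w₀ w₁) m)
  have hmeas : MeasurableSet (Set.pi Set.univ fun _ : Fin (n + 1) => Set.Ioi (1 : ℝ)) :=
    MeasurableSet.univ_pi fun _ => measurableSet_Ioi
  have e : Set.EqOn (fun t : Fin (n + 1) → ℝ =>
      trOmega w₀ w₁ g (n + 1) (fun i => (t i : ℂ) * z) * ∏ _i : Fin (n + 1), -z)
      (fun t => ∑ d ∈ s, A d * ∏ k, (xiVec (t k * z) (d k) * -z))
      (Set.pi Set.univ fun _ => Set.Ioi 1) := by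
    intro t ht
    have ht' : ∀ i, (t i : ℂ) * z ≠ 0 := fun i =>
      mul_ne_zero (Complex.ofReal_ne_zero.mpr (one_pos.trans (ht i trivial)).ne') hz
    simp only
    rw [isPolarization_fockEnergy w₀ w₁ hm g n hgn _ ht', hA, sum_mul]
    exact sum_congr rfl fun d _ => by rw [prod_mul_distrib, mul_assoc]
  rw [freeEnergy, setIntegral_congr_fun hmeas e, volume_pi, Measure.restrict_pi_pi,
    integral_finsetSum]
  · have h := hA fun _ => tauVec z
    rw [Multiset.map_const', card_val, card_univ, Fintype.card_fin] at h
    rw [h]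
    refine sum_congr rfl fun d _ => ?_
    rw [integral_const_mul, integral_fintype_prod_eq_prod
      (f := fun k (t : ℝ) => xiVec (t * z) (d k) * -z)]
    simp only [(integral_xiVec z _).2]
  · intro d _
    exact (Integrable.fintype_prod (f := fun k (t : ℝ) => xiVec (t * z) (d k) * -z)
      fun k => (integral_xiVec z (d k)).1).const_mul _

/-- Restriction of a polynomial to the line through `0` and `v`. -/
def lineHom (v : ℕ → ℂ) : Fock →ₐ[ℂ] Polynomial ℂ :=
  aeval fun c => Polynomial.C (v c) * Polynomial.X

theorem eval_one_lineHom (v : ℕ → ℂ) (p : Fock) : (lineHom v p).eval 1 = eval v p := by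
  induction p using MvPolynomial.induction_on with
  | C a => simp [lineHom]
  | add p q hp hq => rw [map_add, Polynomial.eval_add, hp, hq, map_add]
  | mul_X p i hp =>
    rw [map_mul, Polynomial.eval_mul, hp, map_mul, eval_X]
    simp [lineHom]

theorem coeff_zero_lineHom (v : ℕ → ℂ) (p : Fock) : (lineHom v p).coeff 0 = constantCoeff p := by
  induction p using MvPolynomial.induction_on with
  | C a => simp [lineHom]
  | add p q hp hq => rw [map_add, Polynomial.coeff_add, hp, hq, map_add]
  | mul_X p i hp =>
    rw [map_mul, Polynomial.mul_coeff_zero, hp, map_mul, constantCoeff_X]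
    simp [lineHom]

theorem derivative_lineHom (v : ℕ → ℂ) (p : Fock) :
    Polynomial.derivative (lineHom v p) = lineHom v (vecDer v p) := by
  induction p using MvPolynomial.induction_on with
  | C a => simp [lineHom]
  | add p q hp hq => simp only [map_add, hp, hq]
  | mul_X p i hp =>
    rw [map_mul, Polynomial.derivative_mul, hp, Derivation.leibniz, map_add, smul_eq_mul,
      smul_eq_mul, map_mul, map_mul, vecDer_X]
    simp [lineHom]
    ring

/-- Taylor's formula along the line s ↦ s v. -/
theorem coeff_lineHom (v : ℕ → ℂ) (n : ℕ) (p : Fock) :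
    (lineHom v p).coeff n = 1 / (n.factorial : ℂ) * polar (Multiset.replicate n v) p := by
  induction n generalizing p with
  | zero => simp [coeff_zero_lineHom, polar_zero]
  | succ n ih =>
    have h := Polynomial.coeff_derivative (lineHom v p) n
    rw [derivative_lineHom, ih] at h
    rw [Multiset.replicate_succ, polar_cons, Nat.factorial_succ]
    have h1 : ((n : ℂ) + 1) ≠ 0 := by exact_mod_cast Nat.succ_ne_zero n
    have h2 : (n.factorial : ℂ) ≠ 0 := by exact_mod_cast n.factorial_ne_zero
    push_cast
    field_simp at h ⊢
    linear_combination -h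

theorem eval_eq_sum_polar (v : ℕ → ℂ) (p : Fock) {N : ℕ}
    (hN : ∀ n, N ≤ n → polar (Multiset.replicate n v) p = 0) :
    eval v p = ∑ n ∈ range N, 1 / (n.factorial : ℂ) * polar (Multiset.replicate n v) p := by
  rw [← eval_one_lineHom, Polynomial.eval_eq_sum_range' (n := max N ((lineHom v p).natDegree + 1))
    (by omega)]
  simp only [one_pow, mul_one, coeff_lineHom]
  symm
  refine sum_subset (range_mono (le_max_left _ _)) fun n _ hn => ?_
  rw [hN n (not_lt.mp fun h => hn (mem_range.mpr h)), mul_zero]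

theorem polar_replicate_fockEnergy_ne_zero {c : ℂ} {m n : ℕ} {v : ℕ → ℂ}
    (h : polar (Multiset.replicate (n + 1) v) (fockEnergy c m) ≠ 0) : ∃ g, n + 2 * g = m + 1 := by
  rw [Multiset.replicate_succ] at h
  obtain ⟨g, hg⟩ := polar_fockEnergy_ne_zero _ _ h
  exact ⟨g, by rwa [Multiset.card_replicate] at hg⟩

theorem eval_sub_constantCoeff (c : ℂ) (m : ℕ) (v : ℕ → ℂ) :
    eval v (fockEnergy c m) - constantCoeff (fockEnergy c m) =
      ∑ n ∈ range (m + 2), 1 / ((n + 1).factorial : ℂ) *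
        polar (Multiset.replicate (n + 1) v) (fockEnergy c m) := by
  rw [eval_eq_sum_polar v (fockEnergy c m) (N := m + 3), sum_range_succ']
  · simp only [Nat.factorial_zero, Nat.cast_one, div_one, one_mul, Multiset.replicate_zero,
      polar_zero, add_sub_cancel_right]
  · intro n hn
    obtain ⟨k, rfl⟩ : ∃ k, n = k + 1 := ⟨n - 1, by omega⟩
    by_contra h
    obtain ⟨g, hg⟩ := polar_replicate_fockEnergy_ne_zero h
    omega

/-- In the Taylor expansion of F_m at the origin, the part of degree n evaluated at τ(z) is
F_n^{(g)}/n!, with g determined by 2g - 2 + n = m. Subtracting the constant term removes the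
arbitrariness of the primitive. -/
theorem freeEnergySum_eq (w₀ w₁ : ℂ) {m : ℕ} (hm : 1 ≤ m) {z : ℂ} (hz : z ≠ 0) :
    freeEnergySum w₀ w₁ (m + 1) z = eval (tauVec z) (fockEnergy (Lam w₀ w₁) m) -
      constantCoeff (fockEnergy (Lam w₀ w₁) m) := by
  rw [eval_sub_constantCoeff, freeEnergySum]
  have hmem : ∀ p : ℕ × ℕ, p ∈ (range (m + 1 + 2) ×ˢ Icc 1 (m + 1 + 1)).filter
      (fun p => 2 * p.1 + p.2 = m + 1 + 1) ↔ 1 ≤ p.2 ∧ 2 * p.1 + p.2 = m + 2 := by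
    intro p
    simp only [mem_filter, mem_product, mem_range, mem_Icc]
    omega
  refine sum_of_injOn (fun p => p.2 - 1) ?_ ?_ ?_ ?_
  · rintro ⟨a, b⟩ hp ⟨a', b'⟩ hp' h
    have h1 := (hmem _).mp (mem_coe.mp hp)
    have h2 := (hmem _).mp (mem_coe.mp hp')
    simp only [Prod.mk.injEq] at h h1 h2 ⊢
    omega
  · intro p hp
    have h1 := (hmem _).mp (mem_coe.mp hp)
    exact mem_coe.mpr (mem_range.mpr (by simp only; omega))
  · intro n _ hn
    by_contra h
    obtain ⟨g, hg⟩ := polar_replicate_fockEnergy_ne_zero (right_ne_zero_of_mul h)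
    exact hn ⟨(g, n + 1), mem_coe.mpr ((hmem _).mpr ⟨by simp, by simp only; omega⟩), rfl⟩
  · rintro ⟨g, n⟩ hp
    obtain ⟨h1, h2⟩ := (hmem _).mp hp
    obtain ⟨k, rfl⟩ : ∃ k, n = k + 1 := ⟨n - 1, by simp only at h1; omega⟩
    simp only [Nat.add_sub_cancel]
    rw [freeEnergy_eq_polar w₀ w₁ hm (by simp only at h2; omega) hz]

/-- The derivative of the free energy of order `m`. -/
def freeEnergyDeriv (c : ℂ) (m : ℕ) (z : ℂ) : ℂ :=
  eval (tauVec z) (vecDer (xiVec z) (fockEnergy c m))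

theorem hasDerivAt_freeEnergySum (w₀ w₁ : ℂ) {m : ℕ} (hm : 1 ≤ m) {z : ℂ} (hz : z ≠ 0) :
    HasDerivAt (freeEnergySum w₀ w₁ (m + 1)) (freeEnergyDeriv (Lam w₀ w₁) m z) z := by
  refine ((hasDerivAt_eval_tauVec hz (fockEnergy (Lam w₀ w₁) m)).sub_const
    (constantCoeff (fockEnergy (Lam w₀ w₁) m))).congr_of_eventuallyEq ?_
  filter_upwards [isOpen_ne.mem_nhds hz] with u hu
  exact freeEnergySum_eq w₀ w₁ hm hu

theorem tendsto_freeEnergySum (w₀ w₁ : ℂ) {m : ℕ} (hm : 1 ≤ m) :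
    Tendsto (freeEnergySum w₀ w₁ (m + 1)) (Bornology.cobounded ℂ) (𝓝 0) := by
  have h := (tendsto_eval_tauVec (fockEnergy (Lam w₀ w₁) m)).sub_const
    (constantCoeff (fockEnergy (Lam w₀ w₁) m))
  rw [sub_self] at h
  refine h.congr' ?_
  filter_upwards [Bornology.eventually_ne_cobounded (0 : ℂ)] with u hu
  exact (freeEnergySum_eq w₀ w₁ hm hu).symm

theorem polar_replicate_neg (n : ℕ) (v : ℕ → ℂ) (p : Fock) :
    polar (Multiset.replicate n (-v)) p = (-1) ^ n * polar (Multiset.replicate n v) p := by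
  induction n generalizing p with
  | zero => simp
  | succ n ih =>
    rw [Multiset.replicate_succ, Multiset.replicate_succ, polar_cons, polar_cons, ih,
      show -v = (-1 : ℂ) • v by rw [neg_smul, one_smul], vecDer_smul, Derivation.smul_apply,
      map_smul, smul_eq_mul, pow_succ]
    ring

/-- τ is odd in z, and the positive degrees that occur in F_m are congruent to m modulo 2. -/
theorem freeEnergySum_neg (w₀ w₁ : ℂ) {m : ℕ} (hm : 1 ≤ m) {z : ℂ} (hz : z ≠ 0) :
    freeEnergySum w₀ w₁ (m + 1) (-z) = (-1) ^ m * freeEnergySum w₀ w₁ (m + 1) z := by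
  rw [freeEnergySum_eq w₀ w₁ hm hz, freeEnergySum_eq w₀ w₁ hm (neg_ne_zero.mpr hz),
    eval_sub_constantCoeff, eval_sub_constantCoeff, tauVec_neg, mul_sum]
  refine sum_congr rfl fun n _ => ?_
  rw [polar_replicate_neg]
  by_cases h : polar (Multiset.replicate (n + 1) (tauVec z)) (fockEnergy (Lam w₀ w₁) m) = 0
  · rw [h]; ring
  · obtain ⟨g, hg⟩ := polar_replicate_fockEnergy_ne_zero h
    have h1 : ((-1 : ℂ)) ^ (n + 1) = (-1) ^ m := by
      have h2 : ((-1 : ℂ)) ^ (n + 1 + 2 * g) = (-1) ^ (m + 2) := by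
        rw [show n + 1 + 2 * g = m + 2 by omega]
      rwa [pow_add, pow_mul, pow_add _ m, neg_one_sq, one_pow, mul_one, mul_one] at h2
    rw [h1]; ring

end FreeEnergy
end EquivariantCP1

end

noncomputable section

namespace EquivariantCP1

section DerivativeRecursion

open Finset MvPolynomial

/-! ### The recursion for the derivatives of the free energies on the diagonal -/

theorem eval_vecDer (u v : ℕ → ℂ) {p : Fock} {M : ℕ} (h : ∀ i ∈ p.vars, i < M) :
    eval u (vecDer v p) = ∑ j ∈ range M, v j * eval u (pderiv j p) := by
  rw [vecDer_eq_sum v h, map_sum]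
  exact sum_congr rfl fun j _ => by rw [smul_eval]

theorem bergmanCoeff_mul_tauVec (z : ℂ) (a : ℕ) :
    bergmanCoeff a * tauVec z a = -2 * (z ^ (2 * a + 1))⁻¹ := by
  have h : (2 * (a : ℂ) + 1) ≠ 0 := by exact_mod_cast Nat.succ_ne_zero (2 * a)
  rw [bergmanCoeff, tauVec]
  field_simp

theorem eval_tauVec_shiftDer (z : ℂ) (k : ℕ) {p : Fock} {M : ℕ} (h : ∀ i ∈ p.vars, i < M) :
    eval (tauVec z) (shiftDer k p) = ∑ j ∈ range M,
      if k ≤ j + 1 then -2 * (z ^ (2 * (j + 1 - k) + 1))⁻¹ * eval (tauVec z) (pderiv j p) else 0 := by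
  rw [derivation_eq_sum (shiftDer k) h, map_sum]
  refine sum_congr rfl fun j _ => ?_
  rw [map_mul, shiftDer_X]
  split_ifs
  · rw [smul_eval, eval_X, bergmanCoeff_mul_tauVec]
  · rw [map_zero]; ring

/-- On the diagonal the powers of z combine to z^(-2j-3) independently of k, so the j + 2 indices k
= 0, …, j + 1 contribute equally. -/
theorem sum_eval_tauVec_shiftDer (z : ℂ) {p : Fock} {M B : ℕ}
    (h : ∀ i ∈ p.vars, i < M) (hB : M + 1 ≤ B) :
    ∑ k ∈ range B, (z ^ (2 * k))⁻¹ * eval (tauVec z) (shiftDer k p) =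
      ∑ j ∈ range M, -2 * ((j : ℂ) + 2) * (z ^ (2 * j + 3))⁻¹ * eval (tauVec z) (pderiv j p) := by
  simp only [eval_tauVec_shiftDer z _ h, mul_sum]
  rw [sum_comm]
  refine sum_congr rfl fun j hj => ?_
  have hj' := mem_range.mp hj
  rw [← sum_subset (range_mono (show j + 2 ≤ B by omega))]
  · rw [sum_congr rfl (g := fun _ => -2 * (z ^ (2 * j + 3))⁻¹ * eval (tauVec z) (pderiv j p))]
    · rw [sum_const, card_range, nsmul_eq_mul]
      push_cast
      ring
    · intro k hk
      have hk' := mem_range.mp hk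
      rw [if_pos (by omega), show 2 * j + 3 = 2 * k + (2 * (j + 1 - k) + 1) by omega, pow_add,
        mul_inv]
      ring
  · intro k _ hk
    have hk' := mt mem_range.mpr hk
    rw [if_neg (by omega), mul_zero]

theorem hasDerivAt_freeEnergyDeriv (c : ℂ) {m M : ℕ} {z : ℂ} (hz : z ≠ 0)
    (h : ∀ i ∈ (fockEnergy c m).vars, i < M) :
    HasDerivAt (freeEnergyDeriv c m)
      (∑ j ∈ range M, -2 * ((j : ℂ) + 1) * (z ^ (2 * j + 3))⁻¹ *
          eval (tauVec z) (pderiv j (fockEnergy c m)) +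
        eval (tauVec z) (vecDer (xiVec z) (vecDer (xiVec z) (fockEnergy c m)))) z := by
  have e : freeEnergyDeriv c m = fun z => ∑ j ∈ range M,
      (z ^ (2 * j + 2))⁻¹ * eval (tauVec z) (pderiv j (fockEnergy c m)) :=
    funext fun z => eval_vecDer _ _ h
  rw [e, vecDer_eq_sum (xiVec z) h, map_sum, map_sum, ← sum_add_distrib]
  refine HasDerivAt.fun_sum fun j _ => ?_
  refine (((hasDerivAt_pow (2 * j + 2) z).inv (pow_ne_zero _ hz)).mul
    (hasDerivAt_eval_tauVec hz (pderiv j (fockEnergy c m)))).congr_deriv ?_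
  rw [Derivation.map_smul, smul_eval, xiVec]
  congr 1
  have h0 := pow_ne_zero (2 * j) hz
  simp only [show 2 * j + 2 - 1 = 2 * j + 1 from rfl, pow_add]
  push_cast
  field_simp

theorem freeEnergyDeriv_succ_eq (c : ℂ) {z : ℂ} (hz : z ≠ 0) {m M : ℕ}
    (h : ∀ i ≤ m + 1, ∀ j ∈ (fockEnergy c i).vars, j < M) :
    freeEnergyDeriv c (m + 1) z = -(1 / 4) * ∑ b ∈ range (2 * M + 2),
      eval (tauVec z) (loopCoeff (fockEnergy c) m b) *
        ((z ^ 2 - c) * (z ^ (2 * b + 2))⁻¹ - if b = 0 then 1 else 0) := by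
  rw [freeEnergyDeriv, eval_vecDer (M := 2 * M + 2) _ _
    fun i hi => (h (m + 1) le_rfl i hi).trans (by omega)]
  have h1 := sum_mul_kernel_coeff hz c
    (fun b => eval (tauVec z) (loopCoeff (fockEnergy c) m b)) (2 * M + 2)
  have h0 := loopCoeff_eq_zero (fun i hi => h i (hi.trans m.le_succ)) (le_refl (2 * M + 2))
  simp only [h0, map_zero, zero_mul, mul_zero, sub_zero] at h1
  rw [← h1]
  refine sum_congr rfl fun k _ => ?_
  rw [pderiv_fockEnergy, recursionRHS, smul_eval, map_sub, smul_eval, xiVec]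

/-- The factor `κ = (1 - c / z²) / 4`. -/
def kappa (c z : ℂ) : ℂ := (1 - c * (z ^ 2)⁻¹) / 4

theorem freeEnergyDeriv_zero (c z : ℂ) : freeEnergyDeriv c 0 z = 0 := by
  rw [freeEnergyDeriv, fockEnergy, map_zero, map_zero]

theorem freeEnergyDeriv_one (c : ℂ) {z : ℂ} (hz : z ≠ 0) :
    freeEnergyDeriv c 1 z = -(1 / 16) * ((z ^ 2)⁻¹ - 5 * c * (z ^ 4)⁻¹) := by
  obtain ⟨M, hM⟩ := exists_common_bound (fockEnergy c) 1
  have hF : fockEnergy c 0 = 0 := by rw [fockEnergy]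
  rw [freeEnergyDeriv_succ_eq c hz hM,
    ← sum_subset (range_mono (show 2 ≤ 2 * M + 2 by omega)), sum_range_succ, sum_range_one]
  · simp only [loopCoeff, if_true, hF, map_zero, add_zero, map_mul, eval_X, eval_C, tauVec]
    simp only [Nat.cast_zero, mul_zero, zero_add, pow_one, one_ne_zero, if_false]
    field_simp
    ring
  · intro b _ hb
    rw [loopCoeff_eq_zero (M := 0) (fun i hi j hj => ?_)
      (not_lt.mp (fun h => hb (mem_range.mpr h))), map_zero, zero_mul]
    rw [Nat.le_zero.mp hi, hF] at hj
    simp at hj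

/-- As κ' = c/(2z³), this says W_{m+1} = -(κ W_m)' - κ ∑ W_i W_j. The linear Virasoro terms carry
the weight j + 2 where the derivative of ξ_j carries j + 1; this excess and the correction at b = 0
together produce the term κ' W_m. -/
theorem freeEnergyDeriv_succ (c : ℂ) {z : ℂ} (hz : z ≠ 0) {m : ℕ} (hm : 1 ≤ m) :
    freeEnergyDeriv c (m + 1) z =
      -(c / (2 * z ^ 3) * freeEnergyDeriv c m z + kappa c z * (deriv (freeEnergyDeriv c m) z +
        ∑ ij ∈ antidiagonal m, freeEnergyDeriv c ij.1 z * freeEnergyDeriv c ij.2 z)) := by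
  obtain ⟨M, hM⟩ := exists_common_bound (fockEnergy c) (m + 1)
  have hM' : ∀ i ≤ m, ∀ j ∈ (fockEnergy c i).vars, j < M := fun i hi => hM i (hi.trans m.le_succ)
  have hm0 : m ≠ 0 := by omega
  set E := eval (tauVec z)
  have hloop : ∑ b ∈ range (2 * M + 2), (z ^ (2 * b))⁻¹ * E (loopCoeff (fockEnergy c) m b) =
      ∑ b ∈ range (2 * M + 2), (z ^ (2 * b))⁻¹ * E (shiftDer b (fockEnergy c m)) +
        (E (vecDer (xiVec z) (vecDer (xiVec z) (fockEnergy c m))) +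
          ∑ ij ∈ antidiagonal m, freeEnergyDeriv c ij.1 z * freeEnergyDeriv c ij.2 z) := by
    have hq := congrArg E (sum_quadTerm hM' z)
    simp only [map_sum, map_add, map_mul, smul_eval, E] at hq
    simp only [freeEnergyDeriv]
    rw [← hq, sum_range_succ', sum_range_succ', sum_range_succ' _ (2 * M + 1),
      sum_range_succ' _ (2 * M)]
    simp only [loopCoeff, if_neg hm0, zero_add, map_add, mul_add, sum_add_distrib, E]
    ring
  set S₀ := ∑ j ∈ range M, (z ^ (2 * j + 3))⁻¹ * E (pderiv j (fockEnergy c m)) with hS₀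
  set S₁ := ∑ j ∈ range M, (j : ℂ) * ((z ^ (2 * j + 3))⁻¹ * E (pderiv j (fockEnergy c m)))
    with hS₁
  set N := E (vecDer (xiVec z) (vecDer (xiVec z) (fockEnergy c m)))
  set Q := ∑ ij ∈ antidiagonal m, freeEnergyDeriv c ij.1 z * freeEnergyDeriv c ij.2 z
  have hW : freeEnergyDeriv c m z = z * S₀ := by
    rw [freeEnergyDeriv, eval_vecDer _ _ (hM' m le_rfl), hS₀, mul_sum]
    refine sum_congr rfl fun j _ => ?_
    rw [xiVec, pow_succ z (2 * j + 2)]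
    field_simp
    rfl
  have hW' : deriv (freeEnergyDeriv c m) z = -2 * S₁ - 2 * S₀ + N := by
    rw [(hasDerivAt_freeEnergyDeriv c hz (hM' m le_rfl)).deriv, hS₀, hS₁, mul_sum, mul_sum,
      ← sum_sub_distrib]
    congr 1
    exact sum_congr rfl fun j _ => by ring
  have hsh : ∑ b ∈ range (2 * M + 2), (z ^ (2 * b))⁻¹ * E (shiftDer b (fockEnergy c m)) =
      -2 * S₁ - 4 * S₀ := by
    rw [sum_eval_tauVec_shiftDer z (hM' m le_rfl) (by omega), hS₀, hS₁, mul_sum, mul_sum,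
      ← sum_sub_distrib]
    exact sum_congr rfl fun j _ => by ring
  have h0 : E (loopCoeff (fockEnergy c) m 0) = -2 * S₀ := by
    simp only [loopCoeff, if_neg hm0, zero_add, E]
    rw [eval_tauVec_shiftDer z 0 (hM' m le_rfl), hS₀, mul_sum]
    refine sum_congr rfl fun j _ => ?_
    rw [if_pos (Nat.zero_le _), mul_assoc, show 2 * (j + 1 - 0) + 1 = 2 * j + 3 by omega]
  have hsplit : ∑ b ∈ range (2 * M + 2), E (loopCoeff (fockEnergy c) m b) *
      ((z ^ 2 - c) * (z ^ (2 * b + 2))⁻¹ - if b = 0 then 1 else 0) =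
      (z ^ 2 - c) * (z ^ 2)⁻¹ * ∑ b ∈ range (2 * M + 2), (z ^ (2 * b))⁻¹ *
        E (loopCoeff (fockEnergy c) m b) - E (loopCoeff (fockEnergy c) m 0) := by
    rw [mul_sum, ← Finset.sum_ite_eq_of_mem' (range (2 * M + 2)) 0
      (fun b => E (loopCoeff (fockEnergy c) m b)) (mem_range.mpr (by omega)), ← sum_sub_distrib]
    refine sum_congr rfl fun b _ => ?_
    rw [pow_add, mul_inv]
    split_ifs <;> ring
  rw [freeEnergyDeriv_succ_eq c hz hM, hsplit, hloop, hsh, h0, hW', hW, kappa]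
  field_simp
  ring

end DerivativeRecursion
end EquivariantCP1

end

/-! ### The WKB side: Riccati recursion, P_odd and the amplitudes -/

noncomputable section

namespace EquivariantCP1

section Riccati

open Finset Filter Topology

/-! ### The solutions of the Riccati equation -/

variable {w₀ w₁ : ℂ}

theorem isOpen_puncturedCurve (w₀ w₁ : ℂ) : IsOpen (puncturedCurve w₀ w₁) := by
  have h : Continuous (curveX w₀ w₁) := by unfold curveX; fun_prop
  exact isOpen_ne.inter (isOpen_ne.preimage h)

theorem deriv_curveX (w₀ w₁ z : ℂ) : deriv (curveX w₀ w₁) z = 2 * z :=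
  (hasDerivAt_curveX w₀ w₁ z).deriv

theorem differentiableAt_freeEnergyDeriv (c : ℂ) (m : ℕ) {z : ℂ} (hz : z ≠ 0) :
    DifferentiableAt ℂ (freeEnergyDeriv c m) z := by
  obtain ⟨M, hM⟩ := exists_bound_vars (fockEnergy c m)
  exact (hasDerivAt_freeEnergyDeriv c hz hM).differentiableAt

/-- The function `2z P₁`. -/
def leadingCorrection (w₀ w₁ z : ℂ) : ℂ := (z ^ 2 + Lam w₀ w₁) / (2 * z * curveX w₀ w₁ z)

theorem riccati_succ (w₀ w₁ ε : ℂ) (n : ℕ) (z : ℂ) : riccati w₀ w₁ ε (n + 1) z =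
    1 / (2 * (ε * sqrtQ0 w₀ w₁ z)) *
        ((if n = 1 then Q2 (curveX w₀ w₁ z) else 0)
          - ∑ i ∈ range n, riccati w₀ w₁ ε (i + 1) z * riccati w₀ w₁ ε (n - i) z
          - ddx w₀ w₁ (riccati w₀ w₁ ε n) z) := by
  rw [riccati, ← Fin.sum_univ_eq_sum_range
    (fun i => riccati w₀ w₁ ε (i + 1) z * riccati w₀ w₁ ε (n - i) z)]

theorem riccati_zero (w₀ w₁ ε z : ℂ) : riccati w₀ w₁ ε 0 z = ε * sqrtQ0 w₀ w₁ z := by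
  rw [riccati]

theorem hasDerivAt_leadingCorrection {z : ℂ} (hz : z ∈ puncturedCurve w₀ w₁) :
    HasDerivAt (leadingCorrection w₀ w₁)
      ((2 * z * (2 * z * curveX w₀ w₁ z) - (z ^ 2 + Lam w₀ w₁) *
        (2 * curveX w₀ w₁ z + 4 * z ^ 2)) / (2 * z * curveX w₀ w₁ z) ^ 2) z := by
  have h1 : HasDerivAt (fun z => z ^ 2 + Lam w₀ w₁) (2 * z) z := by
    simpa using (hasDerivAt_pow 2 z).add_const (Lam w₀ w₁)
  have h2 : HasDerivAt (fun z => 2 * z * curveX w₀ w₁ z)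
      (2 * curveX w₀ w₁ z + 4 * z ^ 2) z := by
    refine (((hasDerivAt_id z).const_mul 2).mul (hasDerivAt_curveX w₀ w₁ z)).congr_deriv ?_
    simp only [id]
    ring
  exact h1.div h2 (mul_ne_zero (mul_ne_zero two_ne_zero hz.1) hz.2)

/-- The correction ℓ = 2z P₁ is -½ d log P₀/dz. In the coordinate z, where d/dx = (2z)⁻¹ d/dz, it
enters the Riccati recursion through κ(2ℓ - 1/z) = κ', which reproduces `freeEnergyDeriv_succ`. The
value of Q₂ is used once, to match P₂ with W₁. -/
theorem riccati_one_succ (m : ℕ) {z : ℂ} (hz : z ∈ puncturedCurve w₀ w₁) :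
    riccati w₀ w₁ 1 (m + 1) z = (freeEnergyDeriv (Lam w₀ w₁) m z +
      if m = 0 then leadingCorrection w₀ w₁ z else 0) / (2 * z) := by
  induction m using Nat.strong_induction_on generalizing z with
  | _ m ih =>
  obtain ⟨hz0, hzX⟩ := id hz
  have hX : curveX w₀ w₁ z = z ^ 2 - Lam w₀ w₁ := rfl
  have hX' := hzX
  rw [hX] at hX'
  rcases m with _ | m
  · have h0 : riccati w₀ w₁ 1 0 = fun z => z / curveX w₀ w₁ z :=
      funext fun z => by rw [riccati_zero, one_mul, sqrtQ0]
    have hd : HasDerivAt (fun z => z / curveX w₀ w₁ z)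
        ((1 * curveX w₀ w₁ z - z * (2 * z)) / curveX w₀ w₁ z ^ 2) z :=
      (hasDerivAt_id z).div (hasDerivAt_curveX w₀ w₁ z) hzX
    rw [riccati_succ, ddx, h0, hd.deriv, deriv_curveX, sqrtQ0, freeEnergyDeriv_zero, if_pos rfl,
      leadingCorrection, if_neg zero_ne_one, range_zero, sum_empty, hX]
    field_simp
    ring
  · set W := freeEnergyDeriv (Lam w₀ w₁) with hW
    set ℓ := leadingCorrection w₀ w₁ with hℓ
    -- The correction ℓ sits in the factors of order 1, hence at i = 0 and at i = m. These coincide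
    -- when m = 0, which gives ℓ².
    have hsum : ∑ i ∈ range (m + 1), riccati w₀ w₁ 1 (i + 1) z * riccati w₀ w₁ 1 (m + 1 - i) z =
        (∑ ij ∈ antidiagonal m, W ij.1 z * W ij.2 z + 2 * ℓ z * W m z +
          if m = 0 then ℓ z ^ 2 else 0) / (4 * z ^ 2) := by
      rw [Nat.sum_antidiagonal_eq_sum_range_succ fun i j => W i z * W j z]
      have e : ∀ i ∈ range (m + 1), riccati w₀ w₁ 1 (i + 1) z * riccati w₀ w₁ 1 (m + 1 - i) z =
          (W i z * W (m - i) z + (if i = 0 then ℓ z * W (m - i) z else 0) +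
            (if i = m then ℓ z * W i z else 0) +
            if i = 0 then (if m = 0 then ℓ z ^ 2 else 0) else 0) / (4 * z ^ 2) := by
        intro i hi
        have hi' := mem_range.mp hi
        rw [show m + 1 - i = m - i + 1 by omega, ih i (by omega) hz, ih (m - i) (by omega) hz,
          div_mul_div_comm, show 2 * z * (2 * z) = 4 * z ^ 2 by ring]
        congr 1
        by_cases h0 : i = 0 <;> by_cases h1 : i = m
        · simp only [if_pos h0, if_pos h1, if_pos (show m - i = 0 by omega),
            if_pos (show m = 0 by omega)]
          ring
        · simp only [if_pos h0, if_neg h1, if_neg (show ¬ m - i = 0 by omega),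
            if_neg (show ¬ m = 0 by omega)]
          ring
        · simp only [if_neg h0, if_pos h1, if_pos (show m - i = 0 by omega)]
          ring
        · simp only [if_neg h0, if_neg h1, if_neg (show ¬ m - i = 0 by omega)]
          ring
      rw [sum_congr rfl e, ← sum_div, sum_add_distrib, sum_add_distrib, sum_add_distrib,
        sum_ite_eq_of_mem' _ _ _ (mem_range.mpr (Nat.succ_pos m)),
        sum_ite_eq_of_mem' _ _ _ (mem_range.mpr (Nat.succ_pos m)),
        sum_ite_eq_of_mem' _ _ _ (mem_range.mpr (Nat.lt_succ_self m)), Nat.sub_zero]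
      congr 1
      ring
    have hderiv : deriv (riccati w₀ w₁ 1 (m + 1)) z =
        (deriv (W m) z + if m = 0 then deriv ℓ z else 0) / (2 * z) -
          (W m z + if m = 0 then ℓ z else 0) / (2 * z ^ 2) := by
      have he : riccati w₀ w₁ 1 (m + 1) =ᶠ[𝓝 z]
          fun u => (W m u + if m = 0 then ℓ u else 0) / (2 * u) := by
        filter_upwards [(isOpen_puncturedCurve w₀ w₁).mem_nhds hz] with u hu
        exact ih m (Nat.lt_succ_self m) hu
      have h1 : HasDerivAt (fun u => W m u + if m = 0 then ℓ u else 0)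
          (deriv (W m) z + if m = 0 then deriv ℓ z else 0) z := by
        refine (differentiableAt_freeEnergyDeriv _ m hz0).hasDerivAt.add ?_
        split_ifs
        · exact (hasDerivAt_leadingCorrection hz).differentiableAt.hasDerivAt
        · exact hasDerivAt_const z 0
      have h2 := h1.div ((hasDerivAt_id z).const_mul 2) (mul_ne_zero two_ne_zero hz0)
      rw [he.deriv_eq]
      refine h2.deriv.trans ?_
      simp only [id]
      field_simp
    rw [riccati_succ, hsum, ddx, hderiv, deriv_curveX, if_neg (Nat.succ_ne_zero m), add_zero,
      sqrtQ0]
    rcases Nat.eq_zero_or_pos m with rfl | hm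
    · simp only [zero_add, if_true, hW, freeEnergyDeriv_one _ hz0]
      have hW0 : freeEnergyDeriv (Lam w₀ w₁) 0 = fun _ => 0 :=
        funext fun z => freeEnergyDeriv_zero _ z
      rw [Nat.antidiagonal_zero, sum_singleton, hW0, hℓ, (hasDerivAt_leadingCorrection hz).deriv,
        leadingCorrection, Q2, deriv_const, hX]
      field_simp
      ring
    · simp only [if_neg (show ¬ m + 1 = 1 by omega), if_neg (show ¬ m = 0 by omega)]
      rw [hW, freeEnergyDeriv_succ _ hz0 hm, ← hW, hℓ, leadingCorrection, kappa, hX]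
      field_simp
      ring

theorem curveX_neg (w₀ w₁ z : ℂ) : curveX w₀ w₁ (-z) = curveX w₀ w₁ z := by
  rw [curveX, curveX, neg_sq]

theorem neg_mem_puncturedCurve {z : ℂ} (hz : z ∈ puncturedCurve w₀ w₁) :
    -z ∈ puncturedCurve w₀ w₁ :=
  ⟨neg_ne_zero.mpr hz.1, by rw [curveX_neg]; exact hz.2⟩

/-- The involution reverses √Q₀ and commutes with d/dx because x is invariant, so it carries one
Riccati recursion into the other. -/
theorem riccati_neg_one (w₀ w₁ : ℂ) (n : ℕ) (z : ℂ) :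
    riccati w₀ w₁ (-1) n z = riccati w₀ w₁ 1 n (-z) := by
  induction n using Nat.strong_induction_on generalizing z with
  | _ n ih =>
  have hs : -1 * sqrtQ0 w₀ w₁ z = 1 * sqrtQ0 w₀ w₁ (-z) := by
    rw [sqrtQ0, sqrtQ0, curveX_neg]; ring
  rcases n with _ | n
  · rw [riccati_zero, riccati_zero, hs]
  · have hd : ddx w₀ w₁ (riccati w₀ w₁ (-1) n) z = ddx w₀ w₁ (riccati w₀ w₁ 1 n) (-z) := by
      have e : riccati w₀ w₁ (-1) n = fun u => riccati w₀ w₁ 1 n (-u) :=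
        funext fun u => ih n (Nat.lt_succ_self n) u
      rw [ddx, ddx, e, deriv_comp_neg, deriv_curveX, deriv_curveX, mul_neg, div_neg, neg_div]
    rw [riccati_succ, riccati_succ, hs, hd, curveX_neg]
    congr 3
    refine sum_congr rfl fun i hi => ?_
    have := mem_range.mp hi
    rw [ih (i + 1) (by omega), ih (n - i) (by omega)]

theorem freeEnergyDeriv_neg (w₀ w₁ : ℂ) (m : ℕ) {z : ℂ} (hz : z ≠ 0) :
    freeEnergyDeriv (Lam w₀ w₁) m (-z) = (-1) ^ (m + 1) * freeEnergyDeriv (Lam w₀ w₁) m z := by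
  rcases Nat.eq_zero_or_pos m with rfl | hm
  · rw [freeEnergyDeriv_zero, freeEnergyDeriv_zero, mul_zero]
  · have h1 : HasDerivAt (fun z => freeEnergySum w₀ w₁ (m + 1) (-z))
        (-freeEnergyDeriv (Lam w₀ w₁) m (-z)) z := by
      have h := (hasDerivAt_freeEnergySum w₀ w₁ hm (neg_ne_zero.mpr hz)).comp z (hasDerivAt_neg z)
      exact h.congr_deriv (by ring)
    have h2 : HasDerivAt (fun z => freeEnergySum w₀ w₁ (m + 1) (-z))
        ((-1) ^ m * freeEnergyDeriv (Lam w₀ w₁) m z) z := by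
      refine ((hasDerivAt_freeEnergySum w₀ w₁ hm hz).const_mul ((-1) ^ m)).congr_of_eventuallyEq ?_
      filter_upwards [isOpen_ne.mem_nhds hz] with u hu
      exact freeEnergySum_neg w₀ w₁ hm hu
    rw [pow_succ]
    linear_combination -(h1.unique h2)

theorem Podd_zero (w₀ w₁ z : ℂ) : Podd w₀ w₁ 0 z = z / curveX w₀ w₁ z := by
  rw [Podd, riccati_zero, riccati_zero, sqrtQ0]; ring

/-- P_odd is the part of P^{(+)} that is odd in z. The quotient W_m/(2z) has parity (-1)^m, and
ℓ/(2z) is even and drops out. -/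
theorem Podd_succ (m : ℕ) {z : ℂ} (hz : z ∈ puncturedCurve w₀ w₁) :
    Podd w₀ w₁ (m + 1) z =
      if Odd m then freeEnergyDeriv (Lam w₀ w₁) m z / (2 * z) else 0 := by
  have hz0 := hz.1
  have hℓ : leadingCorrection w₀ w₁ (-z) = -leadingCorrection w₀ w₁ z := by
    rw [leadingCorrection, leadingCorrection, curveX_neg, neg_sq, mul_neg, neg_mul, div_neg]
  rw [Podd, riccati_neg_one, riccati_one_succ m hz, riccati_one_succ m (neg_mem_puncturedCurve hz),
    freeEnergyDeriv_neg w₀ w₁ m hz0, hℓ]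
  split_ifs with h0 h1 h1
  · subst h0; exact absurd h1 (by decide)
  · subst h0
    rw [freeEnergyDeriv_zero]
    field_simp
    ring
  · rw [Even.neg_one_pow h1.add_one]
    field_simp
    ring
  · rw [Odd.neg_one_pow (Nat.not_odd_iff_even.mp h1).add_one]
    field_simp
    ring

end Riccati
end EquivariantCP1

end

noncomputable section

namespace EquivariantCP1

section SeriesExp

open Finset Filter Topology PowerSeries

/-! ### Exponentials of power series -/

/-- The exponential of a power series without constant term. -/
def expOf (a : PowerSeries ℂ) : PowerSeries ℂ := (PowerSeries.exp ℂ).subst a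

theorem hasSubst_of_constantCoeff {a : PowerSeries ℂ} (ha : constantCoeff a = 0) : HasSubst a :=
  HasSubst.of_constantCoeff_zero' ha

theorem coeff_pow_eq_zero {a : PowerSeries ℂ} (ha : constantCoeff a = 0) {n k : ℕ} (h : n < k) :
    coeff n (a ^ k) = 0 := by
  have hX : X ^ k ∣ a ^ k := pow_dvd_pow_of_dvd (X_dvd_iff.mpr ha) k
  exact X_pow_dvd_iff.mp hX n h

theorem coeff_expOf {a : PowerSeries ℂ} (ha : constantCoeff a = 0) {n N : ℕ} (h : n < N) :
    coeff n (expOf a) = ∑ k ∈ range N, 1 / (k.factorial : ℂ) * coeff n (a ^ k) := by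
  rw [expOf, coeff_subst' (hasSubst_of_constantCoeff ha), finsum_eq_sum_of_support_subset]
  · refine sum_congr rfl fun k _ => ?_
    rw [coeff_exp, smul_eq_mul]
    simp
  · intro k hk
    by_contra hk'
    have : N ≤ k := by simpa using hk'
    rw [Function.mem_support, coeff_pow_eq_zero ha (h.trans_le this), smul_zero] at hk
    exact hk rfl

theorem constantCoeff_expOf {a : PowerSeries ℂ} (ha : constantCoeff a = 0) :
    constantCoeff (expOf a) = 1 := by
  rw [← coeff_zero_eq_constantCoeff_apply, coeff_expOf ha one_pos]
  simp

theorem derivative_expOf {a : PowerSeries ℂ} (ha : constantCoeff a = 0) :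
    derivative ℂ (expOf a) = expOf a * derivative ℂ a := by
  rw [expOf, derivative_subst (hasSubst_of_constantCoeff ha), derivative_exp]

theorem eq_of_derivative_eq_mul {f g c : PowerSeries ℂ} (hf : derivative ℂ f = f * c)
    (hg : derivative ℂ g = g * c) (h0 : constantCoeff f = constantCoeff g) : f = g := by
  ext n
  induction n using Nat.strong_induction_on with
  | _ n ih =>
    rcases n with _ | n
    · rwa [coeff_zero_eq_constantCoeff_apply, coeff_zero_eq_constantCoeff_apply]
    · have h1 := congrArg (coeff n) hf
      have h2 := congrArg (coeff n) hg
      rw [coeff_derivative, coeff_mul] at h1 h2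
      have h3 : coeff (n + 1) f * ((n : ℂ) + 1) = coeff (n + 1) g * (n + 1) := by
        rw [h1, h2]
        refine sum_congr rfl fun p hp => ?_
        have := HasAntidiagonal.mem_antidiagonal.mp hp
        rw [ih p.1 (by omega)]
      exact mul_right_cancel₀ (by exact_mod_cast Nat.succ_ne_zero n) h3

theorem expOf_add {a b : PowerSeries ℂ} (ha : constantCoeff a = 0) (hb : constantCoeff b = 0) :
    expOf (a + b) = expOf a * expOf b := by
  have hab : constantCoeff (a + b) = 0 := by rw [map_add, ha, hb, add_zero]
  refine eq_of_derivative_eq_mul (c := derivative ℂ (a + b)) (derivative_expOf hab) ?_ ?_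
  · rw [Derivation.leibniz, derivative_expOf ha, derivative_expOf hb, map_add, smul_eq_mul,
      smul_eq_mul]
    ring
  · rw [map_mul, constantCoeff_expOf ha, constantCoeff_expOf hb, constantCoeff_expOf hab, one_mul]

theorem expOf_zero : expOf 0 = 1 := by
  refine eq_of_derivative_eq_mul (c := 0) ?_ ?_ ?_
  · rw [derivative_expOf (map_zero _), map_zero]
  · rw [derivative_one, mul_zero]
  · rw [constantCoeff_expOf (map_zero _), map_one]

theorem logOf_expOf {a : PowerSeries ℂ} (ha : constantCoeff a = 0) : logOf (expOf a) = a := by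
  have hf : constantCoeff (expOf a - 1) = 0 := by
    rw [map_sub, constantCoeff_expOf ha, map_one, sub_self]
  have hs := hasSubst_of_constantCoeff hf
  refine derivative.ext ?_ ?_
  · rw [logOf_eq, derivative_subst hs, deriv_log, map_sub, derivative_one, sub_zero,
      derivative_expOf ha, ← mul_assoc]
    -- The derivative of log(1 + X) is the inverse of 1 + X; substituting exp(a) - 1 makes it cancel
    -- the factor exp(a) of the chain rule.
    have h1 : (mk fun n => algebraMap ℚ ℂ ((-1 : ℚ) ^ n)) * (1 + X) = 1 := by
      ext n
      rw [mul_add, mul_one, map_add]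
      rcases n with _ | n
      · simp
      · rw [coeff_succ_mul_X, coeff_mk, coeff_mk, coeff_one, if_neg (Nat.succ_ne_zero n), pow_succ]
        simp
    have h2 := congrArg (PowerSeries.subst (expOf a - 1)) h1
    rw [subst_mul hs, subst_add hs, subst_X hs] at h2
    have h3 : (1 : PowerSeries ℂ).subst (expOf a - 1) = (1 : PowerSeries ℂ) := by
      rw [← coe_substAlgHom hs, map_one]
    rw [h3, add_sub_cancel] at h2
    rw [h2, one_mul]
  · rw [constantCoeff_logOf (constantCoeff_expOf ha), ha]

/-- Coefficientwise differentiability of a family of power series. -/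
def HasCoeffDeriv (a : ℂ → PowerSeries ℂ) (a' : PowerSeries ℂ) (z : ℂ) : Prop :=
  ∀ n, HasDerivAt (fun z => coeff n (a z)) (coeff n a') z

theorem HasCoeffDeriv.mul {a b : ℂ → PowerSeries ℂ} {a' b' : PowerSeries ℂ} {z : ℂ}
    (ha : HasCoeffDeriv a a' z) (hb : HasCoeffDeriv b b' z) :
    HasCoeffDeriv (fun z => a z * b z) (a' * b z + a z * b') z := by
  intro n
  simp only [coeff_mul, map_add, ← sum_add_distrib]
  exact HasDerivAt.fun_sum fun p _ => (ha p.1).mul (hb p.2)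

theorem HasCoeffDeriv.pow {a : ℂ → PowerSeries ℂ} {a' : PowerSeries ℂ} {z : ℂ}
    (ha : HasCoeffDeriv a a' z) (k : ℕ) :
    HasCoeffDeriv (fun z => a z ^ k) (k * a z ^ (k - 1) * a') z := by
  induction k with
  | zero =>
    intro n
    simp only [pow_zero, Nat.cast_zero, zero_mul, map_zero]
    exact hasDerivAt_const z _
  | succ k ih =>
    have h := ih.mul ha
    simp only [← pow_succ] at h
    have e : (k : PowerSeries ℂ) * a z ^ (k - 1) * a' * a z + a z ^ k * a' =
        ((k + 1 : ℕ) : PowerSeries ℂ) * a z ^ (k + 1 - 1) * a' := by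
      rcases k with _ | k
      · simp
      · simp only [Nat.add_sub_cancel]
        push_cast
        ring
    rwa [e] at h

theorem HasCoeffDeriv.expOf {a : ℂ → PowerSeries ℂ} {a' : PowerSeries ℂ} {z : ℂ}
    (ha : HasCoeffDeriv a a' z) (h0 : ∀ z, constantCoeff (a z) = 0) :
    HasCoeffDeriv (fun z => expOf (a z)) (expOf (a z) * a') z := by
  intro n
  have e : (fun z => coeff n (EquivariantCP1.expOf (a z))) =
      -- One term more than needed for the coefficient n: differentiation lowers the exponent k by
      -- one and must leave n + 1 terms.
      fun z => ∑ k ∈ range (n + 2), 1 / (k.factorial : ℂ) * coeff n (a z ^ k) :=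
    funext fun z => coeff_expOf (h0 z) (by omega)
  rw [e]
  have h := HasDerivAt.fun_sum fun k (_ : k ∈ range (n + 2)) =>
    ((ha.pow k) n).const_mul (1 / (k.factorial : ℂ))
  refine h.congr_deriv ?_
  rw [sum_range_succ']
  simp only [Nat.cast_zero, zero_mul, map_zero, mul_zero, add_zero, Nat.add_sub_cancel]
  have e2 : ∀ p ∈ antidiagonal n, coeff p.1 (EquivariantCP1.expOf (a z)) * coeff p.2 a' =
      ∑ k ∈ range (n + 1), 1 / (k.factorial : ℂ) * coeff p.1 (a z ^ k) * coeff p.2 a' := by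
    intro p hp
    have := HasAntidiagonal.mem_antidiagonal.mp hp
    rw [coeff_expOf (h0 z) (show p.1 < n + 1 by omega), sum_mul]
  rw [coeff_mul n (EquivariantCP1.expOf (a z)), sum_congr rfl e2, sum_comm]
  refine sum_congr rfl fun k _ => ?_
  have e3 : ((k + 1 : ℕ) : PowerSeries ℂ) * a z ^ k * a' =
      PowerSeries.C ((k + 1 : ℕ) : ℂ) * (a z ^ k * a') := by
    rw [map_natCast, mul_assoc]
  rw [e3, coeff_C_mul, coeff_mul, mul_sum, mul_sum]
  refine sum_congr rfl fun p _ => ?_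
  rw [Nat.factorial_succ]
  have h1 : ((k : ℂ) + 1) ≠ 0 := by exact_mod_cast Nat.succ_ne_zero k
  have h2 : (k.factorial : ℂ) ≠ 0 := by exact_mod_cast k.factorial_ne_zero
  push_cast
  field_simp

/-- Coefficientwise convergence of a family of power series. -/
def TendstoCoeff {α : Type*} (a : α → PowerSeries ℂ) (l : Filter α) (b : PowerSeries ℂ) : Prop :=
  ∀ n, Tendsto (fun z => coeff n (a z)) l (𝓝 (coeff n b))

variable {α : Type*} {l : Filter α}

theorem TendstoCoeff.mul {a b : α → PowerSeries ℂ} {a' b' : PowerSeries ℂ}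
    (ha : TendstoCoeff a l a') (hb : TendstoCoeff b l b') :
    TendstoCoeff (fun z => a z * b z) l (a' * b') := by
  intro n
  simp only [coeff_mul]
  exact tendsto_finsetSum _ fun p _ => (ha p.1).mul (hb p.2)

theorem TendstoCoeff.pow {a : α → PowerSeries ℂ} {a' : PowerSeries ℂ}
    (ha : TendstoCoeff a l a') (k : ℕ) : TendstoCoeff (fun z => a z ^ k) l (a' ^ k) := by
  induction k with
  | zero => intro n; simpa using tendsto_const_nhds
  | succ k ih => simpa only [pow_succ] using ih.mul ha

theorem TendstoCoeff.expOf {a : α → PowerSeries ℂ} {a' : PowerSeries ℂ}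
    (ha : TendstoCoeff a l a') (h0 : ∀ z, constantCoeff (a z) = 0) (h0' : constantCoeff a' = 0) :
    TendstoCoeff (fun z => expOf (a z)) l (expOf a') := by
  intro n
  simp only [coeff_expOf (h0 _) (Nat.lt_succ_self n), coeff_expOf h0' (Nat.lt_succ_self n)]
  exact tendsto_finsetSum _ fun k _ => ((ha.pow k) n).const_mul _

/-- A solution of a homogeneous linear equation is determined by its limit at infinity. -/
theorem eqOn_expOf_of_hasCoeffDeriv {U : Set ℂ} (hU : IsOpen U) (hUc : IsPreconnected U)
    (hUinf : Filter.NeBot (Bornology.cobounded ℂ ⊓ 𝓟 U)) {a p : ℂ → PowerSeries ℂ}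
    {a' : ℂ → PowerSeries ℂ} (h0 : ∀ z, constantCoeff (a z) = 0)
    (ha : ∀ z ∈ U, HasCoeffDeriv a (a' z) z) (hp : ∀ z ∈ U, HasCoeffDeriv p (p z * a' z) z)
    (hal : TendstoCoeff a (Bornology.cobounded ℂ ⊓ 𝓟 U) 0)
    (hpl : TendstoCoeff p (Bornology.cobounded ℂ ⊓ 𝓟 U) 1) {z : ℂ} (hz : z ∈ U) :
    p z = expOf (a z) := by
  have hn : ∀ z, constantCoeff (-a z) = 0 := fun z => by rw [map_neg, h0, neg_zero]
  have hna : ∀ z ∈ U, HasCoeffDeriv (fun z => -a z) (-a' z) z := fun z hz n => by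
    simp only [map_neg]
    exact (ha z hz n).neg
  have hnl : TendstoCoeff (fun z => -a z) (Bornology.cobounded ℂ ⊓ 𝓟 U) 0 := fun n => by
    simpa using (hal n).neg
  -- The quotient of the two solutions has derivative 0 in z, so it is constant on U, and its limit
  -- at infinity is 1.
  set q : ℂ → PowerSeries ℂ := fun z => p z * expOf (-a z) with hq
  have hq' : ∀ z ∈ U, HasCoeffDeriv q 0 z := fun z hz => by
    have h := (hp z hz).mul ((hna z hz).expOf hn)
    have e : p z * a' z * expOf (-a z) + p z * (expOf (-a z) * -a' z) = 0 := by ring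
    rwa [e] at h
  have hql : TendstoCoeff q (Bornology.cobounded ℂ ⊓ 𝓟 U) 1 := by
    have h := hpl.mul (hnl.expOf hn (map_zero _))
    rwa [expOf_zero, one_mul] at h
  have h1 : q z = 1 := by
    ext n
    obtain ⟨c, hc⟩ := hU.exists_is_const_of_deriv_eq_zero (f := fun z => coeff n (q z)) hUc
      (fun z hz => (hq' z hz n).differentiableAt.differentiableWithinAt)
      (fun z hz => by simpa using (hq' z hz n).deriv)
    rw [hc z hz]
    refine tendsto_nhds_unique (Tendsto.congr' ?_ tendsto_const_nhds) (hql n)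
    filter_upwards [mem_inf_of_right (mem_principal_self U)] with u hu
    exact (hc u hu).symm
  have h2 : expOf (-a z) * expOf (a z) = 1 := by
    rw [← expOf_add (hn z) (h0 z), neg_add_cancel, expOf_zero]
  calc p z = q z * expOf (a z) := by rw [hq]; simp only; rw [mul_assoc, h2, mul_one]
    _ = expOf (a z) := by rw [h1, one_mul]

end SeriesExp
end EquivariantCP1

end

noncomputable section

namespace EquivariantCP1

section Amplitude

open Finset Filter Topology PowerSeries

/-! ### The amplitude of the WKB solution -/

variable {w₀ w₁ : ℂ}

theorem curveX_eq_zero_iff (w₀ w₁ z : ℂ) :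
    curveX w₀ w₁ z = 0 ↔ z = (w₀ - w₁) / 2 ∨ z = -((w₀ - w₁) / 2) := by
  rw [curveX, Lam, show z ^ 2 - (w₀ - w₁) ^ 2 / 4 = (z - (w₀ - w₁) / 2) * (z + (w₀ - w₁) / 2) by
    ring, mul_eq_zero, sub_eq_zero, add_eq_zero_iff_eq_neg]

theorem puncturedCurve_eq (w₀ w₁ : ℂ) :
    puncturedCurve w₀ w₁ = ({0, (w₀ - w₁) / 2, -((w₀ - w₁) / 2)} : Set ℂ)ᶜ := by
  ext z
  simp only [puncturedCurve, Set.mem_ofPred_eq, Set.mem_compl_iff, Set.mem_insert_iff,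
    Set.mem_singleton_iff, ne_eq, curveX_eq_zero_iff, not_or]

theorem isPreconnected_puncturedCurve (w₀ w₁ : ℂ) : IsPreconnected (puncturedCurve w₀ w₁) := by
  rw [puncturedCurve_eq]
  refine (Set.Countable.isConnected_compl_of_one_lt_rank ?_
    (Set.toFinite _).countable).isPreconnected
  rw [Complex.rank_real_complex]
  norm_num

theorem eventually_mem_puncturedCurve (w₀ w₁ : ℂ) :
    ∀ᶠ z in Bornology.cobounded ℂ, z ∈ puncturedCurve w₀ w₁ := by
  rw [puncturedCurve_eq]
  exact Bornology.isBounded_def.mp (Set.toFinite _).isBounded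

/-- The part `∑ ħ^m f_m`, over even `m`, of the free energy. -/
def evenSeries (w₀ w₁ z : ℂ) : PowerSeries ℂ :=
  mk fun m => if Even m ∧ m ≠ 0 then freeEnergySum w₀ w₁ (m + 1) z else 0

/-- The derivative of `evenSeries`. -/
def evenSeriesDeriv (w₀ w₁ z : ℂ) : PowerSeries ℂ :=
  mk fun m => if Even m then freeEnergyDeriv (Lam w₀ w₁) m z else 0

/-- The series `P_odd / P_odd,₀`. -/
def poddSeries (w₀ w₁ z : ℂ) : PowerSeries ℂ := mk fun n => Podd w₀ w₁ n z / Podd w₀ w₁ 0 z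

theorem constantCoeff_evenSeries (w₀ w₁ z : ℂ) : constantCoeff (evenSeries w₀ w₁ z) = 0 := by
  simp [evenSeries]

theorem hasCoeffDeriv_evenSeries {z : ℂ} (hz : z ≠ 0) :
    HasCoeffDeriv (evenSeries w₀ w₁) (evenSeriesDeriv w₀ w₁ z) z := by
  intro m
  simp only [evenSeries, evenSeriesDeriv, coeff_mk]
  rcases Nat.eq_zero_or_pos m with rfl | hm
  · simp only [ne_eq, not_true_eq_false, and_false, if_false, freeEnergyDeriv_zero, ite_self]
    exact hasDerivAt_const z 0
  · simp only [Nat.pos_iff_ne_zero.mp hm, ne_eq, not_false_eq_true, and_true]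
    split_ifs
    · exact hasDerivAt_freeEnergySum w₀ w₁ hm hz
    · exact hasDerivAt_const z 0

theorem tendstoCoeff_evenSeries (w₀ w₁ : ℂ) :
    TendstoCoeff (evenSeries w₀ w₁) (Bornology.cobounded ℂ) 0 := by
  intro m
  simp only [evenSeries, coeff_mk, map_zero]
  split_ifs with h
  · exact tendsto_freeEnergySum w₀ w₁ (Nat.pos_iff_ne_zero.mpr h.2)
  · exact tendsto_const_nhds

theorem Podd_zero_ne_zero {z : ℂ} (hz : z ∈ puncturedCurve w₀ w₁) : Podd w₀ w₁ 0 z ≠ 0 := by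
  rw [Podd_zero]
  exact div_ne_zero hz.1 hz.2

theorem coeff_zero_poddSeries {z : ℂ} (hz : z ∈ puncturedCurve w₀ w₁) :
    coeff 0 (poddSeries w₀ w₁ z) = 1 := by
  rw [poddSeries, coeff_mk, div_self (Podd_zero_ne_zero hz)]

theorem coeff_succ_poddSeries (m : ℕ) {z : ℂ} (hz : z ∈ puncturedCurve w₀ w₁) :
    coeff (m + 1) (poddSeries w₀ w₁ z) =
      if Odd m then 2 * kappa (Lam w₀ w₁) z * freeEnergyDeriv (Lam w₀ w₁) m z else 0 := by
  obtain ⟨hz0, hzX⟩ := hz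
  rw [poddSeries, coeff_mk, Podd_succ m ⟨hz0, hzX⟩, Podd_zero]
  have hX : curveX w₀ w₁ z = z ^ 2 - Lam w₀ w₁ := rfl
  split_ifs
  · rw [kappa, div_div_eq_mul_div, hX]
    field_simp
    ring
  · rw [zero_div]

theorem tendsto_kappa (c : ℂ) : Tendsto (kappa c) (Bornology.cobounded ℂ) (𝓝 (1 / 4)) := by
  have h : Tendsto (fun z : ℂ => (z ^ 2)⁻¹) (Bornology.cobounded ℂ) (𝓝 0) :=
    tendsto_inv₀_cobounded.comp (tendsto_pow_cobounded_cobounded two_ne_zero)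
  have h' := ((h.const_mul c).const_sub 1).div_const 4
  rwa [mul_zero, sub_zero] at h'

theorem hasDerivAt_kappa (c : ℂ) {z : ℂ} (hz : z ≠ 0) :
    HasDerivAt (kappa c) (c / (2 * z ^ 3)) z := by
  refine (((((hasDerivAt_pow 2 z).inv (pow_ne_zero 2 hz)).const_mul c).const_sub 1).div_const
    4).congr_deriv ?_
  push_cast
  field_simp
  ring

theorem tendsto_freeEnergyDeriv (c : ℂ) (m : ℕ) :
    Tendsto (freeEnergyDeriv c m) (Bornology.cobounded ℂ) (𝓝 0) := by
  obtain ⟨M, hM⟩ := exists_bound_vars (fockEnergy c m)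
  have e : freeEnergyDeriv c m = fun z => ∑ j ∈ range M,
      (z ^ (2 * j + 2))⁻¹ * MvPolynomial.eval (tauVec z) (MvPolynomial.pderiv j (fockEnergy c m)) :=
    funext fun z => eval_vecDer _ _ hM
  rw [e, ← sum_const_zero (s := range M)]
  refine tendsto_finsetSum _ fun j _ => ?_
  have h : Tendsto (fun z : ℂ => (z ^ (2 * j + 2))⁻¹) (Bornology.cobounded ℂ) (𝓝 0) :=
    tendsto_inv₀_cobounded.comp (tendsto_pow_cobounded_cobounded (Nat.succ_ne_zero _))
  simpa using h.mul (tendsto_eval_tauVec _)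

theorem tendstoCoeff_poddSeries (w₀ w₁ : ℂ) :
    TendstoCoeff (poddSeries w₀ w₁) (Bornology.cobounded ℂ) 1 := by
  intro n
  rcases n with _ | m
  · refine Tendsto.congr' ?_ tendsto_const_nhds
    filter_upwards [eventually_mem_puncturedCurve w₀ w₁] with z hz
    rw [coeff_zero_poddSeries hz, coeff_zero_one]
  · rw [coeff_one, if_neg (Nat.succ_ne_zero m)]
    have h : Tendsto (fun z => if Odd m then
        2 * kappa (Lam w₀ w₁) z * freeEnergyDeriv (Lam w₀ w₁) m z else 0)
        (Bornology.cobounded ℂ) (𝓝 0) := by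
      split_ifs
      · simpa using ((tendsto_kappa (Lam w₀ w₁)).const_mul 2).mul
          (tendsto_freeEnergyDeriv (Lam w₀ w₁) m)
      · exact tendsto_const_nhds
    refine h.congr' ?_
    filter_upwards [eventually_mem_puncturedCurve w₀ w₁] with z hz
    exact (coeff_succ_poddSeries m hz).symm

theorem sum_antidiagonal_odd {m : ℕ} (hm : Odd m) (W : ℕ → ℂ) :
    ∑ ij ∈ antidiagonal m, W ij.1 * W ij.2 =
      2 * ∑ ij ∈ antidiagonal m, if Odd ij.1 then W ij.1 * W ij.2 else 0 := by
  have h : (∑ ij ∈ antidiagonal m, if Odd ij.1 then W ij.1 * W ij.2 else 0) =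
      ∑ ij ∈ antidiagonal m, if Odd ij.2 then W ij.1 * W ij.2 else 0 := by
    rw [← Nat.sum_antidiagonal_swap]
    exact sum_congr rfl fun p _ => by simp only [Prod.fst_swap, Prod.snd_swap, mul_comm]
  rw [two_mul]
  nth_rewrite 2 [h]
  rw [← sum_add_distrib]
  refine sum_congr rfl fun p hp => ?_
  rw [← HasAntidiagonal.mem_antidiagonal.mp hp, Nat.odd_add] at hm
  by_cases h1 : Odd p.1
  · rw [if_pos h1, if_neg (Nat.not_odd_iff_even.mpr (hm.mp h1)), add_zero]
  · rw [if_neg h1, if_pos (Nat.not_even_iff_odd.mp fun h2 => h1 (hm.mpr h2)), zero_add]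

/-- This is the classical identity P_even = -½ d log P_odd/dx, read order by order. For m odd it is
the formula for (κ W_m)', where exactly one index of each product W_i W_j is odd. -/
theorem hasCoeffDeriv_poddSeries {z : ℂ} (hz : z ∈ puncturedCurve w₀ w₁) :
    HasCoeffDeriv (poddSeries w₀ w₁)
      (poddSeries w₀ w₁ z * (PowerSeries.C (-2) * evenSeriesDeriv w₀ w₁ z)) z := by
  have hz0 := hz.1
  have hnhds := (isOpen_puncturedCurve w₀ w₁).mem_nhds hz
  set W := freeEnergyDeriv (Lam w₀ w₁) with hW
  have hE : ∀ j, coeff j (PowerSeries.C (-2) * evenSeriesDeriv w₀ w₁ z) =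
      if Even j then -2 * W j z else 0 := fun j => by
    rw [coeff_C_mul, evenSeriesDeriv, coeff_mk, mul_ite, mul_zero]
  intro n
  rw [coeff_mul]
  rcases n with _ | m
  · rw [Nat.antidiagonal_zero, sum_singleton, hE, if_pos (by decide), hW, freeEnergyDeriv_zero,
      mul_zero, mul_zero]
    refine (hasDerivAt_const z (1 : ℂ)).congr_of_eventuallyEq ?_
    filter_upwards [hnhds] with u hu
    exact coeff_zero_poddSeries hu
  · rw [Nat.sum_antidiagonal_succ, coeff_zero_poddSeries hz, one_mul, hE]
    have e1 : ∀ p ∈ antidiagonal m, coeff (p.1 + 1) (poddSeries w₀ w₁ z) *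
        coeff p.2 (PowerSeries.C (-2) * evenSeriesDeriv w₀ w₁ z) =
        if Odd m then -4 * kappa (Lam w₀ w₁) z * (if Odd p.1 then W p.1 z * W p.2 z else 0)
          else 0 := by
      intro p hp
      have hp' := HasAntidiagonal.mem_antidiagonal.mp hp
      rw [coeff_succ_poddSeries _ hz, hE, ← hp']
      by_cases h1 : Odd p.1 <;> by_cases h2 : Even p.2
      · rw [if_pos h1, if_pos h2, if_pos (h1.add_even h2), if_pos h1]; ring
      · rw [if_pos h1, if_neg h2, if_neg, mul_zero]
        exact Nat.not_odd_iff_even.mpr (h1.add_odd (Nat.not_even_iff_odd.mp h2))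
      · rw [if_neg h1, if_neg h1, mul_zero, ite_self, zero_mul]
      · rw [if_neg h1, if_neg h1, mul_zero, ite_self, zero_mul]
    rw [sum_congr rfl e1]
    have he : (fun u => coeff (m + 1) (poddSeries w₀ w₁ u)) =ᶠ[𝓝 z]
        fun u => if Odd m then 2 * kappa (Lam w₀ w₁) u * W m u else 0 := by
      filter_upwards [hnhds] with u hu
      exact coeff_succ_poddSeries m hu
    refine HasDerivAt.congr_of_eventuallyEq ?_ he
    by_cases hm : Odd m
    · simp only [if_pos hm, if_pos hm.add_one, ← mul_sum]
      refine (((hasDerivAt_kappa (Lam w₀ w₁) hz0).const_mul 2).mul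
        (differentiableAt_freeEnergyDeriv (Lam w₀ w₁) m hz0).hasDerivAt).congr_deriv ?_
      have hs := sum_antidiagonal_odd hm fun i => W i z
      rw [hW, freeEnergyDeriv_succ _ hz0 hm.pos, ← hW, hs]
      ring
    · have hm' : ¬ Even (m + 1) := Nat.not_even_iff_odd.mpr (Nat.not_odd_iff_even.mp hm).add_one
      simp only [if_neg hm, if_neg hm', sum_const_zero, add_zero]
      exact hasDerivAt_const z 0

/-- The punctured curve is connected and reaches infinity, where both sides tend to 1; this fixes
the constant of integration of the common linear equation. -/
theorem poddSeries_eq_expOf {z : ℂ} (hz : z ∈ puncturedCurve w₀ w₁) :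
    poddSeries w₀ w₁ z = expOf (PowerSeries.C (-2) * evenSeries w₀ w₁ z) := by
  have hinf : Bornology.cobounded ℂ ⊓ 𝓟 (puncturedCurve w₀ w₁) = Bornology.cobounded ℂ :=
    inf_eq_left.mpr (le_principal_iff.mpr (eventually_mem_puncturedCurve w₀ w₁))
  refine eqOn_expOf_of_hasCoeffDeriv (isOpen_puncturedCurve w₀ w₁)
    (isPreconnected_puncturedCurve w₀ w₁) (by rw [hinf]; infer_instance)
    (a' := fun z => PowerSeries.C (-2) * evenSeriesDeriv w₀ w₁ z) (p := poddSeries w₀ w₁)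
    (a := fun z => PowerSeries.C (-2) * evenSeries w₀ w₁ z)
    (fun z => by rw [map_mul, constantCoeff_evenSeries, mul_zero]) (fun z hz n => ?_)
    (fun z hz => hasCoeffDeriv_poddSeries hz) (fun n => ?_) ?_ hz
  · simp only [coeff_C_mul]
    exact (hasCoeffDeriv_evenSeries hz.1 n).const_mul _
  · rw [hinf]
    simpa [coeff_C_mul] using (tendstoCoeff_evenSeries w₀ w₁ n).const_mul (-2)
  · rw [hinf]
    exact tendstoCoeff_poddSeries w₀ w₁

theorem neg_half_mul_logOf_poddSeries {z : ℂ} (hz : z ∈ puncturedCurve w₀ w₁) :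
    PowerSeries.C (-(1 / 2 : ℂ)) * logOf (poddSeries w₀ w₁ z) = evenSeries w₀ w₁ z := by
  rw [poddSeries_eq_expOf hz, logOf_expOf
    (by rw [map_mul, constantCoeff_evenSeries, mul_zero]), ← mul_assoc, ← map_mul]
  norm_num

variable {V : Set ℂ}

theorem TurningPointPaths.integral_eq (γ : TurningPointPaths w₀ w₁ V) {z : ℂ} (hz : z ∈ V)
    {G g : ℂ → ℂ} (hG : ∀ u ∈ puncturedCurve w₀ w₁, HasDerivAt G (g u) u)
    (hg : ContinuousOn g (puncturedCurve w₀ w₁)) :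
    ∫ t in (0 : ℝ)..1, g (γ.path z t) * γ.velocity z t = G z - G (-z) := by
  have hp : ContinuousOn (γ.path z) (Set.Icc 0 1) :=
    fun t ht => (γ.hasDeriv z hz t ht).continuousWithinAt
  have hv : ContinuousOn (γ.velocity z) (Set.Icc 0 1) :=
    γ.continuousOn_velocity.comp (f := fun t => (z, t)) (by fun_prop) fun t ht => ⟨hz, ht⟩
  have hgp : ContinuousOn (fun t => g (γ.path z t)) (Set.Icc 0 1) :=
    hg.comp hp fun t ht => γ.mem_punctured z hz t ht
  have hGp : ContinuousOn (fun t => G (γ.path z t)) (Set.Icc 0 1) := fun t ht =>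
    (hG _ (γ.mem_punctured z hz t ht)).continuousAt.comp_continuousWithinAt (hp t ht)
  have h := intervalIntegral.integral_eq_sub_of_hasDerivAt_of_le (f := fun t => G (γ.path z t))
    (f' := fun t => g (γ.path z t) * γ.velocity z t) zero_le_one hGp (fun t ht => ?_)
    ((hgp.mul hv).intervalIntegrable_of_Icc zero_le_one)
  · rw [h, γ.source z hz, γ.target z hz]
  · have ht' := Set.Ioo_subset_Icc_self ht
    have h1 := (γ.hasDeriv z hz t ht').hasDerivAt (Icc_mem_nhds ht.1 ht.2)
    have h2 := (hG _ (γ.mem_punctured z hz t ht')).scomp t h1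
    refine h2.congr_deriv ?_
    rw [smul_eq_mul, mul_comm]

/-- For odd m the primitive f_m is single-valued on the punctured curve, so only the end points of
the path matter. Being odd, it equals half its difference between z and -z: normalization at the
turning point and at infinity agree. -/
theorem turningPointIntegral_Podd (γ : TurningPointPaths w₀ w₁ V) (hV : V ⊆ puncturedCurve w₀ w₁)
    {z : ℂ} (hz : z ∈ V) (m : ℕ) :
    turningPointIntegral γ (Podd w₀ w₁ (m + 1)) z =
      if Odd m then freeEnergySum w₀ w₁ (m + 1) z else 0 := by
  have hz0 := (hV hz).1
  have e : Set.EqOn (fun t => Podd w₀ w₁ (m + 1) (γ.path z t) *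
      deriv (curveX w₀ w₁) (γ.path z t) * γ.velocity z t)
      (fun t => if Odd m then freeEnergyDeriv (Lam w₀ w₁) m (γ.path z t) * γ.velocity z t else 0)
      (Set.uIcc 0 1) := by
    intro t ht
    rw [Set.uIcc_of_le zero_le_one] at ht
    have hγ := γ.mem_punctured z hz t ht
    have hγ0 := hγ.1
    simp only
    rw [Podd_succ m hγ, deriv_curveX]
    split_ifs
    · field_simp
    · rw [zero_mul, zero_mul]
  rw [turningPointIntegral, intervalIntegral.integral_congr e]
  split_ifs with hm
  · rw [γ.integral_eq hz (G := freeEnergySum w₀ w₁ (m + 1))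
      (fun u hu => hasDerivAt_freeEnergySum w₀ w₁ hm.pos hu.1)
      (fun u hu => (differentiableAt_freeEnergyDeriv _ m
        hu.1).continuousAt.continuousWithinAt), freeEnergySum_neg w₀ w₁ hm.pos hz0,
      hm.neg_one_pow]
    ring
  · simp

theorem expSeries_eq (a : ℕ → ℂ) :
    expSeries a = expOf (PowerSeries.mk fun m => if m = 0 then 0 else a m) := rfl

/-- The even orders come from 1/√P_odd, the odd ones from the exponential with the sign ε. By the
parity of f_m both are f_m(εz). -/
theorem wkbSolution_amp (hV : V ⊆ puncturedCurve w₀ w₁) (L r : ℂ → ℂ)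
    (γ : TurningPointPaths w₀ w₁ V) {ε : ℂ} (hε : ε = 1 ∨ ε = -1) {z : ℂ} (hz : z ∈ V) :
    (wkbSolution w₀ w₁ L r γ ε).amp z =
      PowerSeries.C (Complex.exp (-(1 / 2) * L z) * (r z)⁻¹) *
        expSeries fun m => freeEnergySum w₀ w₁ (m + 1) (ε * z) := by
  have hz' := hV hz
  have h1 : turningPointIntegral γ (Podd w₀ w₁ 1) z = 0 := by
    rw [turningPointIntegral_Podd γ hV hz 0, if_neg (by decide)]
  have h2 : (PowerSeries.exp ℂ).subst (PowerSeries.C (-(1 / 2 : ℂ)) *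
      logOf (PowerSeries.mk fun n => Podd w₀ w₁ n z / Podd w₀ w₁ 0 z)) =
      expOf (evenSeries w₀ w₁ z) := by
    rw [← neg_half_mul_logOf_poddSeries hz']
    rfl
  simp only [wkbSolution]
  rw [h2, h1, mul_zero, Complex.exp_zero, map_one, one_mul, map_mul, expSeries_eq, expSeries_eq,
    mul_assoc, mul_assoc, ← expOf_add (constantCoeff_evenSeries _ _ _)
      (by rw [← coeff_zero_eq_constantCoeff_apply, coeff_mk, if_pos rfl]), mul_assoc]
  congr 3
  ext m
  rw [map_add, evenSeries, coeff_mk, coeff_mk, coeff_mk, turningPointIntegral_Podd γ hV hz]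
  rcases Nat.eq_zero_or_pos m with rfl | hm
  · simp
  · have hm0 := Nat.pos_iff_ne_zero.mp hm
    have key : freeEnergySum w₀ w₁ (m + 1) (ε * z) =
        (if Even m then 1 else ε) * freeEnergySum w₀ w₁ (m + 1) z := by
      rcases hε with rfl | rfl
      · simp
      · rw [neg_one_mul, freeEnergySum_neg w₀ w₁ hm hz'.1]
        split_ifs with h
        · rw [h.neg_one_pow]
        · rw [(Nat.not_even_iff_odd.mp h).neg_one_pow]
    rw [if_neg hm0, if_neg hm0, key]
    by_cases h : Even m
    · rw [if_pos ⟨h, hm0⟩, if_neg (Nat.not_odd_iff_even.mpr h), if_pos h]; ring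
    · rw [if_neg fun h' => h h'.1, if_pos (Nat.not_even_iff_odd.mp h), if_neg h]; ring

end Amplitude
end EquivariantCP1

end

/-! ### The two unstable orders: phase and prefactor -/

noncomputable section

namespace EquivariantCP1

section Phase

open Filter Topology MeasureTheory

/-! ### The phase of the WKB solution and the regularized free energies -/

/-- A continuous logarithm of a differentiable function is differentiable. -/
theorem hasDerivAt_of_exp_eq {V : Set ℂ} (hV : IsOpen V) {ℓ g : ℂ → ℂ} (hℓ : ContinuousOn ℓ V)
    (h : ∀ z ∈ V, Complex.exp (ℓ z) = g z) {z g' : ℂ} (hz : z ∈ V) (hg : HasDerivAt g g' z) :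
    HasDerivAt ℓ (g' / g z) z := by
  have hgz : g z ≠ 0 := by rw [← h z hz]; exact Complex.exp_ne_zero _
  -- Near z the continuous logarithm differs from ℓ(z) by a principal logarithm, since by continuity
  -- ℓ(u) - ℓ(z) has imaginary part below π in absolute value.
  have h1 : HasDerivAt (fun u => ℓ z + Complex.log (g u / g z)) (g' / g z) z := by
    have h2 := (hg.div_const (g z)).clog (by rw [div_self hgz]; exact Complex.one_mem_slitPlane)
    refine (h2.const_add (ℓ z)).congr_deriv ?_
    rw [div_self hgz, div_one]
  refine h1.congr_of_eventuallyEq ?_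
  have hcont : ContinuousAt (fun u => ℓ u - ℓ z) z :=
    (hℓ.continuousAt (hV.mem_nhds hz)).sub continuousAt_const
  have hsmall : ∀ᶠ u in 𝓝 z, ‖ℓ u - ℓ z‖ < Real.pi := by
    refine hcont.norm.eventually_lt_const ?_
    simpa using Real.pi_pos
  filter_upwards [hsmall, hV.mem_nhds hz] with u hu huV
  have him := (Complex.abs_im_le_norm (ℓ u - ℓ z)).trans_lt hu
  rw [← h u huV, ← h z hz, ← Complex.exp_sub,
    Complex.log_exp (abs_lt.mp him).1 (abs_lt.mp him).2.le]
  ring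

/-- The exponential of `∫ dζ / (ζ - b)` along a path. -/
theorem exp_integral_div {p v : ℝ → ℂ} {b : ℂ}
    (hp : ∀ t ∈ Set.Icc (0 : ℝ) 1, HasDerivWithinAt p (v t) (Set.Icc 0 1) t)
    (hv : ContinuousOn v (Set.Icc 0 1)) (hb : ∀ t ∈ Set.Icc (0 : ℝ) 1, p t ≠ b) :
    Complex.exp (∫ t in (0 : ℝ)..1, v t / (p t - b)) = (p 1 - b) / (p 0 - b) := by
  have hpc : ContinuousOn p (Set.Icc 0 1) := fun t ht => (hp t ht).continuousWithinAt
  have hne : ∀ t ∈ Set.Icc (0 : ℝ) 1, p t - b ≠ 0 := fun t ht => sub_ne_zero.mpr (hb t ht)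
  have hg : ContinuousOn (fun t => v t / (p t - b)) (Set.Icc 0 1) :=
    hv.div (hpc.sub continuousOn_const) hne
  -- The integrand is controlled only on [0, 1]. Its constant extension is continuous on ℝ and has a
  -- primitive Φ, for which (p - b) exp(-Φ) is constant on [0, 1].
  set G : ℝ → ℂ := Set.IccExtend (zero_le_one' ℝ)
    (Set.domRestrict (Set.Icc (0 : ℝ) 1) fun t => v t / (p t - b)) with hG
  have hGc : Continuous G := (continuousOn_iff_continuous_domRestrict.mp hg).Icc_extend'
  have hGe : ∀ t ∈ Set.Icc (0 : ℝ) 1, G t = v t / (p t - b) := fun t ht => by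
    rw [hG, Set.IccExtend_of_mem _ _ ht]
    rfl
  set Φ : ℝ → ℂ := fun t => ∫ s in (0 : ℝ)..t, G s with hΦ
  have hΦd : ∀ t, HasDerivAt Φ (G t) t := fun t => (hGc.integral_hasStrictDerivAt 0 t).hasDerivAt
  have hd : ∀ t ∈ Set.Icc (0 : ℝ) 1, HasDerivWithinAt
      (fun t => (p t - b) * Complex.exp (-Φ t)) 0 (Set.Icc 0 1) t := by
    intro t ht
    have h1 := ((hp t ht).sub_const b).mul ((hΦd t).neg.cexp.hasDerivWithinAt (s := Set.Icc 0 1))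
    refine h1.congr_deriv ?_
    rw [hGe t ht]
    have := hne t ht
    field_simp
    ring
  have hconst := constant_of_has_deriv_right_zero (a := (0 : ℝ)) (b := 1)
    (fun t ht => (hd t ht).continuousWithinAt)
    (fun t ht => (hd t (Set.Ico_subset_Icc_self ht)).mono_of_mem_nhdsWithin
      (Icc_mem_nhdsGE_of_mem ht)) 1 ⟨zero_le_one, le_rfl⟩
  have h0 : Φ 0 = 0 := intervalIntegral.integral_same
  have h1 : Φ 1 = ∫ t in (0 : ℝ)..1, v t / (p t - b) :=
    intervalIntegral.integral_congr fun t ht => hGe t (by rwa [Set.uIcc_of_le zero_le_one] at ht)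
  rw [h0, neg_zero, Complex.exp_zero, mul_one, Complex.exp_neg] at hconst
  rw [← h1, ← hconst]
  have h2 := hne 1 ⟨zero_le_one, le_rfl⟩
  have h3 := Complex.exp_ne_zero (Φ 1)
  field_simp

theorem continuousOn_inv_sub {s : Set ℂ} {b : ℂ} (hb : ∀ u ∈ s, u ≠ b) :
    ContinuousOn (fun u => (u - b)⁻¹) s :=
  ContinuousOn.inv₀ (by fun_prop) fun u hu => sub_ne_zero.mpr (hb u hu)

variable {w₀ w₁ : ℂ} {V : Set ℂ}

theorem TurningPointPaths.continuousOn_integral (γ : TurningPointPaths w₀ w₁ V) {g : ℂ → ℂ}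
    (hg : ContinuousOn g (puncturedCurve w₀ w₁)) :
    ContinuousOn (fun z => ∫ t in (0 : ℝ)..1, g (γ.path z t) * γ.velocity z t) V := by
  have hF : ContinuousOn (fun p : ℂ × ℝ => g (γ.path p.1 p.2) * γ.velocity p.1 p.2)
      (V ×ˢ Set.Icc 0 1) :=
    (hg.comp γ.continuousOn_path fun p hp => γ.mem_punctured p.1 hp.1 p.2 hp.2).mul
      γ.continuousOn_velocity
  rw [continuousOn_iff_continuous_domRestrict]
  set f : V → ℝ → ℂ := fun z t => g (γ.path z (Set.projIcc 0 1 zero_le_one t)) *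
    γ.velocity z (Set.projIcc (0 : ℝ) 1 zero_le_one t) with hf
  have hfc : Continuous (Function.uncurry f) :=
    hF.comp_continuous (f := fun q : V × ℝ =>
      ((q.1 : ℂ), ((Set.projIcc (0 : ℝ) 1 zero_le_one q.2 : Set.Icc (0 : ℝ) 1) : ℝ)))
      (by fun_prop) fun q => ⟨q.1.2, (Set.projIcc (0 : ℝ) 1 zero_le_one q.2).2⟩
  have h := intervalIntegral.continuous_parametric_intervalIntegral_of_continuous' (μ := volume)
    hfc 0 1
  refine h.congr fun z => intervalIntegral.integral_congr fun t ht => ?_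
  rw [Set.uIcc_of_le zero_le_one] at ht
  simp only [hf]
  rw [Set.projIcc_of_mem zero_le_one ht]

/-- The integral `∫ dζ / (ζ - b)` along the path with index `z`. -/
def TurningPointPaths.logIntegral (γ : TurningPointPaths w₀ w₁ V) (b z : ℂ) : ℂ :=
  ∫ t in (0 : ℝ)..1, (γ.path z t - b)⁻¹ * γ.velocity z t

theorem TurningPointPaths.continuousOn_velocity_right (γ : TurningPointPaths w₀ w₁ V) {z : ℂ}
    (hz : z ∈ V) : ContinuousOn (γ.velocity z) (Set.Icc 0 1) :=
  γ.continuousOn_velocity.comp (f := fun t => (z, t)) (by fun_prop) fun _ ht => ⟨hz, ht⟩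

/-- The integral depends on the homotopy class of the path, but its exponential is (z - b)/(-z - b).
Continuity of the family of paths makes it a continuous logarithm of this function, hence
differentiable. -/
theorem TurningPointPaths.hasDerivAt_logIntegral (γ : TurningPointPaths w₀ w₁ V) (hVo : IsOpen V)
    {b z : ℂ} (hb : ∀ u ∈ puncturedCurve w₀ w₁, u ≠ b) (hb' : ∀ u ∈ puncturedCurve w₀ w₁, -u ≠ b)
    (hV : V ⊆ puncturedCurve w₀ w₁) (hz : z ∈ V) :
    HasDerivAt (γ.logIntegral b) ((z - b)⁻¹ - (z + b)⁻¹) z := by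
  have hc : ContinuousOn (γ.logIntegral b) V := γ.continuousOn_integral
    (g := fun u => (u - b)⁻¹) (continuousOn_inv_sub hb)
  have he : ∀ z ∈ V, Complex.exp (γ.logIntegral b z) = (z - b) / (-z - b) := fun z hz => by
    have h := exp_integral_div (b := b) (γ.hasDeriv z hz) (γ.continuousOn_velocity_right hz)
      fun t ht => hb _ (γ.mem_punctured z hz t ht)
    rw [γ.source z hz, γ.target z hz] at h
    rw [← h, TurningPointPaths.logIntegral]
    simp only [div_eq_inv_mul]
  have h1 : z - b ≠ 0 := sub_ne_zero.mpr (hb z (hV hz))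
  have h2 : -z - b ≠ 0 := sub_ne_zero.mpr (hb' z (hV hz))
  have h3 : z + b ≠ 0 := fun h => h2 (by linear_combination -h)
  have hd : HasDerivAt (fun z => (z - b) / (-z - b)) ((1 * (-z - b) - (z - b) * -1) / (-z - b) ^ 2)
      z := ((hasDerivAt_id z).sub_const b).div ((hasDerivAt_neg z).sub_const b) h2
  refine (hasDerivAt_of_exp_eq hVo hc he hz hd).congr_deriv ?_
  rw [show -z - b = -(z + b) by ring]
  field_simp
  ring

/-- With a = (w₀ - w₁)/2, P_odd,₀ dx = (2 + a/(ζ - a) - a/(ζ + a)) dζ. The residues at x = 0 in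
general prevent a single-valued primitive on the punctured curve, so the logarithmic parts are
treated by `logIntegral`. -/
theorem hasDerivAt_turningPointIntegral_zero (γ : TurningPointPaths w₀ w₁ V) (hVo : IsOpen V)
    (hV : V ⊆ puncturedCurve w₀ w₁) {z : ℂ} (hz : z ∈ V) :
    HasDerivAt (turningPointIntegral γ (Podd w₀ w₁ 0)) (2 * z ^ 2 / curveX w₀ w₁ z) z := by
  set a := (w₀ - w₁) / 2 with ha
  have hX : ∀ u, curveX w₀ w₁ u = (u - a) * (u + a) := fun u => by
    rw [curveX, Lam, ha]; ring
  have hne : ∀ u ∈ puncturedCurve w₀ w₁, u - a ≠ 0 ∧ u + a ≠ 0 := fun u hu => by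
    have h := hu.2
    rw [hX] at h
    exact ⟨left_ne_zero_of_mul h, right_ne_zero_of_mul h⟩
  have hna : ∀ u ∈ puncturedCurve w₀ w₁, u ≠ a := fun u hu => sub_ne_zero.mp (hne u hu).1
  have hna' : ∀ u ∈ puncturedCurve w₀ w₁, u ≠ -a := fun u hu h =>
    (hne u hu).2 (by linear_combination h)
  have e : ∀ u ∈ V, turningPointIntegral γ (Podd w₀ w₁ 0) u =
      1 / 2 * (4 * u + a * (γ.logIntegral a u - γ.logIntegral (-a) u)) := by
    intro u hu
    have hint : ∀ g : ℂ → ℂ, ContinuousOn g (puncturedCurve w₀ w₁) →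
        IntervalIntegrable (fun t => g (γ.path u t) * γ.velocity u t) volume 0 1 := fun g hg =>
      ((hg.comp (fun t ht => (γ.hasDeriv u hu t ht).continuousWithinAt)
        fun t ht => γ.mem_punctured u hu t ht).mul
          (γ.continuousOn_velocity_right hu)).intervalIntegrable_of_Icc zero_le_one
    have h1 := hint (fun _ => 2) continuousOn_const
    have h2 := (hint (fun u => (u - a)⁻¹) (continuousOn_inv_sub hna)).const_mul a
    have h3 := (hint (fun u => (u - -a)⁻¹) (continuousOn_inv_sub hna')).const_mul a
    have h4 : ∫ t in (0 : ℝ)..1, 2 * γ.velocity u t = 2 * u - 2 * -u :=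
      γ.integral_eq hu (G := fun u => 2 * u) (g := fun _ => 2)
        (fun u _ => by simpa using (hasDerivAt_id u).const_mul 2) continuousOn_const
    have h5 : Set.EqOn (fun t => Podd w₀ w₁ 0 (γ.path u t) * deriv (curveX w₀ w₁) (γ.path u t) *
        γ.velocity u t) (fun t => 2 * γ.velocity u t + a * ((γ.path u t - a)⁻¹ * γ.velocity u t) -
          a * ((γ.path u t - -a)⁻¹ * γ.velocity u t)) (Set.uIcc 0 1) := by
      intro t ht
      rw [Set.uIcc_of_le zero_le_one] at ht
      obtain ⟨h6, h7⟩ := hne _ (γ.mem_punctured u hu t ht)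
      simp only
      rw [Podd_zero, deriv_curveX, hX, sub_neg_eq_add]
      field_simp
      ring
    rw [turningPointIntegral, intervalIntegral.integral_congr h5,
      intervalIntegral.integral_sub (h1.add h2) h3, intervalIntegral.integral_add h1 h2, h4,
      intervalIntegral.integral_const_mul, intervalIntegral.integral_const_mul]
    simp only [TurningPointPaths.logIntegral]
    ring
  have hd1 := γ.hasDerivAt_logIntegral hVo (b := a) hna
    (fun u hu h => (hne u hu).2 (by linear_combination -h)) hV hz
  have hd2 := γ.hasDerivAt_logIntegral hVo (b := -a) hna'
    (fun u hu h => (hne u hu).1 (by linear_combination -h)) hV hz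
  refine HasDerivAt.congr_of_eventuallyEq ?_ (by filter_upwards [hVo.mem_nhds hz] with u hu using e u hu)
  refine ((((hasDerivAt_id z).const_mul 4).add ((hd1.sub hd2).const_mul a)).const_mul
    (1 / 2)).congr_deriv ?_
  obtain ⟨h6, h7⟩ := hne z (hV hz)
  rw [hX, sub_neg_eq_add, ← sub_eq_add_neg]
  field_simp
  ring

theorem hasDerivAt_wkbSolution_phase (hVo : IsOpen V) (hV : V ⊆ puncturedCurve w₀ w₁) {L : ℂ → ℂ}
    (hLc : ContinuousOn L V) (hL : ∀ z ∈ V, Complex.exp (L z) = curveX w₀ w₁ z) (r : ℂ → ℂ)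
    (γ : TurningPointPaths w₀ w₁ V) {ε : ℂ} (hε : ε * ε = 1) {z : ℂ} (hz : z ∈ V) :
    HasDerivAt (wkbSolution w₀ w₁ L r γ ε).phase (ε * omegaForm w₀ w₁ (ε * z)) z := by
  have h1 := hasDerivAt_of_exp_eq hVo hLc hL hz (hasDerivAt_curveX w₀ w₁ z)
  refine ((h1.const_mul ((w₀ + w₁) / 2)).add
    ((hasDerivAt_turningPointIntegral_zero γ hVo hV hz).const_mul ε)).congr_deriv ?_
  have hX : curveX w₀ w₁ (ε * z) = curveX w₀ w₁ z := by
    rw [curveX, curveX, mul_pow, pow_two ε, hε, one_mul]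
  have hX0 := (hV hz).2
  rw [omegaForm, deriv_curveX, hX, curveY]
  field_simp
  linear_combination -(2 * ε * z ^ 2 + z * (w₀ + w₁)) * hε

theorem integral_omegaHat2 {u : ℂ} (hu : u ≠ 0) :
    ∫ s in Set.Ioi (1 : ℝ), omegaHat2 u (s * u) * -u = -(1 / (2 * u)) := by
  have h : ∫ s in Set.Ioi (1 : ℝ), ((1 + s) ^ 2)⁻¹ = 1 / 2 := by
    have hd : ∀ s ∈ Set.Ici (1 : ℝ), HasDerivAt (fun s : ℝ => -(1 + s)⁻¹) ((1 + s) ^ 2)⁻¹ s := by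
      intro s hs
      have hs' : (1 : ℝ) + s ≠ 0 := by
        have : (1 : ℝ) ≤ s := hs
        positivity
      refine (((hasDerivAt_id s).const_add 1).inv hs').neg.congr_deriv ?_
      simp [neg_div]
    have ht : Tendsto (fun s : ℝ => -(1 + s)⁻¹) atTop (𝓝 0) := by
      have := (tendsto_inv_atTop_zero.comp (tendsto_atTop_add_const_left atTop (1 : ℝ)
        tendsto_id)).neg
      rwa [neg_zero] at this
    rw [integral_Ioi_of_hasDerivAt_of_nonneg' hd (fun s _ => by positivity) ht]
    norm_num
  have e : Set.EqOn (fun s : ℝ => omegaHat2 u (s * u) * -u)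
      (fun s : ℝ => -u⁻¹ * (((((1 + s) ^ 2)⁻¹ : ℝ)) : ℂ)) (Set.Ioi 1) := by
    intro s hs
    have hs' : (1 : ℂ) + s ≠ 0 := by
      have : (1 : ℝ) + s ≠ 0 := by
        have : (1 : ℝ) < s := hs
        positivity
      exact_mod_cast this
    simp only [omegaHat2]
    push_cast
    rw [show u + s * u = (1 + s) * u by ring]
    field_simp
  rw [setIntegral_congr_fun measurableSet_Ioi e, integral_const_mul, integral_complex_ofReal, h]
  push_cast
  field_simp

end Phase
end EquivariantCP1

end

noncomputable section

namespace EquivariantCP1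

section Regularization

open Filter Topology

/-! ### Comparison of the prefactor with the regularized free energies -/

variable {w₀ w₁ : ℂ} {V : Set ℂ} {L r : ℂ → ℂ}

/-- The prefactor is a branch of z^(-1/2). Its square suffices both for the decay and for the
logarithmic derivative, and needs no choice of branch. -/
theorem prefactor_sq (hV : V ⊆ puncturedCurve w₀ w₁)
    (hL : ∀ z ∈ V, Complex.exp (L z) = curveX w₀ w₁ z) (hr : ∀ z ∈ V, r z ^ 2 = Podd w₀ w₁ 0 z)
    {z : ℂ} (hz : z ∈ V) : (Complex.exp (-(1 / 2) * L z) * (r z)⁻¹) ^ 2 = z⁻¹ := by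
  have hX := (hV hz).2
  have hz0 := (hV hz).1
  rw [mul_pow, inv_pow, hr z hz, Podd_zero, ← Complex.exp_nat_mul,
    show ((2 : ℕ) : ℂ) * (-(1 / 2) * L z) = -L z by push_cast; ring, Complex.exp_neg, hL z hz]
  field_simp

theorem tendsto_prefactor (hV : V ⊆ puncturedCurve w₀ w₁)
    (hL : ∀ z ∈ V, Complex.exp (L z) = curveX w₀ w₁ z)
    (hr : ∀ z ∈ V, r z ^ 2 = Podd w₀ w₁ 0 z) :
    Tendsto (fun z => Complex.exp (-(1 / 2) * L z) * (r z)⁻¹)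
      (Bornology.cobounded ℂ ⊓ 𝓟 V) (𝓝 0) := by
  have h : Tendsto (fun z : ℂ => √‖z⁻¹‖) (Bornology.cobounded ℂ ⊓ 𝓟 V) (𝓝 0) := by
    have h1 := (tendsto_inv₀_cobounded (α := ℂ)).norm.sqrt
    rw [norm_zero, Real.sqrt_zero] at h1
    exact h1.mono_left inf_le_left
  refine tendsto_zero_iff_norm_tendsto_zero.mpr (h.congr' ?_)
  filter_upwards [mem_inf_of_right (mem_principal_self V)] with z hz
  rw [← prefactor_sq hV hL hr hz, norm_pow, Real.sqrt_sq (norm_nonneg _)]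

theorem tendstoCoeff_expSeries_freeEnergySum (w₀ w₁ : ℂ) {ε : ℂ} (hε : ε ≠ 0) :
    TendstoCoeff (fun z => expSeries fun m => freeEnergySum w₀ w₁ (m + 1) (ε * z))
      (Bornology.cobounded ℂ) 1 := by
  rw [← expOf_zero]
  refine TendstoCoeff.expOf (a := fun z => PowerSeries.mk fun m =>
    if m = 0 then 0 else freeEnergySum w₀ w₁ (m + 1) (ε * z)) (fun n => ?_) (fun z => ?_)
    (map_zero _)
  · simp only [PowerSeries.coeff_mk, map_zero]
    split_ifs with hn
    · exact tendsto_const_nhds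
    · exact (tendsto_freeEnergySum w₀ w₁ (Nat.pos_of_ne_zero hn)).comp
        (tendsto_mul_left_cobounded hε)
  · rw [← PowerSeries.coeff_zero_eq_constantCoeff_apply, PowerSeries.coeff_mk, if_pos rfl]

/-- Simple connectedness supplies a continuous logarithm of the nonvanishing prefactor. Its
derivative -1/(2z) is that of ½F_2^{(0)}, by `integral_omegaHat2`. -/
theorem exists_log_prefactor (hVo : IsOpen V) (hVs : IsSimplyConnected V)
    (hV : V ⊆ puncturedCurve w₀ w₁)
    (hLc : ContinuousOn L V) (hL : ∀ z ∈ V, Complex.exp (L z) = curveX w₀ w₁ z)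
    (hrc : ContinuousOn r V) (hr : ∀ z ∈ V, r z ^ 2 = Podd w₀ w₁ 0 z) :
    ∃ ℓ : ℂ → ℂ, (∀ z ∈ V, Complex.exp (ℓ z) = Complex.exp (-(1 / 2) * L z) * (r z)⁻¹) ∧
      ∀ z ∈ V, HasDerivAt ℓ (-(1 / (2 * z))) z := by
  have hr0 : ∀ z ∈ V, r z ≠ 0 := fun z hz h => by
    have h1 := hr z hz
    rw [h, zero_pow two_ne_zero] at h1
    exact Podd_zero_ne_zero (hV hz) h1.symm
  have hqc : ContinuousOn (fun z => Complex.exp (-(1 / 2) * L z) * (r z)⁻¹) V :=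
    (hLc.const_mul _).cexp.mul (hrc.inv₀ hr0)
  obtain ⟨ℓ, hℓc, hℓ⟩ := Complex.exists_continuousOn_eqOn_exp_comp hVs hVo hqc (by
    rintro ⟨z, hz, h⟩
    exact mul_ne_zero (Complex.exp_ne_zero _) (inv_ne_zero (hr0 z hz)) h)
  refine ⟨ℓ, hℓ, fun z hz => ?_⟩
  have hz0 := (hV hz).1
  have h2 : ∀ z ∈ V, Complex.exp (2 * ℓ z) = z⁻¹ := fun z hz => by
    have h1 : Complex.exp (ℓ z) = Complex.exp (-(1 / 2) * L z) * (r z)⁻¹ := hℓ hz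
    rw [← prefactor_sq hV hL hr hz, ← h1, ← Complex.exp_nat_mul]
    push_cast
    rfl
  have h3 := (hasDerivAt_of_exp_eq hVo (hℓc.const_mul 2) h2 hz (hasDerivAt_inv hz0)).const_mul
    (1 / 2)
  have h4 : HasDerivAt (fun z => 1 / 2 * (2 * ℓ z)) (-(1 / (2 * z))) z := by
    refine h3.congr_deriv ?_
    field_simp
  exact h4.congr_of_eventuallyEq (Eventually.of_forall fun u => by ring)

/-- Two functions with the same derivative on a connected open set differ by a constant. -/
theorem exists_eq_add_const {f g f' : ℂ → ℂ} (hVo : IsOpen V) (hVc : IsPreconnected V)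
    (hf : ∀ z ∈ V, HasDerivAt f (f' z) z) (hg : ∀ z ∈ V, HasDerivAt g (f' z) z) :
    ∃ c, ∀ z ∈ V, f z = g z + c :=
  hVo.exists_eq_add_of_deriv_eq hVc
    (fun z hz => (hf z hz).differentiableAt.differentiableWithinAt)
    (fun z hz => (hg z hz).differentiableAt.differentiableWithinAt)
    fun z hz => by rw [(hf z hz).deriv, (hg z hz).deriv]

theorem hasDerivAt_comp_mul_left {f : ℂ → ℂ} {f' ε z : ℂ} (h : HasDerivAt f f' (ε * z)) :
    HasDerivAt (fun z => f (ε * z)) (ε * f') z := by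
  have h1 := h.comp z ((hasDerivAt_id z).const_mul ε)
  refine h1.congr_deriv ?_
  ring

end Regularization
end EquivariantCP1

end

/-! ### Comparison of the WKB solution with the wave function -/

theorem mainTheorem12 (w₀ w₁ : ℂ) (hw : w₀ - w₁ ≠ 0)
    (V : Set ℂ) (hVo : IsOpen V) (hVs : IsSimplyConnected V) (hV : V ⊆ puncturedCurve w₀ w₁)
    (L : ℂ → ℂ) (hLc : ContinuousOn L V) (hL : ∀ z ∈ V, Complex.exp (L z) = curveX w₀ w₁ z)
    (r : ℂ → ℂ) (hrc : ContinuousOn r V) (hr : ∀ z ∈ V, r z ^ 2 = Podd w₀ w₁ 0 z)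
    (γ : TurningPointPaths w₀ w₁ V)
    (ε : ℂ) (hε : ε = 1 ∨ ε = -1) :
    (∀ n : ℕ, Filter.Tendsto
      (fun z => PowerSeries.coeff n ((wkbSolution w₀ w₁ L r γ ε).amp z))
      (Bornology.cobounded ℂ ⊓ Filter.principal V) (nhds 0)) ∧
    (∃ F01 F02 : ℂ → ℂ,
      IsRegularizedF01 w₀ w₁ ((fun z => ε * z) '' V) F01 ∧
      IsRegularizedF02 ((fun z => ε * z) '' V) F02 ∧
      (wkbSolution w₀ w₁ L r γ ε).EqOn
        (((waveFunction w₀ w₁ F01 F02).comp fun z => ε * z).scale (1 / 2) 0 0) V) ∧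
    (∀ F01 F02 : ℂ → ℂ,
      IsRegularizedF01 w₀ w₁ ((fun z => ε * z) '' V) F01 →
      IsRegularizedF02 ((fun z => ε * z) '' V) F02 →
      ∃ c₀ c₁ : ℂ,
        (wkbSolution w₀ w₁ L r γ ε).EqOn
          (((waveFunction w₀ w₁ F01 F02).comp fun z => ε * z).scale (1 / 2) c₀ c₁) V) := by
  have hεε : ε * ε = 1 := by rcases hε with rfl | rfl <;> norm_num
  have hε0 : ε ≠ 0 := left_ne_zero_of_mul (hεε.trans_ne one_ne_zero)
  have hmem : ∀ {u : ℂ}, u ∈ (fun z => ε * z) '' V → ε * u ∈ V := by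
    rintro u ⟨z, hz, rfl⟩
    simp only
    rwa [← mul_assoc, hεε, one_mul]
  have hphase : ∀ z ∈ V, HasDerivAt (wkbSolution w₀ w₁ L r γ ε).phase
      (ε * omegaForm w₀ w₁ (ε * z)) z := fun z hz =>
    hasDerivAt_wkbSolution_phase hVo hV hLc hL r γ hεε hz
  obtain ⟨ℓ, hℓ, hℓ'⟩ := exists_log_prefactor hVo hVs hV hLc hL hrc hr
  refine ⟨fun n => ?_, ?_, ?_⟩
  · have h := (tendsto_prefactor hV hL hr).mul
      ((tendstoCoeff_expSeries_freeEnergySum w₀ w₁ hε0 n).mono_left inf_le_left)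
    rw [zero_mul] at h
    refine h.congr' ?_
    filter_upwards [Filter.mem_inf_of_right (Filter.mem_principal_self V)] with z hz
    rw [wkbSolution_amp hV L r γ hε hz, PowerSeries.coeff_C_mul]
  -- The regularizations are read off from the WKB solution itself, as its phase and twice the
  -- logarithm of its prefactor, so that both constants vanish. They are transported to the image of
  -- V by u ↦ εu, which is its own inverse.
  · refine ⟨fun u => (wkbSolution w₀ w₁ L r γ ε).phase (ε * u), fun u => 2 * ℓ (ε * u),
      fun u hu => ?_, fun u hu => ?_, ?_, fun z hz => ⟨?_, ?_⟩⟩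
    · refine (hasDerivAt_comp_mul_left (hphase _ (hmem hu))).congr_deriv ?_
      rw [← mul_assoc, hεε, one_mul, ← mul_assoc, hεε, one_mul]
    · have hu0 : u ≠ 0 := right_ne_zero_of_mul (hV (hmem hu)).1
      refine ((hasDerivAt_comp_mul_left (hℓ' _ (hmem hu))).const_mul 2).congr_deriv ?_
      rw [integral_omegaHat2 hu0]
      field_simp
    · simp [wkbSolution, waveFunction, FormalWKB.comp, FormalWKB.scale]
    · simp only [FormalWKB.comp, FormalWKB.scale, waveFunction]
      rw [← mul_assoc, hεε, one_mul, add_zero]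
    · simp only [FormalWKB.comp, FormalWKB.scale, waveFunction]
      rw [wkbSolution_amp hV L r γ hε hz, ← mul_assoc ε, hεε, one_mul, ← mul_assoc (1 / 2 : ℂ),
        one_div_mul_cancel two_ne_zero, one_mul, hℓ z hz, Complex.exp_zero, map_one, one_mul]
  · intro F01 F02 hF01 hF02
    -- Any other regularization has the same derivatives on the connected set V, for the phase and
    -- for the logarithm of the prefactor alike, which gives c₀ and c₁.
    obtain ⟨c₀, hc₀⟩ := exists_eq_add_const (g := fun z => F01 (ε * z)) hVo
      hVs.isPathConnected.isConnected.isPreconnected hphase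
      fun z hz => hasDerivAt_comp_mul_left (hF01 _ ⟨z, hz, rfl⟩)
    obtain ⟨c₁, hc₁⟩ := exists_eq_add_const (g := fun z => 1 / 2 * F02 (ε * z)) hVo
      hVs.isPathConnected.isConnected.isPreconnected hℓ' fun z hz => by
        have hz0 := (hV hz).1
        refine ((hasDerivAt_comp_mul_left (hF02 _ ⟨z, hz, rfl⟩)).const_mul (1 / 2)).congr_deriv ?_
        rw [integral_omegaHat2 (mul_ne_zero hε0 hz0)]
        field_simp
    refine ⟨c₀, c₁, ?_, fun z hz => ⟨hc₀ z hz, ?_⟩⟩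
    · simp [wkbSolution, waveFunction, FormalWKB.comp, FormalWKB.scale]
    · simp only [FormalWKB.comp, FormalWKB.scale, waveFunction]
      rw [wkbSolution_amp hV L r γ hε hz, ← mul_assoc, ← map_mul, ← Complex.exp_add, add_comm c₁,
        ← hc₁ z hz, hℓ z hz]
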